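/- For positive integers $m,s,n$ with $n\ge 3$ and $r\in\mathbb Z_n^*$ with $r^{ms}=\pm1$, let $\overline{\mathrm{CPM}}(m,s,n;r)$ be the graph whose vertices are the pairs $\langle i;\mathbf v\rangle$ with $i\in\mathbb Z_{ms}$, $\mathbf v\in\mathbb Z_n^s$, and whose adjacencies are $$\langle i;\mathbf v\rangle\sim\langle i+1;\mathbf v\pm r^i\mathbf e_\ell\rangle,\qquad \ell = i \bmod s,$$ where $\mathbf e_0,\dots,\mathbf e_{s-1}$ are the standard vectors of $\mathbb Z_n^s$. Let $\mathrm{CPM}(m,s,n;r)$ be the connected component of $\overline{\mathrm{CPM}}(m,s,n;r)$ that contains $\langle 0;\mathbf 0\rangle$. Let $m,s,n,m',s',n'$ be positive integers with $n,n'\ge 3$, $n,n'\ne 4$, $s,s'\ge 2$, $ms\ge 3$ and $m's'\ge 3$, and let $r\in\mathbb Z_n^*$ and $r'\in\mathbb Z_{n'}^*$ satisfy $r^{ms}=\pm1$ and $r'^{\,m's'}=\pm1$. Assume that each of $n$ and $n'$ is odd or divisible by $4$, that $m$ is even if $n$ is even, and that $m'$ is even if $n'$ is even. Suppose that the graphs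 $\mathrm{CPM}(m,s,n;r)$ and $\mathrm{CPM}(m',s',n';r')$ are isomorphic. Then $m=m'$, $s=s'$, $n=n'$, and one of the following holds in $\mathbb Z_n$: (i) $(rr')^s=\pm1$ or $(r^{-1}r')^s=\pm1$; (ii) $n$ is divisible by $4$, $m$ is even, and at least one of the four equalities $2((rr')^s\pm1)=0$, $2((r^{-1}r')^s\pm1)=0$ holds. -/

import Mathlib

/-- The `ℓ`-th standard vector `e_ℓ` of `(ℤ/n)^s`, coordinates being numbered `0, …, s - 1`. -/
def stdVec (s n ℓ : ℕ) : Fin s → ZMod n :=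
  fun j => if (j : ℕ) = ℓ then 1 else 0

/-- The vertices `⟨i; v⟩` with `i ∈ ℤ/(ms)` and `v ∈ (ℤ/n)^s`. -/
abbrev CPMVertex (m s n : ℕ) : Type :=
  ZMod (m * s) × (Fin s → ZMod n)

/-- `CPMStep m s n r x y` says that `x = ⟨i; v⟩` and `y = ⟨i + 1; v ± r ^ i e_ℓ⟩`, where
`ℓ = i mod s` and `i` is represented by its least non-negative residue modulo `ms`. -/
def CPMStep (m s n : ℕ) (r : (ZMod n)ˣ) (x y : CPMVertex m s n) : Prop :=
  y.1 = x.1 + 1 ∧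
    (y.2 = x.2 + (r : ZMod n) ^ x.1.val • stdVec s n (x.1.val % s) ∨
      y.2 = x.2 - (r : ZMod n) ^ x.1.val • stdVec s n (x.1.val % s))

/-- The (possibly disconnected) graph on all the vertices `⟨i; v⟩`, with
`⟨i; v⟩ ∼ ⟨i + 1; v ± r ^ i e_ℓ⟩`. -/
def CPMBar (m s n : ℕ) (r : (ZMod n)ˣ) : SimpleGraph (CPMVertex m s n) :=
  SimpleGraph.fromRel (CPMStep m s n r)

/-- The vertex set of the connected component of `⟨0; 0⟩`. -/
def CPMSupp (m s n : ℕ) (r : (ZMod n)ˣ) : Set (CPMVertex m s n) :=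
  ((CPMBar m s n r).connectedComponentMk (0, 0)).supp

/-- The graph `CPM(m, s, n; r)`: the connected component of `⟨0; 0⟩`. -/
def CPM (m s n : ℕ) (r : (ZMod n)ˣ) : SimpleGraph (CPMSupp m s n r) :=
  (CPMBar m s n r).induce (CPMSupp m s n r)

/-- The standing assumption on the parameters `m, s, n, r`. -/
structure CPMParams (m s n : ℕ) (r : (ZMod n)ˣ) : Prop where
  m_pos : 0 < m
  two_le_s : 2 ≤ s
  three_le_n : 3 ≤ n
  n_ne_four : n ≠ 4
  three_le_ms : 3 ≤ m * s
  pow_eq : r ^ (m * s) = 1 ∨ r ^ (m * s) = -1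

/-- The parity normalization: `n` is odd or divisible by `4`, and `m` is even if `n` is even. -/
def CPMNormalized (m n : ℕ) : Prop :=
  (Odd n ∨ 4 ∣ n) ∧ (Even n → Even m)

/-- The element of `(ℤ/k)ˣ` that an element of `(ℤ/n)ˣ` is when `n = k`. -/
def unitCongr {n k : ℕ} (h : n = k) (r : (ZMod n)ˣ) : (ZMod k)ˣ :=
  Units.mapEquiv (ZMod.ringEquivCongr h : ZMod n ≃* ZMod k) r

/-!
Write `ρ = r ^ s`. The graph `CPMBar m s n r` is covered by a layered graph on `ℤ × (ℤ/n)^s`, in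
which four moves start at each vertex: up or down by one layer, with a positive or a negative sign.
Walks are therefore words in four letters. Whether a walk is closed in `CPMBar` depends on its word
only (`proj_run_eq_iff`): for each class of layers modulo `s`, a Laurent polynomial in `ρ` with
integral coefficients has to vanish, and the word has to rise by a multiple of `ms`. An isomorphism
of the graphs lifts to a correspondence of the covers (`corr_isoRel`), which respects closed words,
and hence also the numbers of closed extensions of corresponding words (`Corr.cnt_eq`).

Suppose first that the correspondence preserves the directions of all moves, or reverses them all. A
walk that alternates between two layers closes after `2k` steps exactly if `2k = 0` in `ℤ/n`, which
shows that `2` has the same order in `ℤ/n` and `ℤ/n'` (`Corr.addOrderOf_dvd`); as `n` and `n'` are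
odd or divisible by `4`, they are equal. A closed walk that links two layers at distance `s` yields
`s = s'` and `2ρ' = ±2ρ` or `2ρ'⁻¹ = ±2ρ` (`Corr.eq_of_directed_of_le`). The component has
`m s N ^ s` vertices, where `N` is the order of `2` (`card_CPMSupp`), so `m = m'`. The assertion
follows, on cancelling the factor `2` when `n` is odd.

If the correspondence mixes directions at some vertex, then conjugating a reflection in one
coordinate with it produces a symmetry of the first cover that fixes a vertex and one of its upper
neighbours, and takes the other upper neighbour to a lower one (`Corr.twisted`). Such a twist is
rare (`Twisted.classification`): counting closed words of at most eight letters excludes it unless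
`s = 2` and `2ρ = ±2`. In that case the same counts show that zigzags correspond to straight walks
and that certain straight walks correspond to walks between three layers; comparing the lengths
after which these close gives `m = N`. If both graphs have twists, then the number of vertices,
`2 N ^ 3`, determines all parameters; if one of them has none, the correspondence is directed.

The counts are bounded by evaluation in the kernel: from above by the words that close unless one of
finitely many polynomials known not to vanish at `ρ` does vanish (`maybeTest`), and from below by
the words that close because finitely many polynomials known to vanish do so (`closeTest`).
-/

namespace CPMWord

/-! ### Words and the layered cover -/

/-- A letter says how a walk moves: the first entry is `true` when the layer goes up, the second
is `true` when a positive multiple of the relevant standard vector is added. -/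
abbrev Letter := Bool × Bool

/-- The sign encoded by a Boolean. -/
def sgn (b : Bool) : ℤ := if b then 1 else -1

/-- The letter that undoes a given letter. -/
def inv (a : Letter) : Letter := (!a.1, !a.2)

/-- The lower layer of the edge traversed by the letter `a` from the layer `h`. -/
def gap (h : ℤ) (a : Letter) : ℤ := if a.1 then h else h - 1

/-- The number of layers by which a word rises. -/
def net : List Letter → ℤ
  | [] => 0
  | a :: l => sgn a.1 + net l

/-- The list of pairs (gap, sign) of the letters of a word that starts in the layer `h`. -/
def terms : ℤ → List Letter → List (ℤ × ℤ)
  | _, [] => []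
  | h, a :: l => (gap h a, sgn a.2) :: terms (h + sgn a.1) l

/-- The vertices of the cover of `CPMBar` in which the layers are numbered by `ℤ`. -/
abbrev Cover (s n : ℕ) : Type := ℤ × (Fin s → ZMod n)

/-- The vector `r ^ g e_ℓ`, with `ℓ = g mod s`, that is added between the layers `g` and `g + 1`. -/
def edgeVec (s : ℕ) {n : ℕ} (r : (ZMod n)ˣ) (g : ℤ) : Fin s → ZMod n :=
  ((r ^ g : (ZMod n)ˣ) : ZMod n) • stdVec s n (g % s).toNat

/-- The neighbour of a vertex of the cover in the direction of a letter. -/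
def move {s n : ℕ} (r : (ZMod n)ˣ) (y : Cover s n) (a : Letter) : Cover s n :=
  (y.1 + sgn a.1, y.2 + sgn a.2 • edgeVec s r (gap y.1 a))

/-- The end of the walk that reads a word. -/
def run {s n : ℕ} (r : (ZMod n)ˣ) (y : Cover s n) (l : List Letter) : Cover s n :=
  l.foldl (move r) y

/-- The projection of the cover onto the vertex set of `CPMBar`. -/
def proj (m : ℕ) {s n : ℕ} (y : Cover s n) : CPMVertex m s n :=
  ((y.1 : ZMod (m * s)), y.2)

@[simp] theorem inv_inv (a : Letter) : inv (inv a) = a := by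
  simp [inv]

@[simp] theorem run_nil {s n : ℕ} (r : (ZMod n)ˣ) (y : Cover s n) : run r y [] = y := rfl

@[simp] theorem run_cons {s n : ℕ} (r : (ZMod n)ˣ) (y : Cover s n) (a : Letter)
    (l : List Letter) : run r y (a :: l) = run r (move r y a) l := rfl

theorem run_append {s n : ℕ} (r : (ZMod n)ˣ) (y : Cover s n) (l₁ l₂ : List Letter) :
    run r y (l₁ ++ l₂) = run r (run r y l₁) l₂ := by
  simp [run]

theorem sgn_not (b : Bool) : sgn (!b) = -sgn b := by
  cases b <;> rfl

theorem move_inv {s n : ℕ} (r : (ZMod n)ˣ) (y : Cover s n) (a : Letter) :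
    move r (move r y a) (inv a) = y := by
  obtain ⟨d, e⟩ := a
  have hg : gap (y.1 + sgn d) (!d, !e) = gap y.1 (d, e) := by
    cases d <;> simp [gap, sgn]
    ring
  refine Prod.ext ?_ ?_
  · simp [move, inv, sgn_not]
  · simp only [move, inv]
    rw [hg, sgn_not]
    simp

section
variable {m s n : ℕ} {r : (ZMod n)ˣ}

theorem neg_one_zpow_eq {G : Type*} [Group G] [HasDistribNeg G] (q : ℤ) :
    (-1 : G) ^ q = 1 ∨ (-1 : G) ^ q = -1 := by
  rcases Int.even_or_odd' q with ⟨k, rfl | rfl⟩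
  · left
    rw [zpow_mul]
    simp
  · right
    rw [zpow_add, zpow_mul]
    simp

/-- The vector attached to a layer modulo `ms` agrees up to sign with the one attached to a layer
of the cover above it; this is where `r ^ (ms) = ±1` is used. -/
theorem edgeVec_proj (P : CPMParams m s n r) (j : ℤ) :
    (r : ZMod n) ^ ((j : ZMod (m * s)).val) • stdVec s n ((j : ZMod (m * s)).val % s)
        = edgeVec s r j ∨
      (r : ZMod n) ^ ((j : ZMod (m * s)).val) • stdVec s n ((j : ZMod (m * s)).val % s)
        = -edgeVec s r j := by
  have hms := P.three_le_ms
  have : NeZero (m * s) := ⟨by omega⟩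
  set i : ℕ := (j : ZMod (m * s)).val with hi
  have hv : (i : ℤ) = j % ((m * s : ℕ) : ℤ) := ZMod.val_intCast (n := m * s) j
  have hj : j = (i : ℤ) + ((m * s : ℕ) : ℤ) * (j / ((m * s : ℕ) : ℤ)) := by
    rw [hv]; exact (Int.emod_add_mul_ediv j _).symm
  have hidx : (j % (s : ℤ)).toNat = i % s := by
    have : ((i % s : ℕ) : ℤ) = j % (s : ℤ) := by
      push_cast
      rw [hv]
      exact Int.emod_emod_of_dvd j (by push_cast; exact Dvd.intro_left _ rfl)
    omega
  have hpow : r ^ j = r ^ i ∨ r ^ j = -r ^ i := by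
    have h1 : r ^ j = r ^ i * (r ^ (m * s)) ^ (j / ((m * s : ℕ) : ℤ)) := by
      conv_lhs => rw [hj]
      rw [zpow_add, zpow_mul, zpow_natCast, zpow_natCast]
    rcases P.pow_eq with h | h
    · left; rw [h1, h]; simp
    · rw [h1, h]
      rcases neg_one_zpow_eq (G := (ZMod n)ˣ) (j / ((m * s : ℕ) : ℤ)) with h' | h' <;> rw [h']
      · left; simp
      · right; simp
  unfold edgeVec
  rw [hidx]
  rcases hpow with h | h
  · left; rw [h]; simp
  · right; rw [h]; simp

theorem proj_eq_iff {y y' : Cover s n} :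
    proj m y = proj m y' ↔ ((m * s : ℕ) : ℤ) ∣ y'.1 - y.1 ∧ y.2 = y'.2 := by
  unfold proj
  rw [Prod.ext_iff]
  simp only
  rw [ZMod.intCast_eq_intCast_iff_dvd_sub]

theorem proj_surjective (P : CPMParams m s n r) (x : CPMVertex m s n) :
    ∃ y : Cover s n, proj m y = x := by
  have hms := P.three_le_ms
  have : NeZero (m * s) := ⟨by omega⟩
  exact ⟨((x.1.val : ℤ), x.2), Prod.ext (by simp [proj]) rfl⟩

theorem step_proj_left (P : CPMParams m s n r) (y : Cover s n) (x : CPMVertex m s n) :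
    CPMStep m s n r (proj m y) x ↔ ∃ e, x = proj m (move r y (true, e)) := by
  have hE := edgeVec_proj P y.1
  unfold CPMStep
  constructor
  · rintro ⟨h1, h2⟩
    have h1' : ∀ e, x.1 = (proj m (move r y (true, e))).1 := by
      intro e; rw [h1]; simp [proj, move, sgn]
    rcases hE with hE | hE <;> simp only [proj] at h2 <;> rw [hE] at h2 <;> rcases h2 with h2 | h2
    · exact ⟨true, Prod.ext (h1' _) (by rw [h2]; simp [proj, move, sgn, gap])⟩
    · exact ⟨false, Prod.ext (h1' _) (by rw [h2]; simp [proj, move, sgn, gap, sub_eq_add_neg])⟩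
    · exact ⟨false, Prod.ext (h1' _) (by rw [h2]; simp [proj, move, sgn, gap])⟩
    · exact ⟨true, Prod.ext (h1' _) (by rw [h2]; simp [proj, move, sgn, gap])⟩
  · rintro ⟨e, rfl⟩
    refine ⟨by simp [proj, move, sgn], ?_⟩
    simp only [proj]
    rcases hE with hE | hE <;> rw [hE] <;> cases e <;> simp [move, sgn, gap, sub_eq_add_neg]

theorem step_proj_right (P : CPMParams m s n r) (y : Cover s n) (x : CPMVertex m s n) :
    CPMStep m s n r x (proj m y) ↔ ∃ e, x = proj m (move r y (false, e)) := by
  constructor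
  · intro h
    have hx : x = proj m ((y.1 - 1, x.2) : Cover s n) := by
      refine Prod.ext ?_ rfl
      have := h.1
      simp only [proj] at this ⊢
      push_cast
      rw [this]; ring
    rw [hx, step_proj_left P] at h
    obtain ⟨e, he⟩ := h
    rw [proj_eq_iff] at he
    refine ⟨!e, ?_⟩
    rw [hx, proj_eq_iff]
    refine ⟨by simp [move, sgn], ?_⟩
    have h2 := he.2
    simp only [move, gap] at h2 ⊢
    simp only [if_true] at h2
    rw [h2, sgn_not]
    simp
  · rintro ⟨e, rfl⟩
    rw [step_proj_left P]
    exact ⟨!e, by rw [show ((true, !e) : Letter) = inv (false, e) from rfl, move_inv]⟩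

/-- The cover is locally bijective: the neighbours of a vertex are the projections of the four
moves from a lift. -/
theorem adj_proj_iff (P : CPMParams m s n r) (y : Cover s n) (x : CPMVertex m s n) :
    (CPMBar m s n r).Adj (proj m y) x ↔ ∃ a, x = proj m (move r y a) := by
  have hms := P.three_le_ms
  unfold CPMBar
  rw [SimpleGraph.fromRel_adj, step_proj_left P, step_proj_right P]
  constructor
  · rintro ⟨-, ⟨e, he⟩ | ⟨e, he⟩⟩
    exacts [⟨_, he⟩, ⟨_, he⟩]
  · rintro ⟨⟨d, e⟩, rfl⟩
    refine ⟨?_, ?_⟩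
    · rw [Ne, proj_eq_iff]
      rintro ⟨h, -⟩
      have h3 : (3 : ℤ) ≤ ((m * s : ℕ) : ℤ) := by exact_mod_cast hms
      have := Int.le_of_dvd (a := ((m * s : ℕ) : ℤ)) (b := 1) one_pos (by
        cases d
        · rw [← dvd_neg]; simpa [move, sgn] using h
        · simpa [move, sgn] using h)
      omega
    · cases d
      · exact Or.inr ⟨e, rfl⟩
      · exact Or.inl ⟨e, rfl⟩

theorem one_ne_zero_of (P : CPMParams m s n r) : (1 : ZMod n) ≠ 0 := by
  have := P.three_le_n
  have : Fact (1 < n) := ⟨by omega⟩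
  exact one_ne_zero

theorem two_ne_zero_of (P : CPMParams m s n r) : (2 : ZMod n) ≠ 0 := by
  have h3 := P.three_le_n
  have : ((2 : ℕ) : ZMod n) ≠ 0 := by
    rw [Ne, ZMod.natCast_eq_zero_iff]
    intro h
    have := Nat.le_of_dvd (by norm_num) h
    omega
  exact_mod_cast this

theorem four_ne_zero_of (P : CPMParams m s n r) : (4 : ZMod n) ≠ 0 := by
  have h3 := P.three_le_n
  have h4 := P.n_ne_four
  have : ((4 : ℕ) : ZMod n) ≠ 0 := by
    rw [Ne, ZMod.natCast_eq_zero_iff]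
    intro h
    have := Nat.le_of_dvd (by norm_num) h
    interval_cases n <;> omega
  exact_mod_cast this

theorem isUnit_two_of_odd (h : Odd n) : IsUnit (2 : ZMod n) := by
  have := (ZMod.isUnit_iff_coprime 2 n).2 (Nat.coprime_two_left.2 h)
  exact_mod_cast this

/-- The coordinate that changes between the layers `g` and `g + 1`. -/
def idx (P : CPMParams m s n r) (g : ℤ) : Fin s :=
  ⟨(g % s).toNat, by
    have hs : (0 : ℤ) < s := by have := P.two_le_s; omega
    have := Int.emod_lt_of_pos g hs
    have := Int.emod_nonneg g hs.ne'
    omega⟩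

theorem idx_eq_iff (P : CPMParams m s n r) {g h : ℤ} : idx P g = idx P h ↔ (s : ℤ) ∣ g - h := by
  have hs : (0 : ℤ) < s := by have := P.two_le_s; omega
  have h1 := Int.emod_nonneg g hs.ne'
  have h2 := Int.emod_nonneg h hs.ne'
  rw [Int.dvd_iff_emod_eq_zero, ← Int.emod_eq_emod_iff_emod_sub_eq_zero, Fin.ext_iff]
  simp only [idx]
  omega

end

/-! ### Closing words -/

/-- The coordinate sum of a list of (gap, sign) pairs over the gaps congruent to `c` modulo `s`,
divided by the power of `r` attached to the gap `c`; here `ρ = r ^ s`. -/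
def cval (s : ℕ) {n : ℕ} (ρ : (ZMod n)ˣ) (c : ℤ) (ts : List (ℤ × ℤ)) : ZMod n :=
  (ts.map fun t => if (s : ℤ) ∣ t.1 - c then
    (t.2 : ZMod n) * ((ρ ^ ((t.1 - c) / s) : (ZMod n)ˣ) : ZMod n) else 0).sum

/-- A word closes if the walks in `CPMBar` that read it return to their start. The condition does
not depend on the start, see `proj_run_eq_iff`. -/
def Closes (m s : ℕ) {n : ℕ} (r : (ZMod n)ˣ) (l : List Letter) : Prop :=
  ((m * s : ℕ) : ℤ) ∣ net l ∧ ∀ c : ℤ, cval s (r ^ s) c (terms 0 l) = 0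

theorem net_cons (a : Letter) (l : List Letter) : net (a :: l) = sgn a.1 + net l := rfl

section
variable {m s n : ℕ} {r : (ZMod n)ˣ}

theorem run_fst (y : Cover s n) (l : List Letter) : (run r y l).1 = y.1 + net l := by
  induction l generalizing y with
  | nil => simp [net]
  | cons a l ih =>
    rw [run_cons, ih, net_cons]
    simp [move, add_assoc]

theorem run_snd (y : Cover s n) (l : List Letter) :
    (run r y l).2 = y.2 + ((terms y.1 l).map fun t => t.2 • edgeVec s r t.1).sum := by
  induction l generalizing y with
  | nil => simp [terms]
  | cons a l ih =>
    rw [run_cons, ih, terms]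
    simp [move, add_assoc]

theorem terms_shift (h k : ℤ) (l : List Letter) :
    terms (h + k) l = (terms k l).map fun t => (h + t.1, t.2) := by
  induction l generalizing k with
  | nil => rfl
  | cons a l ih =>
    simp only [terms, List.map_cons]
    rw [add_assoc, ih]
    congr 2
    unfold gap
    split_ifs <;> ring

theorem edgeVec_apply_idx (P : CPMParams m s n r) (j g c : ℤ) :
    edgeVec s r (j + g) (idx P (j + c)) =
      if (s : ℤ) ∣ g - c then
        ((r ^ (j + c) : (ZMod n)ˣ) : ZMod n) * (((r ^ s) ^ ((g - c) / s) : (ZMod n)ˣ) : ZMod n)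
      else 0 := by
  have h := idx_eq_iff P (g := j + g) (h := j + c)
  rw [show j + g - (j + c) = g - c by ring, Fin.ext_iff] at h
  simp only [edgeVec, Pi.smul_apply, stdVec, smul_eq_mul, mul_ite, mul_one, mul_zero]
  change (if ((idx P (j + c)) : ℕ) = ((idx P (j + g)) : ℕ) then _ else _) = _
  by_cases hd : (s : ℤ) ∣ g - c
  · rw [if_pos (h.2 hd).symm, if_pos hd, ← Units.val_mul]
    congr 1
    obtain ⟨q, hq⟩ := hd
    have hs : (s : ℤ) ≠ 0 := by have := P.two_le_s; omega
    rw [hq, Int.mul_ediv_cancel_left _ hs, ← zpow_natCast, ← zpow_mul, ← zpow_add, ← hq]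
    congr 1
    ring
  · rw [if_neg (fun e => hd (h.1 e.symm)), if_neg hd]

/-- The coordinates of the end of a walk, in terms of its word. -/
theorem run_snd_apply (P : CPMParams m s n r) (y : Cover s n) (l : List Letter) (c : ℤ) :
    (run r y l).2 (idx P (y.1 + c)) = y.2 (idx P (y.1 + c)) +
      ((r ^ (y.1 + c) : (ZMod n)ˣ) : ZMod n) * cval s (r ^ s) c (terms 0 l) := by
  rw [run_snd, Pi.add_apply]
  congr 1
  have := terms_shift y.1 0 l
  rw [add_zero] at this
  rw [this]
  generalize terms 0 l = ts
  unfold cval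
  induction ts with
  | nil => simp
  | cons t ts ih =>
    simp only [List.map_cons, List.sum_cons, Pi.add_apply, mul_add]
    rw [ih, Pi.smul_apply, edgeVec_apply_idx P]
    congr 1
    split_ifs with hd
    · rw [zsmul_eq_mul]; ring
    · simp

theorem exists_idx_eq (P : CPMParams m s n r) (j : ℤ) (i : Fin s) :
    ∃ c, idx P (j + c) = i := by
  refine ⟨(i : ℕ) - j, ?_⟩
  have hi := i.2
  rw [Fin.ext_iff]
  simp only [idx]
  rw [show j + (((i : ℕ) : ℤ) - j) = ((i : ℕ) : ℤ) by ring,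
    Int.emod_eq_of_lt (by omega) (by omega)]
  simp

/-- A walk returns to its start modulo `ms` if and only if its word closes. -/
theorem proj_run_eq_iff (P : CPMParams m s n r) (y : Cover s n) (l : List Letter) :
    proj m (run r y l) = proj m y ↔ Closes m s r l := by
  rw [proj_eq_iff, run_fst]
  refine and_congr ?_ ⟨fun h c => ?_, fun h => ?_⟩
  · rw [show y.1 - (y.1 + net l) = -net l by ring, dvd_neg]
  · have := run_snd_apply P y l c
    rw [h, left_eq_add] at this
    exact (Units.mul_right_eq_zero _).1 this
  · funext i
    obtain ⟨c, rfl⟩ := exists_idx_eq P y.1 i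
    rw [run_snd_apply P, h c]
    simp

/-- The four neighbours of a vertex are distinct, also in `CPMBar`. -/
theorem proj_move_injective (P : CPMParams m s n r) (y : Cover s n) {a b : Letter}
    (h : proj m (move r y a) = proj m (move r y b)) : a = b := by
  rw [proj_eq_iff] at h
  obtain ⟨h1, h2⟩ := h
  obtain ⟨d, e⟩ := a
  obtain ⟨d', e'⟩ := b
  have h3 : (3 : ℤ) ≤ ((m * s : ℕ) : ℤ) := by exact_mod_cast P.three_le_ms
  have hd : d = d' := by
    by_contra hne
    have : ((m * s : ℕ) : ℤ) ∣ 2 := by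
      cases d <;> cases d' <;> simp [move, sgn] at h1 hne ⊢
      · ring_nf at h1 ⊢
        exact h1
      · ring_nf at h1 ⊢
        exact h1
    have := Int.le_of_dvd two_pos this
    omega
  subst hd
  by_contra hne
  have hee : e' = !e := by
    cases e <;> cases e' <;> simp_all
  subst hee
  simp only [move] at h2
  rw [sgn_not] at h2
  have h4 := congrFun (add_left_cancel h2) (idx P (gap y.1 (d, e)))
  have hg : gap y.1 (d, !e) = gap y.1 (d, e) := by simp [gap]
  rw [hg] at h4
  have h5 := edgeVec_apply_idx P 0 (gap y.1 (d, e)) (gap y.1 (d, e))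
  rw [if_pos (by simp), zero_add] at h5
  simp only [Pi.smul_apply, neg_smul] at h4
  rw [h5] at h4
  have h6 : ((r ^ gap y.1 (d, e) : (ZMod n)ˣ) : ZMod n) * 2 = 0 := by
    have : (s : ℤ) ≠ 0 := by have := P.two_le_s; omega
    cases e <;> simp [sgn] at h4
    · linear_combination -h4
    · linear_combination h4
  exact two_ne_zero_of P ((Units.mul_right_eq_zero _).1 h6)

end

/-! ### Correspondences between covers -/

section
variable {m s n m' s' n' : ℕ} {r : (ZMod n)ˣ} {r' : (ZMod n')ˣ}

/-- A correspondence between two covers: the lift of an isomorphism between connected components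
of the graphs below. -/
structure Corr (m m' : ℕ) {s n s' n' : ℕ} (r : (ZMod n)ˣ) (r' : (ZMod n')ˣ)
    (R : Cover s n → Cover s' n' → Prop) : Prop where
  fwd : ∀ {y y'}, R y y' → ∀ a, ∃ a', R (move r y a) (move r' y' a')
  bwd : ∀ {y y'}, R y y' → ∀ a', ∃ a, R (move r y a) (move r' y' a')
  proj_iff : ∀ {y₁ y₂ y₁' y₂'}, R y₁ y₁' → R y₂ y₂' →
    (proj m y₁ = proj m y₂ ↔ proj m' y₁' = proj m' y₂')

/-- Two words of equal length, read from two given vertices, correspond letter by letter. -/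
def WRel (r : (ZMod n)ˣ) (r' : (ZMod n')ˣ) (R : Cover s n → Cover s' n' → Prop) :
    Cover s n → Cover s' n' → List Letter → List Letter → Prop
  | y, y', [], [] => R y y'
  | y, y', a :: l, a' :: l' => R y y' ∧ WRel r r' R (move r y a) (move r' y' a') l l'
  | _, _, _, _ => False

variable {R : Cover s n → Cover s' n' → Prop}

theorem Corr.symm (C : Corr m m' r r' R) : Corr m' m r' r (fun y' y => R y y') :=
  ⟨fun h a => C.bwd h a, fun h a => C.fwd h a, fun h₁ h₂ => (C.proj_iff h₁ h₂).symm⟩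

theorem WRel.symm {y : Cover s n} {y' : Cover s' n'} {l l' : List Letter}
    (h : WRel r r' R y y' l l') : WRel r' r (fun y' y => R y y') y' y l' l := by
  induction l generalizing y y' l' with
  | nil => cases l' <;> simp [WRel] at h ⊢; exact h
  | cons a l ih =>
    cases l' with
    | nil => simp [WRel] at h
    | cons a' l' => exact ⟨h.1, ih h.2⟩

theorem WRel.base {y : Cover s n} {y' : Cover s' n'} {l l' : List Letter}
    (h : WRel r r' R y y' l l') : R y y' := by
  cases l <;> cases l' <;> simp [WRel] at h
  · exact h
  · exact h.1

theorem WRel.length_eq {y : Cover s n} {y' : Cover s' n'} {l l' : List Letter}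
    (h : WRel r r' R y y' l l') : l.length = l'.length := by
  induction l generalizing y y' l' with
  | nil => cases l' <;> simp [WRel] at h ⊢
  | cons a l ih =>
    cases l' with
    | nil => simp [WRel] at h
    | cons a' l' => simpa using ih h.2

theorem WRel.run_rel {y : Cover s n} {y' : Cover s' n'} {l l' : List Letter}
    (h : WRel r r' R y y' l l') : R (run r y l) (run r' y' l') := by
  induction l generalizing y y' l' with
  | nil => cases l' <;> simp [WRel] at h ⊢; exact h
  | cons a l ih =>
    cases l' with
    | nil => simp [WRel] at h
    | cons a' l' =>
      have := ih h.2
      simpa using this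

theorem WRel.append {y : Cover s n} {y' : Cover s' n'} {l₁ l₁' l₂ l₂' : List Letter}
    (h₁ : WRel r r' R y y' l₁ l₁') (h₂ : WRel r r' R (run r y l₁) (run r' y' l₁') l₂ l₂') :
    WRel r r' R y y' (l₁ ++ l₂) (l₁' ++ l₂') := by
  induction l₁ generalizing y y' l₁' with
  | nil => cases l₁' <;> simp [WRel] at h₁ h₂ ⊢; exact h₂
  | cons a l ih =>
    cases l₁' with
    | nil => simp [WRel] at h₁
    | cons a' l' => exact ⟨h₁.1, ih h₁.2 h₂⟩

theorem Corr.closes_iff (C : Corr m m' r r' R) (P : CPMParams m s n r)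
    (P' : CPMParams m' s' n' r') {y : Cover s n} {y' : Cover s' n'} {l l' : List Letter}
    (h : WRel r r' R y y' l l') : Closes m s r l ↔ Closes m' s' r' l' := by
  rw [← proj_run_eq_iff P y, ← proj_run_eq_iff P' y']
  exact C.proj_iff h.run_rel h.base

theorem Corr.letter_unique (C : Corr m m' r r' R) (P' : CPMParams m' s' n' r')
    {y : Cover s n} {y' : Cover s' n'} {a b b' : Letter}
    (h₁ : R (move r y a) (move r' y' b)) (h₂ : R (move r y a) (move r' y' b')) : b = b' :=
  proj_move_injective P' y' ((C.proj_iff h₁ h₂).1 rfl)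

theorem Corr.letter_iff (C : Corr m m' r r' R) (P : CPMParams m s n r)
    (P' : CPMParams m' s' n' r') {y : Cover s n} {y' : Cover s' n'} {a a' b b' : Letter}
    (h₁ : R (move r y a) (move r' y' a')) (h₂ : R (move r y b) (move r' y' b')) :
    a = b ↔ a' = b' := by
  constructor
  · rintro rfl
    exact C.letter_unique P' h₁ h₂
  · rintro rfl
    exact C.symm.letter_unique P h₁ h₂

/-- At corresponding vertices, the correspondence of moves is a permutation of the letters. -/
theorem Corr.exists_perm (C : Corr m m' r r' R) (P : CPMParams m s n r)
    (P' : CPMParams m' s' n' r') {y : Cover s n} {y' : Cover s' n'} (h : R y y') :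
    ∃ σ : Equiv.Perm Letter, ∀ a, R (move r y a) (move r' y' (σ a)) := by
  choose f hf using C.fwd h
  have hinj : Function.Injective f := by
    intro a b hab
    exact (C.letter_iff P P' (hf a) (hf b)).2 hab
  exact ⟨Equiv.ofBijective f (Finite.injective_iff_bijective.1 hinj), hf⟩

/-- Going back along an edge corresponds to going back along an edge. -/
theorem Corr.letter_inv (C : Corr m m' r r' R) (P : CPMParams m s n r)
    (P' : CPMParams m' s' n' r') {y : Cover s n} {y' : Cover s' n'} {a a' b b' : Letter}
    (h₀ : R y y') (h₂ : R (move r (move r y a) b) (move r' (move r' y' a') b')) :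
    b = inv a ↔ b' = inv a' := by
  have hi : proj m (move r (move r y a) b) = proj m y ↔ b = inv a := by
    constructor
    · intro h
      refine proj_move_injective P (move r y a) ?_
      rw [h, move_inv]
    · rintro rfl
      rw [move_inv]
  have hi' : proj m' (move r' (move r' y' a') b') = proj m' y' ↔ b' = inv a' := by
    constructor
    · intro h
      refine proj_move_injective P' (move r' y' a') ?_
      rw [h, move_inv]
    · rintro rfl
      rw [move_inv]
  rw [← hi, ← hi']
  exact C.proj_iff h₂ h₀

end

/-! ### Counting closed extensions -/

/-- A letter may follow a word if it does not undo the last letter. -/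
def okNext (q : List Letter) (a : Letter) : Bool := q.getLast? != some (inv a)

/-- The number of reduced extensions of the word `q` by `k` letters that satisfy `p`. -/
def countExt (p : List Letter → Bool) : ℕ → List Letter → ℕ
  | 0, q => if p q then 1 else 0
  | k + 1, q =>
    ((if okNext q (true, true) then countExt p k (q ++ [(true, true)]) else 0) +
      (if okNext q (true, false) then countExt p k (q ++ [(true, false)]) else 0)) +
    ((if okNext q (false, true) then countExt p k (q ++ [(false, true)]) else 0) +
      (if okNext q (false, false) then countExt p k (q ++ [(false, false)]) else 0))

theorem countExt_succ (p : List Letter → Bool) (k : ℕ) (q : List Letter) :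
    countExt p (k + 1) q = ∑ a : Letter, if okNext q a then countExt p k (q ++ [a]) else 0 := by
  rw [countExt, Fintype.sum_prod_type]
  simp

theorem countExt_mono {p p' : List Letter → Bool} (k : ℕ) (q : List Letter)
    (h : ∀ w, w.length = q.length + k → p w → p' w) : countExt p k q ≤ countExt p' k q := by
  induction k generalizing q with
  | zero =>
    simp only [countExt]
    have := h q (by simp)
    split_ifs <;> simp_all
  | succ k ih =>
    rw [countExt_succ, countExt_succ]
    refine Finset.sum_le_sum fun a _ => ?_
    split_ifs
    · refine ih _ fun w hw => h w ?_
      rw [hw]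
      simp
      omega
    · exact le_rfl

open Classical in
/-- The number of reduced closed extensions of the word `q` by `k` letters. -/
noncomputable def cnt (m s : ℕ) {n : ℕ} (r : (ZMod n)ˣ) (k : ℕ) (q : List Letter) : ℕ :=
  countExt (fun w => decide (Closes m s r w)) k q

section
variable {m s n m' s' n' : ℕ} {r : (ZMod n)ˣ} {r' : (ZMod n')ˣ}
variable {R : Cover s n → Cover s' n' → Prop}

theorem Corr.okNext_iff (C : Corr m m' r r' R) (P : CPMParams m s n r)
    (P' : CPMParams m' s' n' r') {y : Cover s n} {y' : Cover s' n'} {q q' : List Letter}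
    (h : WRel r r' R y y' q q') {a a' : Letter}
    (h₂ : R (run r y (q ++ [a])) (run r' y' (q' ++ [a']))) :
    okNext q a = okNext q' a' := by
  have hlen := h.length_eq
  rcases List.eq_nil_or_concat' q with rfl | ⟨q, b, rfl⟩
  · have : q' = [] := List.length_eq_zero_iff.1 (by simpa using hlen.symm)
    subst this
    rfl
  · rcases List.eq_nil_or_concat' q' with rfl | ⟨q', b', rfl⟩
    · simp at hlen
    · have hsplit : ∀ (l l' : List Letter) (y : Cover s n) (y' : Cover s' n'),
          WRel r r' R y y' (l ++ [b]) (l' ++ [b']) → l.length = l'.length →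
          R (run r y l) (run r' y' l') := by
        intro l
        induction l with
        | nil =>
          intro l' y y' h hl
          have : l' = [] := List.length_eq_zero_iff.1 (by simpa using hl.symm)
          subst this
          exact h.1
        | cons c l ih =>
          intro l' y y' h hl
          cases l' with
          | nil => simp at hl
          | cons c' l' => exact ih l' _ _ h.2 (by simpa using hl)
      have h0 := hsplit q q' y y' h (by simpa using hlen)
      simp only [run_append, run_cons, run_nil] at h₂
      have key := C.letter_inv P P' h0 h₂
      have e1 : (b = inv a) ↔ (b' = inv a') := by
        have flip : ∀ x z : Letter, x = inv z ↔ z = inv x := by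
          intro x z
          constructor <;> (rintro rfl; simp)
        rw [flip b a, flip b' a']
        exact key
      rw [Bool.eq_iff_iff]
      simp [okNext, e1]

/-- Corresponding words have equally many closed extensions of each length. -/
theorem Corr.cnt_eq (C : Corr m m' r r' R) (P : CPMParams m s n r)
    (P' : CPMParams m' s' n' r') (k : ℕ) {y : Cover s n} {y' : Cover s' n'}
    {q q' : List Letter} (h : WRel r r' R y y' q q') : cnt m s r k q = cnt m' s' r' k q' := by
  unfold cnt
  induction k generalizing q q' with
  | zero =>
    have hiff := C.closes_iff P P' h
    by_cases hc : Closes m s r q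
    · simp [countExt, hc, hiff.1 hc]
    · have hc' : ¬ Closes m' s' r' q' := fun h => hc (hiff.2 h)
      simp [countExt, hc, hc']
  | succ k ih =>
    obtain ⟨σ, hσ⟩ := C.exists_perm P P' h.run_rel
    rw [countExt_succ, countExt_succ]
    rw [← Equiv.sum_comp σ (fun a => if okNext q' a then _ else _)]
    refine Finset.sum_congr rfl fun a _ => ?_
    have hw : WRel r r' R y y' (q ++ [a]) (q' ++ [σ a]) := h.append ⟨h.run_rel, hσ a⟩
    rw [C.okNext_iff P P' h hw.run_rel, ih hw]

end

/-! ### Deciding which short words close -/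

/-- The Laurent polynomials in `ρ` that occur as coordinate sums are encoded, up to a power of `ρ`,
as coefficient lists; this is the value of such a list at `x`. -/
def pe {R : Type*} [CommRing R] (x : R) : List ℤ → R
  | [] => 0
  | a :: l => a + x * pe x l

/-- Adds `e` to the coefficient number `k`. -/
def addAt : ℕ → ℤ → List ℤ → List ℤ
  | 0, e, [] => [e]
  | 0, e, a :: l => (a + e) :: l
  | k + 1, e, [] => 0 :: addAt k e []
  | k + 1, e, a :: l => a :: addAt k e l

/-- The coefficient list, shifted by `8`, of the coordinate sum `cval` attached to `c`. -/
def coefs (S c : ℤ) : List (ℤ × ℤ) → List ℤ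
  | [] => []
  | t :: ts =>
    if S ∣ t.1 - c then addAt ((t.1 - c) / S + 8).toNat t.2 (coefs S c ts) else coefs S c ts

/-- Removes the trailing zeros. -/
def trimEnd : List ℤ → List ℤ
  | [] => []
  | a :: l => if a = 0 ∧ trimEnd l = [] then [] else a :: trimEnd l

/-- Removes the leading zeros. -/
def trimStart : List ℤ → List ℤ
  | [] => []
  | a :: l => if a = 0 then trimStart l else a :: l

/-- Makes the first coefficient non-negative by a change of sign. -/
def fixSign : List ℤ → List ℤ
  | [] => []
  | a :: l => if a < 0 then (a :: l).map Neg.neg else a :: l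

/-- A normal form of coefficient lists up to sign and powers of `ρ`. -/
def normalForm (l : List ℤ) : List ℤ := fixSign (trimStart (trimEnd l))

/-- The normal form of the coordinate sum of a word that is attached to `c`. -/
def wordPoly (S c : ℤ) (l : List Letter) : List ℤ := normalForm (coefs S c (terms 0 l))

/-- A necessary condition for closing, when the polynomials in `F` do not vanish at `ρ`. -/
def maybeTest (M S : ℤ) (F : List (List ℤ)) (l : List Letter) : Bool :=
  decide (M ∣ net l) &&
    (terms 0 l).all fun t => !(F.contains (wordPoly S t.1 l))

/-- A sufficient condition for closing, when the polynomials in `Z` vanish at `ρ`. -/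
def closeTest (M S : ℤ) (Z : List (List ℤ)) (l : List Letter) : Bool :=
  decide (M ∣ net l) &&
    (terms 0 l).all fun t => ([] :: Z).contains (wordPoly S t.1 l)

/-- For words of at most eight letters, `ms` and `s` only matter through their divisibility
relations to integers of absolute value at most `8`; `M` and `S` are substitutes for them. -/
structure Profile (m s : ℕ) (M S : ℤ) : Prop where
  pos : 0 < S
  net_iff : ∀ d : ℤ, |d| ≤ 8 → (((m * s : ℕ) : ℤ) ∣ d ↔ M ∣ d)
  dvd_iff : ∀ d : ℤ, |d| ≤ 8 → ((s : ℤ) ∣ d ↔ S ∣ d)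
  div_eq : ∀ d : ℤ, |d| ≤ 8 → S ∣ d → d / s = d / S

theorem min_dvd_iff {a : ℕ} (d : ℤ) (hd : |d| ≤ 8) :
    ((a : ℤ) ∣ d ↔ ((min a 9 : ℕ) : ℤ) ∣ d) := by
  rcases le_or_gt a 9 with h | h
  · rw [min_eq_left h]
  · rw [min_eq_right h.le]
    have h0 : ∀ b : ℕ, 9 ≤ b → ((b : ℤ) ∣ d ↔ d = 0) := by
      intro b hb
      refine ⟨fun hdvd => ?_, fun h => h ▸ dvd_zero _⟩
      exact Int.eq_zero_of_abs_lt_dvd hdvd (by omega)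
    rw [h0 a h.le, h0 9 le_rfl]

/-- It is enough to replace `ms` and `s` by `9` when they are larger. -/
theorem Profile.of_min {m s : ℕ} {M S : ℤ} (hs : 0 < s)
    (hM : ((min (m * s) 9 : ℕ) : ℤ) = M) (hS : ((min s 9 : ℕ) : ℤ) = S) : Profile m s M S := by
  subst hM hS
  refine ⟨by simp; omega, fun d hd => min_dvd_iff d hd, fun d hd => min_dvd_iff d hd, ?_⟩
  intro d hd hdvd
  rcases le_or_gt s 9 with h | h
  · rw [min_eq_left h]
  · rw [min_eq_right h.le] at hdvd ⊢
    have : d = 0 := Int.eq_zero_of_abs_lt_dvd hdvd (by push_cast; omega)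
    simp [this]

section
variable {R : Type*} [CommRing R]

theorem pe_addAt (x : R) (k : ℕ) (e : ℤ) (l : List ℤ) :
    pe x (addAt k e l) = pe x l + e * x ^ k := by
  induction k generalizing l with
  | zero => cases l <;> simp [addAt, pe]; ring
  | succ k ih => cases l <;> simp [addAt, pe, ih] <;> ring

theorem pe_trimEnd (x : R) (l : List ℤ) : pe x (trimEnd l) = pe x l := by
  induction l with
  | nil => rfl
  | cons a l ih =>
    unfold trimEnd
    split_ifs with h
    · rw [h.2] at ih
      simp [pe, h.1, ← ih]
    · simp [pe, ih]

theorem pe_map_neg (x : R) (l : List ℤ) : pe x (l.map Neg.neg) = -pe x l := by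
  induction l with
  | nil => simp [pe]
  | cons a l ih => simp [pe, ih]; ring

theorem pe_fixSign_eq_zero (x : R) (l : List ℤ) : pe x (fixSign l) = 0 ↔ pe x l = 0 := by
  cases l with
  | nil => rfl
  | cons a l =>
    simp only [fixSign]
    split_ifs
    · rw [pe_map_neg, neg_eq_zero]
    · rfl

theorem pe_trimStart_eq_zero (u : Rˣ) (l : List ℤ) :
    pe (u : R) (trimStart l) = 0 ↔ pe (u : R) l = 0 := by
  induction l with
  | nil => rfl
  | cons a l ih =>
    unfold trimStart
    split_ifs with h
    · rw [ih, pe, h]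
      simp
    · rfl

theorem pe_normalForm_eq_zero (u : Rˣ) (l : List ℤ) :
    pe (u : R) (normalForm l) = 0 ↔ pe (u : R) l = 0 := by
  rw [normalForm, pe_fixSign_eq_zero, pe_trimStart_eq_zero, pe_trimEnd]

end

section
variable {m s n : ℕ} {r : (ZMod n)ˣ} {M S : ℤ}

theorem Profile.pe_coefs (H : Profile m s M S) (ρ : (ZMod n)ˣ) (c : ℤ) (ts : List (ℤ × ℤ))
    (hts : ∀ t ∈ ts, |t.1 - c| ≤ 8) :
    pe (ρ : ZMod n) (coefs S c ts) = ((ρ ^ (8 : ℤ) : (ZMod n)ˣ) : ZMod n) * cval s ρ c ts := by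
  induction ts with
  | nil => simp [coefs, cval, pe]
  | cons t ts ih =>
    have ih := ih fun t ht => hts t (List.mem_cons_of_mem _ ht)
    have habs : |t.1 - c| ≤ 8 := hts t List.mem_cons_self
    have hc : cval s ρ c (t :: ts) = (if (s : ℤ) ∣ t.1 - c then
        (t.2 : ZMod n) * ((ρ ^ ((t.1 - c) / s) : (ZMod n)ˣ) : ZMod n) else 0) + cval s ρ c ts := by
      simp [cval]
    rw [hc, mul_add, ← ih]
    rw [coefs]
    by_cases hd : S ∣ t.1 - c
    · rw [if_pos hd, if_pos ((H.dvd_iff _ habs).2 hd), pe_addAt, H.div_eq _ habs hd]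
      have hnn : 0 ≤ (t.1 - c) / S + 8 := by
        obtain ⟨q, hq⟩ := hd
        rw [hq, Int.mul_ediv_cancel_left _ H.pos.ne']
        have := H.pos
        have := abs_le.1 habs
        by_contra hneg
        have : S * q ≤ S * (-9) := mul_le_mul_of_nonneg_left (by omega) H.pos.le
        omega
      have : (ρ : ZMod n) ^ ((t.1 - c) / S + 8).toNat
          = ((ρ ^ (8 : ℤ) : (ZMod n)ˣ) : ZMod n) *
            ((ρ ^ ((t.1 - c) / S) : (ZMod n)ˣ) : ZMod n) := by
        rw [← Units.val_mul, ← zpow_add, ← Units.val_pow_eq_pow_val, ← zpow_natCast,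
          Int.toNat_of_nonneg hnn, add_comm]
      rw [this]
      ring
    · rw [if_neg hd, if_neg (fun h => hd ((H.dvd_iff _ habs).1 h))]
      simp

theorem terms_bounds {h : ℤ} {l : List Letter} {t : ℤ × ℤ} (ht : t ∈ terms h l) :
    h - l.length ≤ t.1 ∧ t.1 < h + l.length := by
  induction l generalizing h with
  | nil => simp [terms] at ht
  | cons a l ih =>
    rw [terms, List.mem_cons] at ht
    rw [List.length_cons]
    rcases ht with rfl | ht
    · dsimp only [gap]
      push_cast
      split_ifs <;> constructor <;> omega
    · have := ih ht
      have h1 : -1 ≤ sgn a.1 ∧ sgn a.1 ≤ 1 := by cases a.1 <;> simp [sgn]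
      push_cast
      omega

theorem terms_abs_sub_le {h : ℤ} {l : List Letter} {t t' : ℤ × ℤ} (ht : t ∈ terms h l)
    (ht' : t' ∈ terms h l) : |t.1 - t'.1| ≤ l.length := by
  have key : ∀ (a : Letter) (l : List Letter) (h : ℤ) (t : ℤ × ℤ), t ∈ terms (h + sgn a.1) l →
      |t.1 - gap h a| ≤ l.length + 1 := by
    intro a l h t ht
    have h2 := terms_bounds ht
    rw [abs_le]
    unfold gap
    rcases a with ⟨_ | _, e⟩ <;> simp [sgn] at h2 ⊢ <;> omega
  induction l generalizing h with
  | nil => simp [terms] at ht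
  | cons a l ih =>
    rw [terms, List.mem_cons] at ht ht'
    rw [List.length_cons]
    push_cast
    rcases ht with rfl | ht <;> rcases ht' with rfl | ht'
    · simp; omega
    · rw [abs_sub_comm]; exact key a l h t' ht'
    · exact key a l h t ht
    · have := ih ht ht'
      omega

/-- Evaluating the polynomial of a word at `ρ` decides whether the coordinate sum vanishes. -/
theorem Profile.wordPoly_iff (H : Profile m s M S) {l : List Letter} (hl : l.length ≤ 8)
    {c : ℤ} (hc : ∃ t ∈ terms 0 l, t.1 = c) :
    pe ((r ^ s : (ZMod n)ˣ) : ZMod n) (wordPoly S c l) = 0 ↔ cval s (r ^ s) c (terms 0 l) = 0 := by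
  obtain ⟨t, ht, rfl⟩ := hc
  have hts : ∀ t' ∈ terms 0 l, |t'.1 - t.1| ≤ 8 := fun t' ht' =>
    (terms_abs_sub_le ht' ht).trans (by exact_mod_cast hl)
  rw [wordPoly, pe_normalForm_eq_zero, H.pe_coefs _ _ _ hts]
  exact Units.mul_right_eq_zero _

theorem abs_net_le (l : List Letter) : |net l| ≤ l.length := by
  induction l with
  | nil => simp [net]
  | cons a l ih =>
    rw [net_cons]
    have h1 : |sgn a.1| ≤ 1 := by cases a.1 <;> simp [sgn]
    have := abs_add_le (sgn a.1) (net l)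
    push_cast [List.length_cons]
    omega

theorem cval_congr (ρ : (ZMod n)ˣ) {c c' : ℤ} (h : (s : ℤ) ∣ c - c') (ts : List (ℤ × ℤ))
    (h0 : cval s ρ c ts = 0) : cval s ρ c' ts = 0 := by
  have key : ∀ ts : List (ℤ × ℤ), cval s ρ c' ts =
      ((ρ ^ ((c - c') / s) : (ZMod n)ˣ) : ZMod n) * cval s ρ c ts := by
    intro ts
    unfold cval
    induction ts with
    | nil => simp
    | cons t ts ih =>
      simp only [List.map_cons, List.sum_cons, ih, mul_add]
      congr 1
      have hd : (s : ℤ) ∣ t.1 - c' ↔ (s : ℤ) ∣ t.1 - c := by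
        rw [show t.1 - c' = (t.1 - c) + (c - c') by ring]
        exact dvd_add_left h
      by_cases hc : (s : ℤ) ∣ t.1 - c
      · rw [if_pos hc, if_pos (hd.2 hc), show t.1 - c' = (t.1 - c) + (c - c') by ring,
          Int.add_ediv_of_dvd_left hc, zpow_add, Units.val_mul]
        ring
      · rw [if_neg hc, if_neg (fun h => hc (hd.1 h)), mul_zero]
  rw [key, h0, mul_zero]

theorem Profile.maybeTest_of_closes (H : Profile m s M S) {F : List (List ℤ)}
    (hF : ∀ f ∈ F, pe ((r ^ s : (ZMod n)ˣ) : ZMod n) f ≠ 0) {l : List Letter}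
    (hl : l.length ≤ 8) (h : Closes m s r l) : maybeTest M S F l = true := by
  have hn : |net l| ≤ 8 := (abs_net_le l).trans (by exact_mod_cast hl)
  unfold maybeTest
  rw [Bool.and_eq_true, decide_eq_true_eq]
  refine ⟨(H.net_iff _ hn).1 h.1, ?_⟩
  rw [List.all_eq_true]
  intro t ht
  simp only [Bool.not_eq_true', List.contains_eq_mem, decide_eq_false_iff_not]
  intro hmem
  exact hF _ hmem ((H.wordPoly_iff hl ⟨t, ht, rfl⟩).2 (h.2 t.1))

theorem Profile.closes_of_closeTest (H : Profile m s M S) {Z : List (List ℤ)}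
    (hZ : ∀ z ∈ Z, pe ((r ^ s : (ZMod n)ˣ) : ZMod n) z = 0) {l : List Letter}
    (hl : l.length ≤ 8) (h : closeTest M S Z l = true) : Closes m s r l := by
  have hn : |net l| ≤ 8 := (abs_net_le l).trans (by exact_mod_cast hl)
  unfold closeTest at h
  rw [Bool.and_eq_true, decide_eq_true_eq, List.all_eq_true] at h
  refine ⟨(H.net_iff _ hn).2 h.1, fun c => ?_⟩
  by_cases hex : ∃ t ∈ terms 0 l, (s : ℤ) ∣ t.1 - c
  · obtain ⟨t, ht, hd⟩ := hex
    have h2 := h.2 t ht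
    refine cval_congr _ hd _ ((H.wordPoly_iff hl ⟨t, ht, rfl⟩).1 ?_)
    have h3 := h2
    simp only [List.contains_eq_mem, decide_eq_true_eq, List.mem_cons] at h3
    rcases h3 with h3 | h3
    · rw [h3, pe]
    · exact hZ _ h3
  · unfold cval
    rw [List.sum_eq_zero]
    intro x hx
    rw [List.mem_map] at hx
    obtain ⟨t, ht, rfl⟩ := hx
    rw [if_neg fun hd => hex ⟨t, ht, hd⟩]

/-- An upper bound for the number of closed extensions, computable by evaluation. -/
theorem Profile.cnt_le (H : Profile m s M S) {F : List (List ℤ)}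
    (hF : ∀ f ∈ F, pe ((r ^ s : (ZMod n)ˣ) : ZMod n) f ≠ 0) {k : ℕ} {q : List Letter}
    (hl : q.length + k ≤ 8) {N : ℕ} (hN : countExt (maybeTest M S F) k q ≤ N) :
    cnt m s r k q ≤ N :=
  (countExt_mono k q fun w hw h =>
    H.maybeTest_of_closes hF (by omega) (by simpa using h)).trans hN

/-- A lower bound for the number of closed extensions, computable by evaluation. -/
theorem Profile.le_cnt (H : Profile m s M S) {Z : List (List ℤ)}
    (hZ : ∀ z ∈ Z, pe ((r ^ s : (ZMod n)ˣ) : ZMod n) z = 0) {k : ℕ} {q : List Letter}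
    (hl : q.length + k ≤ 8) {N : ℕ} (hN : N ≤ countExt (closeTest M S Z) k q) :
    N ≤ cnt m s r k q :=
  hN.trans (countExt_mono k q fun w hw h => by
    simpa using H.closes_of_closeTest hZ (by omega) h)

end

/-! ### Reflections and compositions -/

section
variable {m s n m' s' n' m'' s'' n'' : ℕ}
variable {r : (ZMod n)ˣ} {r' : (ZMod n')ˣ} {r'' : (ZMod n'')ˣ}
variable {R : Cover s n → Cover s' n' → Prop} {R' : Cover s' n' → Cover s'' n'' → Prop}

/-- The composition of two relations. -/
def compRel {α β γ : Type*} (R : α → β → Prop) (R' : β → γ → Prop) (x : α) (z : γ) : Prop :=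
  ∃ y, R x y ∧ R' y z

theorem Corr.comp (C : Corr m m' r r' R) (C' : Corr m' m'' r' r'' R') :
    Corr m m'' r r'' (compRel R R') := by
  refine ⟨?_, ?_, ?_⟩
  · rintro y y'' ⟨y', h, h'⟩ a
    obtain ⟨a', ha⟩ := C.fwd h a
    obtain ⟨a'', ha'⟩ := C'.fwd h' a'
    exact ⟨a'', _, ha, ha'⟩
  · rintro y y'' ⟨y', h, h'⟩ a''
    obtain ⟨a', ha'⟩ := C'.bwd h' a''
    obtain ⟨a, ha⟩ := C.bwd h a'
    exact ⟨a, _, ha, ha'⟩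
  · rintro y₁ y₂ z₁ z₂ ⟨x₁, h₁, h₁'⟩ ⟨x₂, h₂, h₂'⟩
    exact (C.proj_iff h₁ h₂).trans (C'.proj_iff h₁' h₂')

theorem WRel.comp {y : Cover s n} {y' : Cover s' n'} {y'' : Cover s'' n''}
    {l l' l'' : List Letter} (h : WRel r r' R y y' l l') (h' : WRel r' r'' R' y' y'' l' l'') :
    WRel r r'' (compRel R R') y y'' l l'' := by
  induction l generalizing y y' y'' l' l'' with
  | nil =>
    cases l' <;> cases l'' <;> simp [WRel] at h h' ⊢
    exact ⟨_, h, h'⟩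
  | cons a l ih =>
    cases l' <;> cases l'' <;> simp only [WRel] at h h' ⊢
    exact ⟨⟨_, h.1, h'.1⟩, ih h.2 h'.2⟩

/-- The reflection of the cover that reverses the coordinates selected by `χ` around the vector
`c`. -/
def reflect (χ : Fin s → Bool) (c : Fin s → ZMod n) (y : Cover s n) : Cover s n :=
  (y.1, fun i => if χ i then 2 * c i - y.2 i else y.2 i)

theorem edgeVec_apply_of_ne (P : CPMParams m s n r) (g : ℤ) (i : Fin s) (h : i ≠ idx P g) :
    edgeVec s r g i = 0 := by
  obtain ⟨c, rfl⟩ := exists_idx_eq P 0 i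
  have h1 := edgeVec_apply_idx P 0 g c
  rw [zero_add] at h1
  rw [h1, if_neg]
  intro hd
  refine h (Eq.symm ?_)
  rw [idx_eq_iff]
  simpa using hd

theorem move_reflect (P : CPMParams m s n r) (χ : Fin s → Bool) (c : Fin s → ZMod n)
    (y : Cover s n) (d e : Bool) :
    move r (reflect χ c y) (d, xor e (χ (idx P (gap y.1 (d, e))))) =
      reflect χ c (move r y (d, e)) := by
  refine Prod.ext rfl (funext fun i => ?_)
  have hg : ∀ e', gap y.1 (d, e') = gap y.1 (d, e) := fun e' => rfl
  simp only [move, reflect, Pi.add_apply, Pi.smul_apply, hg]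
  by_cases hi : i = idx P (gap y.1 (d, e))
  · subst hi
    cases h : χ (idx P (gap y.1 (d, e)))
    · simp
    · simp [sgn_not]
      ring
  · rw [edgeVec_apply_of_ne P _ _ hi]
    split_ifs <;> simp

theorem corr_reflect (P : CPMParams m s n r) (χ : Fin s → Bool) (c : Fin s → ZMod n) :
    Corr m m r r (fun y y' => y' = reflect χ c y) := by
  refine ⟨?_, ?_, ?_⟩
  · rintro y _ rfl ⟨d, e⟩
    exact ⟨_, move_reflect P χ c y d e⟩
  · rintro y _ rfl ⟨d, e⟩
    refine ⟨(d, xor e (χ (idx P (gap y.1 (d, e))))), ?_⟩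
    rw [← move_reflect P χ c y]
    simp [gap]
  · rintro y₁ y₂ _ _ rfl rfl
    rw [proj_eq_iff, proj_eq_iff]
    refine and_congr Iff.rfl ⟨fun h => by simp [reflect, h], fun h => ?_⟩
    funext i
    have := congrFun h i
    simp only [reflect] at this
    split_ifs at this
    · linear_combination -this
    · exact this

end

/-! ### Twists -/

/-- A twist: a symmetry of the cover that fixes a vertex `y` and one upper neighbour of `y`, and
takes the other upper neighbour to a lower neighbour of `y`. The walks are read from the fixed upper
neighbour; all signs are positive, which is no restriction (`Twisted.of_signs`). -/
def Twisted (m : ℕ) {s n : ℕ} (r : (ZMod n)ˣ) : Prop :=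
  ∃ (R : Cover s n → Cover s n → Prop) (p : Cover s n), Corr m m r r R ∧
    WRel r r R p p [(false, true), (true, true)] [(false, true), (false, true)]

section
variable {m s n : ℕ} {r : (ZMod n)ˣ}

/-- The signs in the definition of a twist can be made positive by conjugation with a reflection in
the two coordinates involved. -/
theorem Twisted.of_signs (P : CPMParams m s n r) {R : Cover s n → Cover s n → Prop}
    {p : Cover s n} {b f : Bool} (C : Corr m m r r R)
    (h : WRel r r R p p [(false, b), (true, b)] [(false, b), (false, f)]) :
    Twisted (s := s) m r := by
  have hne : idx P (p.1 - 1) ≠ idx P (p.1 - 2) := by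
    rw [Ne, idx_eq_iff]
    intro hd
    have := Int.le_of_dvd (by norm_num) (show (s : ℤ) ∣ 1 by simpa using hd)
    have := P.two_le_s
    omega
  let χ : Fin s → Bool := fun i =>
    if i = idx P (p.1 - 1) then !b else if i = idx P (p.1 - 2) then !f else false
  have hχ1 : χ (idx P (p.1 - 1)) = !b := by simp [χ]
  have hχ2 : χ (idx P (p.1 - 2)) = !f := by simp [χ, hne.symm]
  have F := corr_reflect P χ 0
  have mv : ∀ (y : Cover s n) (d e : Bool), χ (idx P (gap y.1 (d, e))) = !e →
      move r (reflect χ 0 y) (d, true) = reflect χ 0 (move r y (d, e)) := by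
    intro y d e h
    rw [← move_reflect P χ 0 y, h]
    simp
  have e1 := mv p false b (by simpa [gap] using hχ1)
  have e2 := mv (move r p (false, b)) true b (by
    simpa [gap, move, sgn, ← sub_eq_add_neg] using hχ1)
  have e3 := mv (move r p (false, b)) false f (by
    have : p.1 + sgn false - 1 = p.1 - 2 := by simp only [sgn]; norm_num; ring
    simpa [gap, move, this] using hχ2)
  refine ⟨_, reflect χ 0 p, F.symm.comp (C.comp F), ?_⟩
  refine WRel.comp (y' := p) (l' := [(false, b), (true, b)]) ⟨rfl, ?_, ?_⟩
    (WRel.comp h ⟨rfl, ?_, ?_⟩)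
  · rw [e1]
  · change _ = _
    rw [e1, e2]
  · rw [e1]
  · change _ = _
    rw [e1, e3]

/-- A twist gives a bijection between the letters after the turn and the letters after two steps
down that preserves the numbers of closed extensions; it takes the letter that undoes the turn to
the letter that undoes the second step. -/
theorem Twisted.exists_perm (P : CPMParams m s n r) (T : Twisted (s := s) m r) :
    ∃ σ : Equiv.Perm Letter, σ (false, false) = (true, false) ∧ ∀ a k,
      cnt m s r k [(false, true), (true, true), a] =
        cnt m s r k [(false, true), (false, true), σ a] := by
  obtain ⟨R, p, C, hw⟩ := T
  obtain ⟨σ, hσ⟩ := C.exists_perm P P hw.run_rel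
  refine ⟨σ, ?_, fun a k => ?_⟩
  · exact (C.letter_inv P P hw.2.1 (hσ (false, false))).1 rfl
  · exact C.cnt_eq P P k (hw.append (l₂ := [a]) (l₂' := [σ a]) ⟨hw.run_rel, hσ a⟩)

theorem Twisted.cnt_eq (P : CPMParams m s n r) (T : Twisted (s := s) m r) (k : ℕ) :
    cnt m s r k [(false, true), (true, true)] = cnt m s r k [(false, true), (false, true)] := by
  obtain ⟨R, p, C, hw⟩ := T
  exact C.cnt_eq P P k hw

/-- There is no twist if going on after the turn always leaves more closed extensions than going
down for three steps: the bijection would take both ways of going on to the only letter left over.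
-/
theorem Twisted.false_of_down_lt (P : CPMParams m s n r) (T : Twisted (s := s) m r) (k N : ℕ)
    (h₁ : ∀ g, N ≤ cnt m s r k [(false, true), (true, true), (true, g)])
    (h₂ : ∀ g, cnt m s r k [(false, true), (false, true), (false, g)] < N) : False := by
  obtain ⟨σ, h0, hσ⟩ := T.exists_perm P
  have key : ∀ g, σ (true, g) = (true, true) := by
    intro g
    have h3 := h₁ g
    rw [hσ] at h3
    have h4 : σ (true, g) ≠ (true, false) := by
      rw [← h0]
      exact fun h => by simpa using σ.injective h
    rcases hs : σ (true, g) with ⟨d, x⟩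
    rw [hs] at h3 h4
    cases d
    · exact absurd (h₂ x) (by omega)
    · cases x <;> simp_all
  simpa using σ.injective ((key true).trans (key false).symm)

/-- There is no twist if going down for three steps always leaves more closed extensions than going
on after the turn. -/
theorem Twisted.false_of_up_lt (P : CPMParams m s n r) (T : Twisted (s := s) m r) (k N : ℕ)
    (h₁ : ∀ g, N ≤ cnt m s r k [(false, true), (false, true), (false, g)])
    (h₂ : ∀ g, cnt m s r k [(false, true), (true, true), (true, g)] < N) : False := by
  obtain ⟨σ, h0, hσ⟩ := T.exists_perm P
  have key : ∀ g, σ (false, true) = (false, g) := by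
    intro g
    obtain ⟨⟨d, x⟩, hs⟩ := σ.surjective (false, g)
    have h3 := h₁ g
    rw [← hs, ← hσ] at h3
    cases d
    · by_cases hx : x = false
      · rw [hx, h0] at hs
        simp at hs
      · rw [← hs]
        cases x <;> simp_all
    · exact absurd (h₂ x) (by omega)
  simpa using (key true).symm.trans (key false)

/-- There is no twist if all reduced continuations of the turn have closed extensions while some
continuation of two steps down has none. -/
theorem Twisted.false_of_down_eq_zero (P : CPMParams m s n r) (T : Twisted (s := s) m r)
    (k : ℕ) (h₁ : ∀ a, a ≠ (false, false) → 1 ≤ cnt m s r k [(false, true), (true, true), a])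
    (h₂ : ∃ g, cnt m s r k [(false, true), (false, true), (false, g)] ≤ 0) : False := by
  obtain ⟨σ, h0, hσ⟩ := T.exists_perm P
  obtain ⟨g, hg⟩ := h₂
  obtain ⟨a, hs⟩ := σ.surjective (false, g)
  have ha : a ≠ (false, false) := by
    rintro rfl
    rw [h0] at hs
    simp at hs
  have := h₁ a ha
  rw [hσ, hs] at this
  omega

/-- There is no twist if all reduced continuations of two steps down have closed extensions while
some continuation of the turn has none. -/
theorem Twisted.false_of_turn_eq_zero (P : CPMParams m s n r) (T : Twisted (s := s) m r)
    (k : ℕ) (h₁ : ∀ a, a ≠ (true, false) → 1 ≤ cnt m s r k [(false, true), (false, true), a])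
    (h₂ : cnt m s r k [(false, true), (true, true), (false, true)] ≤ 0) : False := by
  obtain ⟨σ, h0, hσ⟩ := T.exists_perm P
  have ha : σ (false, true) ≠ (true, false) := by
    rw [← h0]
    exact fun h => by simpa using σ.injective h
  have := h₁ _ ha
  rw [← hσ] at this
  omega

/-- `Twisted.false_of_down_lt`, with the counts bounded by evaluation. -/
theorem Profile.false_of_down (H : Profile m s M S) (P : CPMParams m s n r)
    (T : Twisted (s := s) m r) {F Z : List (List ℤ)} (k N : ℕ) (hk : k ≤ 5)
    (hF : ∀ f ∈ F, pe ((r ^ s : (ZMod n)ˣ) : ZMod n) f ≠ 0)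
    (hZ : ∀ z ∈ Z, pe ((r ^ s : (ZMod n)ˣ) : ZMod n) z = 0)
    (h₁ : ∀ g, N + 1 ≤ countExt (closeTest M S Z) k [(false, true), (true, true), (true, g)])
    (h₂ : ∀ g, countExt (maybeTest M S F) k [(false, true), (false, true), (false, g)] ≤ N) :
    False :=
  T.false_of_down_lt P k (N + 1)
    (fun g => H.le_cnt hZ (by simp; omega) (h₁ g))
    (fun g => Nat.lt_succ_of_le (H.cnt_le hF (by simp; omega) (h₂ g)))

/-- `Twisted.false_of_up_lt`, with the counts bounded by evaluation. -/
theorem Profile.false_of_up (H : Profile m s M S) (P : CPMParams m s n r)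
    (T : Twisted (s := s) m r) {F Z : List (List ℤ)} (k N : ℕ) (hk : k ≤ 5)
    (hF : ∀ f ∈ F, pe ((r ^ s : (ZMod n)ˣ) : ZMod n) f ≠ 0)
    (hZ : ∀ z ∈ Z, pe ((r ^ s : (ZMod n)ˣ) : ZMod n) z = 0)
    (h₁ : ∀ g, N + 1 ≤ countExt (closeTest M S Z) k [(false, true), (false, true), (false, g)])
    (h₂ : ∀ g, countExt (maybeTest M S F) k [(false, true), (true, true), (true, g)] ≤ N) :
    False :=
  T.false_of_up_lt P k (N + 1)
    (fun g => H.le_cnt hZ (by simp; omega) (h₁ g))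
    (fun g => Nat.lt_succ_of_le (H.cnt_le hF (by simp; omega) (h₂ g)))

/-- `Twisted.false_of_down_eq_zero`, with the counts bounded by evaluation. -/
theorem Profile.false_of_some_down (H : Profile m s M S) (P : CPMParams m s n r)
    (T : Twisted (s := s) m r) {F Z : List (List ℤ)} (k : ℕ) (hk : k ≤ 5)
    (hF : ∀ f ∈ F, pe ((r ^ s : (ZMod n)ˣ) : ZMod n) f ≠ 0)
    (hZ : ∀ z ∈ Z, pe ((r ^ s : (ZMod n)ˣ) : ZMod n) z = 0)
    (h₁ : ∀ a : Letter, a ≠ (false, false) →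
      1 ≤ countExt (closeTest M S Z) k [(false, true), (true, true), a])
    (h₂ : ∃ g, countExt (maybeTest M S F) k [(false, true), (false, true), (false, g)] ≤ 0) :
    False :=
  T.false_of_down_eq_zero P k
    (fun a ha => H.le_cnt hZ (by simp; omega) (h₁ a ha))
    (h₂.imp fun g hg => H.cnt_le hF (by simp; omega) hg)

/-- `Twisted.false_of_turn_eq_zero`, with the counts bounded by evaluation. -/
theorem Profile.false_of_turn (H : Profile m s M S) (P : CPMParams m s n r)
    (T : Twisted (s := s) m r) {F Z : List (List ℤ)} (k : ℕ) (hk : k ≤ 5)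
    (hF : ∀ f ∈ F, pe ((r ^ s : (ZMod n)ˣ) : ZMod n) f ≠ 0)
    (hZ : ∀ z ∈ Z, pe ((r ^ s : (ZMod n)ˣ) : ZMod n) z = 0)
    (h₁ : ∀ a : Letter, a ≠ (true, false) →
      1 ≤ countExt (closeTest M S Z) k [(false, true), (false, true), a])
    (h₂ : countExt (maybeTest M S F) k [(false, true), (true, true), (false, true)] ≤ 0) :
    False :=
  T.false_of_turn_eq_zero P k
    (fun a ha => H.le_cnt hZ (by simp; omega) (h₁ a ha))
    (H.cnt_le hF (by simp; omega) h₂)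

/-- There is no twist if two steps down have a closed extension while a turn has none, in terms of
evaluations. -/
theorem Profile.false_of_arc (H : Profile m s M S) (P : CPMParams m s n r)
    (T : Twisted (s := s) m r) {F Z : List (List ℤ)} (k : ℕ) (hk : k ≤ 6)
    (hF : ∀ f ∈ F, pe ((r ^ s : (ZMod n)ˣ) : ZMod n) f ≠ 0)
    (hZ : ∀ z ∈ Z, pe ((r ^ s : (ZMod n)ˣ) : ZMod n) z = 0)
    (h₁ : 1 ≤ countExt (closeTest M S Z) k [(false, true), (false, true)])
    (h₂ : countExt (maybeTest M S F) k [(false, true), (true, true)] ≤ 0) :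
    False := by
  have h3 := H.le_cnt (r := r) hZ (q := [(false, true), (false, true)]) (by simp; omega) h₁
  have h4 := H.cnt_le (r := r) hF (q := [(false, true), (true, true)]) (by simp; omega) h₂
  rw [T.cnt_eq P] at h4
  omega

end

set_option maxRecDepth 100000

/-! ### No twist when there are at least three coordinates -/

/-- The evaluations behind `Profile.false_of_down`: there are more than `N` closed extensions after
a turn, and at most `N` after three steps down. -/
abbrev DownCheck (M S : ℤ) (F Z : List (List ℤ)) (k N : ℕ) : Prop :=
  (∀ g, N + 1 ≤ countExt (closeTest M S Z) k [(false, true), (true, true), (true, g)]) ∧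
    ∀ g, countExt (maybeTest M S F) k [(false, true), (false, true), (false, g)] ≤ N

/-- The evaluations behind `Profile.false_of_up`: there are more than `N` closed extensions after
three steps down, and at most `N` after a turn. -/
abbrev UpCheck (M S : ℤ) (F Z : List (List ℤ)) (k N : ℕ) : Prop :=
  (∀ g, N + 1 ≤ countExt (closeTest M S Z) k [(false, true), (false, true), (false, g)]) ∧
    ∀ g, countExt (maybeTest M S F) k [(false, true), (true, true), (true, g)] ≤ N

/-- The pairs run through the values of `ms` and `s`, cut off at `9`, for `s ≥ 4`, except those
where `s = 4` and `m ≤ 2`. -/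
theorem downCheck_of_four_le : ∀ p ∈ [((9 : ℤ), (9 : ℤ)), (5, 5), (6, 6), (7, 7), (8, 8), (9, 4),
    (9, 5), (9, 6), (9, 7), (9, 8)], DownCheck p.1 p.2 [[1], [2], [4]] [] 5 0 := by
  decide +kernel

theorem downCheck_eight_four : DownCheck 8 4 [[1], [2], [4], [1, 1], [1, -1]] [] 5 0 := by
  decide +kernel

theorem upCheck_four : ∀ M ∈ [(4 : ℤ), 8], ∀ z ∈ [[(1 : ℤ), -1], [1, 1]],
    UpCheck M 4 [[1], [2], [4]] [z] 5 1 := by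
  decide +kernel

theorem upCheck_three : ∀ M ∈ [(3 : ℤ), 6], ∀ z ∈ [[(1 : ℤ), -1], [1, 1]],
    UpCheck M 3 [[1], [2], [4]] [z] 3 0 := by
  decide +kernel

theorem downCheck_three_nine :
    DownCheck 9 3 [[1], [2], [4], [2, 2]] [[2, -2]] 5 2 ∧
    DownCheck 9 3 [[1], [2], [4], [2, -2]] [[2, 2]] 5 2 ∧
    DownCheck 9 3 [[1], [2], [4], [2, 2], [2, -2]] [] 5 0 := by
  decide +kernel

theorem downCheck_three_six :
    DownCheck 6 3 [[1, 1], [1, -1], [1], [2], [4], [2, 2]] [[2, -2]] 5 2 ∧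
    DownCheck 6 3 [[1, 1], [1, -1], [1], [2], [4], [2, -2]] [[2, 2]] 5 2 ∧
    DownCheck 6 3 [[1, 1], [1, -1], [1], [2], [4], [2, 2], [2, -2]] [] 5 0 := by
  decide +kernel

section
variable {m s n : ℕ} {r : (ZMod n)ˣ} {M S : ℤ}

theorem Profile.false_of_downCheck (H : Profile m s M S) (P : CPMParams m s n r)
    (T : Twisted (s := s) m r) {F Z : List (List ℤ)} {k N : ℕ} (hk : k ≤ 5)
    (hF : ∀ f ∈ F, pe ((r ^ s : (ZMod n)ˣ) : ZMod n) f ≠ 0)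
    (hZ : ∀ z ∈ Z, pe ((r ^ s : (ZMod n)ˣ) : ZMod n) z = 0)
    (h : DownCheck M S F Z k N) : False :=
  H.false_of_down P T k N hk hF hZ h.1 h.2

theorem Profile.false_of_upCheck (H : Profile m s M S) (P : CPMParams m s n r)
    (T : Twisted (s := s) m r) {F Z : List (List ℤ)} {k N : ℕ} (hk : k ≤ 5)
    (hF : ∀ f ∈ F, pe ((r ^ s : (ZMod n)ˣ) : ZMod n) f ≠ 0)
    (hZ : ∀ z ∈ Z, pe ((r ^ s : (ZMod n)ˣ) : ZMod n) z = 0)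
    (h : UpCheck M S F Z k N) : False :=
  H.false_of_up P T k N hk hF hZ h.1 h.2

theorem small_ne_zero (P : CPMParams m s n r) :
    ∀ f ∈ [[1], [2], [4]], pe ((r ^ s : (ZMod n)ˣ) : ZMod n) f ≠ 0 := by
  simp [pe, one_ne_zero_of P, two_ne_zero_of P, four_ne_zero_of P]

/-- If `ρ = ±1`, one of the two polynomials `1 ∓ ρ` vanishes. -/
theorem exists_direct_poly (hρ : r ^ s = 1 ∨ r ^ s = -1) :
    ∃ z ∈ [[(1 : ℤ), -1], [1, 1]], ∀ f ∈ [z], pe ((r ^ s : (ZMod n)ˣ) : ZMod n) f = 0 := by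
  rcases hρ with hρ | hρ
  · exact ⟨[1, -1], by simp, by simp [pe, hρ]⟩
  · exact ⟨[1, 1], by simp, by simp [pe, hρ]⟩

theorem direct_poly_ne_zero (hρ : ¬ (r ^ s = 1 ∨ r ^ s = -1)) :
    ∀ f ∈ [[(1 : ℤ), 1], [1, -1]], pe ((r ^ s : (ZMod n)ˣ) : ZMod n) f ≠ 0 := by
  rw [not_or, Units.ext_iff, Units.ext_iff] at hρ
  have h1 : (1 : ZMod n) + (r : ZMod n) ^ s ≠ 0 := fun h =>
    hρ.2 (by push_cast; linear_combination h)
  have h2 : (1 : ZMod n) + -(r : ZMod n) ^ s ≠ 0 := fun h =>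
    hρ.1 (by push_cast; linear_combination -h)
  simp [pe, h1, h2]

/-- With at least five coordinates, the walks that turn once and then go on lie on `8`-cycles, while
those that go in one direction for three steps do not. -/
theorem not_twisted_of_five_le (P : CPMParams m s n r) (hs : 5 ≤ s) :
    ¬ Twisted (s := s) m r := by
  intro T
  have hm := P.m_pos
  have hs0 : 0 < s := by omega
  have fin : ∀ M S : ℤ, ((min (m * s) 9 : ℕ) : ℤ) = M → ((min s 9 : ℕ) : ℤ) = S →
      (M, S) ∈ [((9 : ℤ), (9 : ℤ)), (5, 5), (6, 6), (7, 7), (8, 8), (9, 4),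
        (9, 5), (9, 6), (9, 7), (9, 8)] → False := fun M S hM hS hmem =>
    (Profile.of_min hs0 hM hS).false_of_downCheck P T le_rfl (small_ne_zero P) (by simp)
      (downCheck_of_four_le (M, S) hmem)
  rcases le_or_gt 9 s with h9 | h9
  · have hms : 9 ≤ m * s := h9.trans (Nat.le_mul_of_pos_left s hm)
    exact fin 9 9 (by rw [min_eq_right hms]; rfl) (by rw [min_eq_right h9]; rfl) (by simp)
  · rcases Nat.lt_or_ge m 2 with h1 | h2
    · obtain rfl : m = 1 := by omega
      refine fin s s (by rw [one_mul, min_eq_left h9.le]) (by rw [min_eq_left h9.le]) ?_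
      interval_cases s <;> simp
    · have hM : ((min (m * s) 9 : ℕ) : ℤ) = 9 := by
        rw [min_eq_right (by nlinarith)]; rfl
      refine fin 9 s hM (by rw [min_eq_left h9.le]) ?_
      interval_cases s <;> simp

end

section
variable {m n : ℕ} {r : (ZMod n)ˣ}

/-- With four coordinates there are further `8`-cycles, which rise in every step, when
`m = 1`, or `m = 2` and `r ^ 4 = ±1`. Then closed extensions are counted instead. -/
theorem not_twisted_of_eq_four (P : CPMParams m 4 n r) : ¬ Twisted (s := 4) m r := by
  intro T
  have hm := P.m_pos
  have hs0 : 0 < 4 := by norm_num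
  have hdir : (m = 1 ∨ m = 2) → (r ^ 4 = 1 ∨ r ^ 4 = -1) → False := by
    intro hm' hρ
    obtain ⟨z, hz, hZ⟩ := exists_direct_poly hρ
    rcases hm' with rfl | rfl
    · exact (Profile.of_min (M := 4) (S := 4) hs0 (by norm_num) (by norm_num)).false_of_upCheck P T
        le_rfl (small_ne_zero P) hZ (upCheck_four 4 (by simp) z hz)
    · exact (Profile.of_min (M := 8) (S := 4) hs0 (by norm_num) (by norm_num)).false_of_upCheck P T
        le_rfl (small_ne_zero P) hZ (upCheck_four 8 (by simp) z hz)
  rcases lt_trichotomy m 2 with h | h | h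
  · obtain rfl : m = 1 := by omega
    exact hdir (Or.inl rfl) P.pow_eq
  · subst h
    by_cases hρ : r ^ 4 = 1 ∨ r ^ 4 = -1
    · exact hdir (Or.inr rfl) hρ
    · have hF : ∀ f ∈ [[1], [2], [4], [1, 1], [1, -1]],
          pe ((r ^ 4 : (ZMod n)ˣ) : ZMod n) f ≠ 0 := by
        intro f hf
        rcases List.mem_append.1 (show f ∈ [[1], [2], [4]] ++ [[1, 1], [1, -1]] from hf)
          with hf | hf
        · exact small_ne_zero P f hf
        · exact direct_poly_ne_zero hρ f hf
      exact (Profile.of_min (M := 8) (S := 4) hs0 (by norm_num) (by norm_num)).false_of_downCheck P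
        T le_rfl hF (by simp) downCheck_eight_four
  · have hM : ((min (m * 4) 9 : ℕ) : ℤ) = 9 := by
      rw [min_eq_right (by omega)]; rfl
    exact (Profile.of_min (M := 9) (S := 4) hs0 hM (by norm_num)).false_of_downCheck P T
      le_rfl (small_ne_zero P) (by simp) (downCheck_of_four_le (9, 4) (by simp))

/-- With three coordinates, `6`-cycles that rise in every step decide when they exist; otherwise the
`8`-cycles through walks of length three are counted. -/
theorem not_twisted_of_eq_three (P : CPMParams m 3 n r) : ¬ Twisted (s := 3) m r := by
  intro T
  have hm := P.m_pos
  have hs0 : 0 < 3 := by norm_num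
  by_cases h12 : (m = 1 ∨ m = 2) ∧ (r ^ 3 = 1 ∨ r ^ 3 = -1)
  · obtain ⟨hm', hρ⟩ := h12
    obtain ⟨z, hz, hZ⟩ := exists_direct_poly hρ
    rcases hm' with rfl | rfl
    · exact (Profile.of_min (M := 3) (S := 3) hs0 (by norm_num) (by norm_num)).false_of_upCheck P T
        (by norm_num) (small_ne_zero P) hZ (upCheck_three 3 (by simp) z hz)
    · exact (Profile.of_min (M := 6) (S := 3) hs0 (by norm_num) (by norm_num)).false_of_upCheck P T
        (by norm_num) (small_ne_zero P) hZ (upCheck_three 6 (by simp) z hz)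
  have hm2 : 2 ≤ m := by
    by_contra h
    obtain rfl : m = 1 := by omega
    exact h12 ⟨Or.inl rfl, P.pow_eq⟩
  -- The three shapes of `ρ = r ^ 3`: `2ρ = 2`, `2ρ = -2`, or neither.
  have hcase : ∃ (F Z : List (List ℤ)) (N : ℕ),
      ((F = [[1], [2], [4], [2, 2]] ∧ Z = [[2, -2]] ∧ N = 2) ∨
        (F = [[1], [2], [4], [2, -2]] ∧ Z = [[2, 2]] ∧ N = 2) ∨
        (F = [[1], [2], [4], [2, 2], [2, -2]] ∧ Z = [] ∧ N = 0)) ∧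
      (∀ f ∈ F, pe ((r ^ 3 : (ZMod n)ˣ) : ZMod n) f ≠ 0) ∧
      (∀ z ∈ Z, pe ((r ^ 3 : (ZMod n)ˣ) : ZMod n) z = 0) := by
    have h1 := one_ne_zero_of P
    have h2 := two_ne_zero_of P
    have h4 := four_ne_zero_of P
    by_cases hU : 2 * (r : ZMod n) ^ 3 = 2
    · refine ⟨_, _, _, Or.inl ⟨rfl, rfl, rfl⟩, ?_, ?_⟩
      · have : (2 : ZMod n) + (r : ZMod n) ^ 3 * 2 ≠ 0 := fun h =>
          h4 (by linear_combination h - hU)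
        simp [pe, h1, h2, h4, this]
      · simp [pe]; linear_combination -hU
    · by_cases hU' : 2 * (r : ZMod n) ^ 3 = -2
      · refine ⟨_, _, _, Or.inr (Or.inl ⟨rfl, rfl, rfl⟩), ?_, ?_⟩
        · have : (2 : ZMod n) + -((r : ZMod n) ^ 3 * 2) ≠ 0 := fun h =>
            h4 (by linear_combination h + hU')
          simp [pe, h1, h2, h4, this]
        · simp [pe]; linear_combination hU'
      · refine ⟨_, _, _, Or.inr (Or.inr ⟨rfl, rfl, rfl⟩), ?_, by simp⟩
        have h5 : (2 : ZMod n) + (r : ZMod n) ^ 3 * 2 ≠ 0 := fun h =>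
          hU' (by linear_combination h)
        have h6 : (2 : ZMod n) + -((r : ZMod n) ^ 3 * 2) ≠ 0 := fun h =>
          hU (by linear_combination -h)
        simp [pe, h1, h2, h4, h5, h6]
  obtain ⟨F, Z, N, hFZ, hF, hZ⟩ := hcase
  rcases hm2.eq_or_lt with h | h
  · subst h
    have hρ : ¬ (r ^ 3 = 1 ∨ r ^ 3 = -1) := fun h => h12 ⟨Or.inr rfl, h⟩
    have hF' : ∀ f ∈ [1, 1] :: [1, -1] :: F, pe ((r ^ 3 : (ZMod n)ˣ) : ZMod n) f ≠ 0 := by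
      intro f hf
      rcases List.mem_append.1 (show f ∈ [[1, 1], [1, -1]] ++ F from hf) with hf | hf
      · exact direct_poly_ne_zero hρ f hf
      · exact hF f hf
    have H : Profile 2 3 6 3 := .of_min hs0 (by norm_num) (by norm_num)
    have h6 := downCheck_three_six
    rcases hFZ with ⟨rfl, rfl, rfl⟩ | ⟨rfl, rfl, rfl⟩ | ⟨rfl, rfl, rfl⟩
    · exact H.false_of_downCheck P T le_rfl hF' hZ h6.1
    · exact H.false_of_downCheck P T le_rfl hF' hZ h6.2.1
    · exact H.false_of_downCheck P T le_rfl hF' hZ h6.2.2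
  · have H : Profile m 3 9 3 := .of_min hs0 (by rw [min_eq_right (by omega)]; rfl) (by norm_num)
    have h9 := downCheck_three_nine
    rcases hFZ with ⟨rfl, rfl, rfl⟩ | ⟨rfl, rfl, rfl⟩ | ⟨rfl, rfl, rfl⟩
    · exact H.false_of_downCheck P T le_rfl hF hZ h9.1
    · exact H.false_of_downCheck P T le_rfl hF hZ h9.2.1
    · exact H.false_of_downCheck P T le_rfl hF hZ h9.2.2

end

/-! ### No twist for two coordinates, when `2 r ^ 2 ≠ ±2` -/

/-- Polynomials that do not vanish when `2ρ ≠ ±2` (recall `n ≥ 3` and `n ≠ 4`). -/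
abbrev basicPolys : List (List ℤ) := [[1], [2], [4], [1, 1], [1, -1], [2, 2], [2, -2]]

/-- Polynomials that vanish when `ρ` is `±2` or `±1/2`. -/
abbrev doublePolys : List (List ℤ) := [[4, 2], [4, -2], [2, 4], [2, -4]]

/-- Polynomials that vanish when some walk of six steps up is closed. -/
abbrev sixPolys : List (List ℤ) := [[1, 1, 1], [1, 1, -1], [1, -1, 1], [1, -1, -1]]

/-- Polynomials that vanish when some walk of eight steps up is closed. -/
abbrev eightPolys : List (List ℤ) := [[1, 1, 1, 1], [1, 1, 1, -1], [1, 1, -1, 1], [1, 1, -1, -1],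
  [1, -1, 1, 1], [1, -1, 1, -1], [1, -1, -1, 1], [1, -1, -1, -1]]

/-- The values `6`, `8`, `9` of `ms`, cut off at `9`, stand for `m = 3`, `m = 4` and `m ≥ 5`. -/
theorem downCheck_two : ∀ p ∈ [((6 : ℤ), sixPolys), (8, eightPolys), (9, [])],
    DownCheck p.1 2 (basicPolys ++ doublePolys ++ p.2) [] 5 0 := by
  decide +kernel

theorem someDownCheck_two : ∀ p ∈ [((6 : ℤ), sixPolys), (8, eightPolys), (9, [])],
    ∀ z ∈ doublePolys,
    (∀ a : Letter, a ≠ (false, false) →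
      1 ≤ countExt (closeTest p.1 2 [z]) 5 [(false, true), (true, true), a]) ∧
    ∃ g, countExt (maybeTest p.1 2 (basicPolys ++ doublePolys.erase z ++ p.2)) 5
      [(false, true), (false, true), (false, g)] ≤ 0 := by
  decide +kernel

/-- For `m = 2`, the two lists `Z` contain the polynomials that vanish when `ρ ^ 2 = 1` and when
`ρ ^ 2 = -1`. -/
theorem turnCheck_two_two : ∀ Z ∈ [[[(1 : ℤ), 1, -1, -1], [1, -1, -1, 1]],
      [[1, 1, 1, 1], [1, -1, 1, -1]]],
    (∀ a : Letter, a ≠ (true, false) →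
      1 ≤ countExt (closeTest 4 2 Z) 5 [(false, true), (false, true), a]) ∧
    countExt (maybeTest 4 2 (basicPolys ++ doublePolys ++ [[8], [1, 3], [1, -3]])) 5
      [(false, true), (true, true), (false, true)] ≤ 0 := by
  decide +kernel

theorem arcCheck_two_three : ∀ z ∈ sixPolys,
    1 ≤ countExt (closeTest 6 2 [z]) 4 [(false, true), (false, true)] ∧
    countExt (maybeTest 6 2 (basicPolys ++ [[6]])) 4 [(false, true), (true, true)] ≤ 0 := by
  decide +kernel

/-- With two coordinates and `m = 4`, if a closed walk of eight steps up exists, then the three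
given walks have closed extensions to eight letters. -/
theorem eightCheck_close : ∀ z ∈ eightPolys,
    1 ≤ countExt (closeTest 8 2 [z]) 4
      [(false, true), (false, true), (true, true), (true, false)] ∧
    ∃ g, 1 ≤ countExt (closeTest 8 2 [z]) 5 [(false, true), (false, true), (false, g)] ∧
      1 ≤ countExt (closeTest 8 2 [z]) 5 [(false, true), (false, false), (false, g)] := by
  decide +kernel

/-- After a turn, few reduced words have closed extensions to eight letters, and a walk that turns
twice has none. -/
theorem eightCheck_maybe :
    (∀ c d, c ≠ (false, false) → d ≠ inv c →
      countExt (maybeTest 8 2 (basicPolys ++ doublePolys ++ [[8]])) 4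
      [(false, true), (true, true), c, d] ≤ 0 ∨ (c.1 = true ∧ d = (false, c.2))) ∧
    (∀ c, countExt (maybeTest 8 2 (basicPolys ++ doublePolys ++ [[8]])) 5
      [(false, true), (true, true), c] ≤ 0 ∨ c.1 = true) ∧
    (∀ g, countExt (maybeTest 8 2 (basicPolys ++ doublePolys ++ [[8]])) 5
      [(true, g), (false, g), (true, g)] ≤ 0) := by
  decide +kernel

section
variable {m n : ℕ} {r : (ZMod n)ˣ}

/-- Some small moduli are excluded: the first three because `2x = ±2` for every square `x` of a
unit, the other two because they are not normalized. -/
theorem generic_not_small (P : CPMParams m 2 n r) (hN : CPMNormalized m n)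
    (h : 2 * (r : ZMod n) ^ 2 ≠ 2) (h' : 2 * (r : ZMod n) ^ 2 ≠ -2) :
    n ≠ 3 ∧ n ≠ 5 ∧ n ≠ 8 ∧ n ≠ 6 ∧ n ≠ 10 := by
  have hr : (r : ZMod n) * ((r⁻¹ : (ZMod n)ˣ) : ZMod n) = 1 := by simp
  refine ⟨?_, ?_, ?_, ?_, ?_⟩
  · rintro rfl
    have : ∀ x y : ZMod 3, x * y = 1 → 2 * x ^ 2 = 2 := by decide
    exact h (this _ _ hr)
  · rintro rfl
    have : ∀ x y : ZMod 5, x * y = 1 → 2 * x ^ 2 = 2 ∨ 2 * x ^ 2 = -2 := by decide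
    exact (this _ _ hr).elim h h'
  · rintro rfl
    have : ∀ x y : ZMod 8, x * y = 1 → 2 * x ^ 2 = 2 := by decide
    exact h (this _ _ hr)
  all_goals
    rintro rfl
    rcases hN.1 with h | h
    · exact absurd h (by decide)
    · omega

theorem dvd_of_natCast_eq_zero {k : ℕ} (h : (k : ZMod n) = 0) : n ∣ k :=
  (ZMod.natCast_eq_zero_iff k n).1 h

/-- `ρ = r ^ 2` is `±2` or `±1/2` only if `n` is odd. -/
theorem odd_of_double (hN : CPMNormalized m n) {z : List ℤ}
    (hz : z ∈ doublePolys) (h0 : pe ((r ^ 2 : (ZMod n)ˣ) : ZMod n) z = 0) : Odd n := by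
  rcases hN.1 with h | h4
  · exact h
  exfalso
  have h0' := congrArg (ZMod.castHom h4 (ZMod 4)) h0
  have hr : (ZMod.castHom h4 (ZMod 4)) (r : ZMod n) *
      (ZMod.castHom h4 (ZMod 4)) ((r⁻¹ : (ZMod n)ˣ) : ZMod n) = 1 := by
    rw [← map_mul, Units.mul_inv, map_one]
  generalize (ZMod.castHom h4 (ZMod 4)) ((r⁻¹ : (ZMod n)ˣ) : ZMod n) = y at hr
  have key : ∀ x y : ZMod 4, x * y = 1 → 4 + x ^ 2 * 2 ≠ 0 ∧ 4 - x ^ 2 * 2 ≠ 0 ∧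
      2 + x ^ 2 * 4 ≠ 0 ∧ 2 - x ^ 2 * 4 ≠ 0 := by decide
  obtain ⟨k1, k2, k3, k4⟩ := key _ _ hr
  simp only [List.mem_cons, List.not_mem_nil, or_false] at hz
  rcases hz with rfl | rfl | rfl | rfl <;>
    simp only [pe, Units.val_pow_eq_pow_val, map_add, map_mul, map_pow, map_intCast, map_zero,
      mul_zero, add_zero] at h0' <;> push_cast at h0'
  · exact k1 h0'
  · exact k2 (by linear_combination h0')
  · exact k3 h0'
  · exact k4 (by linear_combination h0')

theorem basicPolys_ne_zero (P : CPMParams m 2 n r)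
    (h : 2 * (r : ZMod n) ^ 2 ≠ 2) (h' : 2 * (r : ZMod n) ^ 2 ≠ -2) :
    ∀ f ∈ basicPolys, pe ((r ^ 2 : (ZMod n)ˣ) : ZMod n) f ≠ 0 := by
  have h1 := one_ne_zero_of P
  have h2 := two_ne_zero_of P
  have h4 := four_ne_zero_of P
  have k1 : (1 : ZMod n) + (r : ZMod n) ^ 2 ≠ 0 := fun e => h' (by linear_combination 2 * e)
  have k2 : (1 : ZMod n) + -(r : ZMod n) ^ 2 ≠ 0 := fun e => h (by linear_combination -2 * e)
  have k3 : (2 : ZMod n) + (r : ZMod n) ^ 2 * 2 ≠ 0 := fun e => h' (by linear_combination e)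
  have k4 : (2 : ZMod n) + -((r : ZMod n) ^ 2 * 2) ≠ 0 := fun e => h (by linear_combination -e)
  simp [pe, h1, h2, h4, k1, k2, k3, k4]

theorem eight_ne_zero (P : CPMParams m 2 n r) (hN : CPMNormalized m n)
    (h : 2 * (r : ZMod n) ^ 2 ≠ 2) (h' : 2 * (r : ZMod n) ^ 2 ≠ -2) : (8 : ZMod n) ≠ 0 := by
  intro e
  obtain ⟨n3, n5, n8, n6, n10⟩ := generic_not_small P hN h h'
  have h3 := P.three_le_n
  have h4 := P.n_ne_four
  have hd : n ∣ 8 := dvd_of_natCast_eq_zero (by exact_mod_cast e)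
  have := Nat.le_of_dvd (by norm_num) hd
  interval_cases n <;> omega

theorem ten_ne_zero (P : CPMParams m 2 n r) (hN : CPMNormalized m n)
    (h : 2 * (r : ZMod n) ^ 2 ≠ 2) (h' : 2 * (r : ZMod n) ^ 2 ≠ -2) : (10 : ZMod n) ≠ 0 := by
  intro e
  obtain ⟨n3, n5, n8, n6, n10⟩ := generic_not_small P hN h h'
  have h3 := P.three_le_n
  have hd : n ∣ 10 := dvd_of_natCast_eq_zero (by exact_mod_cast e)
  have := Nat.le_of_dvd (by norm_num) hd
  interval_cases n <;> omega

theorem six_ne_zero (P : CPMParams m 2 n r) (hN : CPMNormalized m n)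
    (h : 2 * (r : ZMod n) ^ 2 ≠ 2) (h' : 2 * (r : ZMod n) ^ 2 ≠ -2) : (6 : ZMod n) ≠ 0 := by
  intro e
  obtain ⟨n3, n5, n8, n6, n10⟩ := generic_not_small P hN h h'
  have h3 := P.three_le_n
  have hd : n ∣ 6 := dvd_of_natCast_eq_zero (by exact_mod_cast e)
  have := Nat.le_of_dvd (by norm_num) hd
  interval_cases n <;> omega

/-- At most one of the polynomials in `doublePolys` vanishes. -/
theorem eq_of_doublePolys {R : Type*} [CommRing R] {x : R} (n4 : (4 : R) ≠ 0) (n6 : (6 : R) ≠ 0)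
    (n8 : (8 : R) ≠ 0) (n10 : (10 : R) ≠ 0) {z f : List ℤ} (hz : z ∈ doublePolys)
    (h0 : pe x z = 0) (hf : f ∈ doublePolys) (e : pe x f = 0) : f = z := by
  simp only [List.mem_cons, List.not_mem_nil, or_false] at hz hf
  by_contra hne
  rcases hz with rfl | rfl | rfl | rfl <;> rcases hf with rfl | rfl | rfl | rfl <;>
    first
      | exact hne rfl
      | (simp only [pe, mul_zero, add_zero] at h0 e
         push_cast at h0 e
         first
          | exact n8 (by linear_combination h0 + e)
          | exact n4 (by linear_combination h0 + e)
          | exact n6 (by linear_combination 2 * h0 - e)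
          | exact n6 (by linear_combination 2 * e - h0)
          | exact n10 (by linear_combination 2 * h0 + e)
          | exact n10 (by linear_combination 2 * e + h0))

theorem doublePolys_erase_ne_zero (P : CPMParams m 2 n r) (hN : CPMNormalized m n)
    (h : 2 * (r : ZMod n) ^ 2 ≠ 2) (h' : 2 * (r : ZMod n) ^ 2 ≠ -2) {z : List ℤ}
    (hz : z ∈ doublePolys) (h0 : pe ((r ^ 2 : (ZMod n)ˣ) : ZMod n) z = 0) :
    ∀ f ∈ doublePolys.erase z, pe ((r ^ 2 : (ZMod n)ˣ) : ZMod n) f ≠ 0 := by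
  intro f hf e
  rw [List.Nodup.mem_erase_iff (by decide)] at hf
  exact hf.1 (eq_of_doublePolys (four_ne_zero_of P) (six_ne_zero P hN h h')
    (eight_ne_zero P hN h h') (ten_ne_zero P hN h h') hz h0 hf.2 e)

/-- For `m = 2` we have `ρ ^ 2 = ±1`, so that all reduced continuations of two steps down have
closed extensions to eight letters, while a walk that turns twice has none. -/
theorem not_twisted_two_two (P : CPMParams 2 2 n r) (hN : CPMNormalized 2 n)
    (h : 2 * (r : ZMod n) ^ 2 ≠ 2) (h' : 2 * (r : ZMod n) ^ 2 ≠ -2) :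
    ¬ Twisted (s := 2) 2 r := by
  intro T
  have H : Profile 2 2 4 2 := .of_min (by norm_num) (by norm_num) (by norm_num)
  have n8 := eight_ne_zero P hN h h'
  have n10 := ten_ne_zero P hN h h'
  obtain ⟨n3', n5', -⟩ := generic_not_small P hN h h'
  have h3 := P.three_le_n
  have hρ : ((r ^ 2 : (ZMod n)ˣ) : ZMod n) ^ 2 = 1 ∨ ((r ^ 2 : (ZMod n)ˣ) : ZMod n) ^ 2 = -1 := by
    have e : ((r ^ 2 : (ZMod n)ˣ) : ZMod n) ^ 2 = ((r ^ (2 * 2) : (ZMod n)ˣ) : ZMod n) := by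
      push_cast; ring
    rcases P.pow_eq with hp | hp <;> rw [e, hp] <;> simp
  have hdouble : ∀ z ∈ doublePolys, pe ((r ^ 2 : (ZMod n)ˣ) : ZMod n) z ≠ 0 := by
    intro z hz h0
    obtain ⟨k, hk⟩ := odd_of_double hN hz h0
    -- Eliminating `ρ` from the linear relation and `ρ ^ 2 = ±1`.
    have key : (12 : ZMod n) = 0 ∨ (20 : ZMod n) = 0 := by
      generalize ((r ^ 2 : (ZMod n)ˣ) : ZMod n) = x at h0 hρ
      simp only [List.mem_cons, List.not_mem_nil, or_false] at hz
      rcases hz with rfl | rfl | rfl | rfl <;> simp only [pe, mul_zero, add_zero] at h0 <;>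
        push_cast at h0 <;> rcases hρ with hρ | hρ
      · left; linear_combination (4 - 2 * x) * h0 + 4 * hρ
      · right; linear_combination (4 - 2 * x) * h0 + 4 * hρ
      · left; linear_combination (4 + 2 * x) * h0 + 4 * hρ
      · right; linear_combination (4 + 2 * x) * h0 + 4 * hρ
      · left; linear_combination (4 * x - 2) * h0 - 16 * hρ
      · right; linear_combination -(4 * x - 2) * h0 + 16 * hρ
      · left; linear_combination -(4 * x + 2) * h0 - 16 * hρ
      · right; linear_combination (4 * x + 2) * h0 + 16 * hρ
    rcases key with e | e
    · have hd : n ∣ 12 := dvd_of_natCast_eq_zero (by exact_mod_cast e)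
      have := Nat.le_of_dvd (by norm_num) hd
      interval_cases n <;> omega
    · have hd : n ∣ 20 := dvd_of_natCast_eq_zero (by exact_mod_cast e)
      have := Nat.le_of_dvd (by norm_num) hd
      interval_cases n <;> omega
  have hextra : ∀ f ∈ [[(8 : ℤ)], [1, 3], [1, -3]],
      pe ((r ^ 2 : (ZMod n)ˣ) : ZMod n) f ≠ 0 := by
    generalize ((r ^ 2 : (ZMod n)ˣ) : ZMod n) = x at hρ
    intro f hf e
    simp only [List.mem_cons, List.not_mem_nil, or_false] at hf
    rcases hf with rfl | rfl | rfl <;> simp only [pe, mul_zero, add_zero] at e <;>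
      push_cast at e
    · exact n8 e
    · rcases hρ with hρ | hρ
      · exact n8 (by linear_combination (3 * x - 1) * e - 9 * hρ)
      · exact n10 (by linear_combination -(3 * x - 1) * e + 9 * hρ)
    · rcases hρ with hρ | hρ
      · exact n8 (by linear_combination -(3 * x + 1) * e - 9 * hρ)
      · exact n10 (by linear_combination (3 * x + 1) * e + 9 * hρ)
  have hF : ∀ f ∈ basicPolys ++ doublePolys ++ [[8], [1, 3], [1, -3]],
      pe ((r ^ 2 : (ZMod n)ˣ) : ZMod n) f ≠ 0 := by
    intro f hf
    rcases List.mem_append.1 hf with hf | hf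
    · rcases List.mem_append.1 hf with hf | hf
      · exact basicPolys_ne_zero P h h' f hf
      · exact hdouble f hf
    · exact hextra f hf
  have hZ : ∃ Z ∈ [[[(1 : ℤ), 1, -1, -1], [1, -1, -1, 1]], [[1, 1, 1, 1], [1, -1, 1, -1]]],
      ∀ z ∈ Z, pe ((r ^ 2 : (ZMod n)ˣ) : ZMod n) z = 0 := by
    generalize ((r ^ 2 : (ZMod n)ˣ) : ZMod n) = x at hρ
    rcases hρ with hρ | hρ
    · refine ⟨_, List.mem_cons_self, ?_⟩
      intro z hz
      simp only [List.mem_cons, List.not_mem_nil, or_false] at hz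
      rcases hz with rfl | rfl <;> simp only [pe, mul_zero, add_zero] <;> push_cast
      · linear_combination -(1 + x) * hρ
      · linear_combination (x - 1) * hρ
    · refine ⟨_, List.mem_cons_of_mem _ List.mem_cons_self, ?_⟩
      intro z hz
      simp only [List.mem_cons, List.not_mem_nil, or_false] at hz
      rcases hz with rfl | rfl <;> simp only [pe, mul_zero, add_zero] <;> push_cast
      · linear_combination (1 + x) * hρ
      · linear_combination (1 - x) * hρ
  obtain ⟨Z, hZ, hZ0⟩ := hZ
  obtain ⟨hc1, hc2⟩ := turnCheck_two_two Z hZ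
  exact H.false_of_turn P T (F := basicPolys ++ doublePolys ++ [[8], [1, 3], [1, -3]]) 5 le_rfl hF
    hZ0 hc1 hc2

/-- If there are no closed walks of six or eight steps up or down, the generic argument for
`8`-cycles applies, with a variant when `ρ` is `±2` or `±1/2`. -/
theorem Profile.not_twisted_two {M : ℤ} {D : List (List ℤ)} (H : Profile m 2 M 2)
    (hMD : (M, D) ∈ [((6 : ℤ), sixPolys), (8, eightPolys), (9, [])])
    (P : CPMParams m 2 n r) (hN : CPMNormalized m n)
    (h : 2 * (r : ZMod n) ^ 2 ≠ 2) (h' : 2 * (r : ZMod n) ^ 2 ≠ -2)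
    (hD : ∀ f ∈ D, pe ((r ^ 2 : (ZMod n)ˣ) : ZMod n) f ≠ 0) :
    ¬ Twisted (s := 2) m r := by
  intro T
  by_cases hQ : ∃ z ∈ doublePolys, pe ((r ^ 2 : (ZMod n)ˣ) : ZMod n) z = 0
  · obtain ⟨z, hz, h0⟩ := hQ
    have hc := someDownCheck_two (M, D) hMD z hz
    refine H.false_of_some_down P T (F := basicPolys ++ doublePolys.erase z ++ D) 5 le_rfl ?_
      (by simpa using h0) hc.1 hc.2
    intro f hf
    rcases List.mem_append.1 hf with hf | hf
    · rcases List.mem_append.1 hf with hf | hf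
      · exact basicPolys_ne_zero P h h' f hf
      · exact doublePolys_erase_ne_zero P hN h h' hz h0 f hf
    · exact hD f hf
  · refine H.false_of_downCheck P T (F := basicPolys ++ doublePolys ++ D) (Z := []) le_rfl ?_
      (by simp) (downCheck_two (M, D) hMD)
    intro f hf
    rcases List.mem_append.1 hf with hf | hf
    · rcases List.mem_append.1 hf with hf | hf
      · exact basicPolys_ne_zero P h h' f hf
      · exact fun h0 => hQ ⟨f, hf, h0⟩
    · exact hD f hf

theorem not_twisted_three_two (P : CPMParams 3 2 n r) (hN : CPMNormalized 3 n)
    (h : 2 * (r : ZMod n) ^ 2 ≠ 2) (h' : 2 * (r : ZMod n) ^ 2 ≠ -2) :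
    ¬ Twisted (s := 2) 3 r := by
  have H : Profile 3 2 6 2 := .of_min (by norm_num) (by norm_num) (by norm_num)
  by_cases hD : ∃ z ∈ sixPolys, pe ((r ^ 2 : (ZMod n)ˣ) : ZMod n) z = 0
  · intro T
    obtain ⟨z, hz, h0⟩ := hD
    have hc := arcCheck_two_three z hz
    refine H.false_of_arc P T (F := basicPolys ++ [[6]]) 4 (by norm_num) ?_
      (by simpa using h0) hc.1 hc.2
    intro f hf
    rcases List.mem_append.1 hf with hf | hf
    · exact basicPolys_ne_zero P h h' f hf
    · have n6 := six_ne_zero P hN h h'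
      simp only [List.mem_cons, List.not_mem_nil, or_false] at hf
      subst hf
      simpa [pe] using n6
  · exact H.not_twisted_two (by simp) P hN h h' fun f hf h0 => hD ⟨f, hf, h0⟩

/-- For `m = 4`, closed walks of eight steps up exclude that `ρ` is `±2` or `±1/2`. -/
theorem doublePolys_ne_zero_of_eight (P : CPMParams 4 2 n r) (hN : CPMNormalized 4 n)
    (h : 2 * (r : ZMod n) ^ 2 ≠ 2) (h' : 2 * (r : ZMod n) ^ 2 ≠ -2) {w : List ℤ}
    (hw : w ∈ eightPolys) (hw0 : pe ((r ^ 2 : (ZMod n)ˣ) : ZMod n) w = 0) :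
    ∀ z ∈ doublePolys, pe ((r ^ 2 : (ZMod n)ˣ) : ZMod n) z ≠ 0 := by
  intro z hz h0
  have hodd := odd_of_double hN hz h0
  obtain ⟨n3, n5, -⟩ := generic_not_small P hN h h'
  have h3 := P.three_le_n
  have hρ : ((r ^ 2 : (ZMod n)ˣ) : ZMod n) ^ 4 = 1 ∨ ((r ^ 2 : (ZMod n)ˣ) : ZMod n) ^ 4 = -1 := by
    have e : ((r ^ 2 : (ZMod n)ˣ) : ZMod n) ^ 4 = ((r ^ (4 * 2) : (ZMod n)ˣ) : ZMod n) := by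
      push_cast; ring
    rcases P.pow_eq with hp | hp <;> rw [e, hp] <;> simp
  -- Eliminating `ρ` from the linear relation and `ρ ^ 4 = ±1`.
  have key : (240 : ZMod n) = 0 ∨ (272 : ZMod n) = 0 := by
    generalize ((r ^ 2 : (ZMod n)ˣ) : ZMod n) = x at h0 hρ
    simp only [List.mem_cons, List.not_mem_nil, or_false] at hz
    rcases hz with rfl | rfl | rfl | rfl <;> simp only [pe, mul_zero, add_zero] at h0 <;>
      push_cast at h0 <;> rcases hρ with hρ | hρ
    · left; linear_combination (4 - 2 * x) * (16 + 4 * x ^ 2) * h0 + 16 * hρ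
    · right; linear_combination (4 - 2 * x) * (16 + 4 * x ^ 2) * h0 + 16 * hρ
    · left; linear_combination (4 + 2 * x) * (16 + 4 * x ^ 2) * h0 + 16 * hρ
    · right; linear_combination (4 + 2 * x) * (16 + 4 * x ^ 2) * h0 + 16 * hρ
    · left; linear_combination (4 * x - 2) * (16 * x ^ 2 + 4) * h0 - 256 * hρ
    · right; linear_combination -(4 * x - 2) * (16 * x ^ 2 + 4) * h0 + 256 * hρ
    · left; linear_combination -(4 * x + 2) * (16 * x ^ 2 + 4) * h0 - 256 * hρ
    · right; linear_combination (4 * x + 2) * (16 * x ^ 2 + 4) * h0 + 256 * hρ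
  have hn : n ∣ 15 ∨ n ∣ 17 := by
    have hc : ∀ k : ℕ, Nat.Coprime n (2 ^ k) := fun k =>
      (Nat.Coprime.pow_right k (Nat.coprime_two_right.2 hodd))
    rcases key with e | e
    · left
      have hd : n ∣ 2 ^ 4 * 15 := dvd_of_natCast_eq_zero (by exact_mod_cast e)
      exact (hc 4).dvd_of_dvd_mul_left hd
    · right
      have hd : n ∣ 2 ^ 4 * 17 := dvd_of_natCast_eq_zero (by exact_mod_cast e)
      exact (hc 4).dvd_of_dvd_mul_left hd
  have hn' : n = 15 ∨ n = 17 := by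
    rcases hn with hd | hd <;> have := Nat.le_of_dvd (by norm_num) hd <;>
      interval_cases n <;> omega
  have hr : (r : ZMod n) * ((r⁻¹ : (ZMod n)ˣ) : ZMod n) = 1 := by simp
  rw [Units.val_pow_eq_pow_val] at h0 hw0
  rcases hn' with rfl | rfl
  · have key : ∀ x y : ZMod 15, x * y = 1 → ∀ z ∈ doublePolys, pe (x ^ 2) z ≠ 0 := by
      decide +kernel
    exact key _ _ hr z hz h0
  · have key : ∀ x : ZMod 17, ∀ z ∈ doublePolys, pe (x ^ 2) z = 0 →
        ∀ w ∈ eightPolys, pe (x ^ 2) w ≠ 0 := by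
      decide +kernel
    exact key _ z hz h0 w hw hw0

/-- For `m = 4`, when a closed walk of eight steps up exists, the walk that goes down twice, up
twice and the walk of three steps down lie on `8`-cycles, as does their combination. The
corresponding walks after a turn are so restricted that the combination corresponds to a walk which
turns twice and lies on no `8`-cycle. -/
theorem not_twisted_four_two (P : CPMParams 4 2 n r) (hN : CPMNormalized 4 n)
    (h : 2 * (r : ZMod n) ^ 2 ≠ 2) (h' : 2 * (r : ZMod n) ^ 2 ≠ -2) :
    ¬ Twisted (s := 2) 4 r := by
  have H : Profile 4 2 8 2 := .of_min (by norm_num) (by norm_num) (by norm_num)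
  by_cases hD : ∃ z ∈ eightPolys, pe ((r ^ 2 : (ZMod n)ˣ) : ZMod n) z = 0
  · rintro ⟨R, p, C, hw⟩
    obtain ⟨z, hz, h0⟩ := hD
    have hZ : ∀ f ∈ [z], pe ((r ^ 2 : (ZMod n)ˣ) : ZMod n) f = 0 := by simpa using h0
    have hF : ∀ f ∈ basicPolys ++ doublePolys ++ [[8]],
        pe ((r ^ 2 : (ZMod n)ˣ) : ZMod n) f ≠ 0 := by
      intro f hf
      rcases List.mem_append.1 hf with hf | hf
      · rcases List.mem_append.1 hf with hf | hf
        · exact basicPolys_ne_zero P h h' f hf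
        · exact doublePolys_ne_zero_of_eight P hN h h' hz h0 f hf
      · have n8 := eight_ne_zero P hN h h'
        simp only [List.mem_cons, List.not_mem_nil, or_false] at hf
        subst hf
        simpa [pe] using n8
    obtain ⟨hc1, g, hc2, hc3⟩ := eightCheck_close z hz
    obtain ⟨hm1, hm2, hm3⟩ := eightCheck_maybe
    have D := C.symm
    have hw' := hw.symm
    have hqq := hw'.run_rel
    obtain ⟨c, hc⟩ := D.fwd hqq (true, true)
    obtain ⟨d, hd⟩ := D.fwd hc (true, false)
    obtain ⟨c₂, hc₂⟩ := D.fwd hqq (false, g)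
    have l1 := H.le_cnt (r := r) hZ (by simp) hc1
    have l2 := H.le_cnt (r := r) hZ (by simp) hc2
    have l3 := H.le_cnt (r := r) hZ (by simp) hc3
    have i1 := D.cnt_eq P P 4 (hw'.append (l₂ := [(true, true), (true, false)]) (l₂' := [c, d])
      ⟨hqq, hc, hd⟩)
    have i2 := D.cnt_eq P P 5 (hw'.append (l₂ := [(false, g)]) (l₂' := [c₂]) ⟨hqq, hc₂⟩)
    -- The two steps up are undone before the step `(false, g)`.
    have back : ∀ (y : Cover 2 n) (a b : Letter), move r (move r (move r (move r y a) b) (inv b))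
        (inv a) = y := fun y a b => by rw [move_inv, move_inv]
    have i3 := D.cnt_eq P P 5 (y := move r (move r (run r p [(false, true), (false, true)])
        (true, true)) (true, false))
      (y' := move r (move r (run r p [(false, true), (true, true)]) c) d)
      (q := [inv (true, false), inv (true, true), (false, g)]) (q' := [inv d, inv c, c₂])
      ⟨hd, by rw [move_inv, move_inv]; exact hc, by rw [back, back]; exact hqq,
        by
          change R (move r _ _) (move r _ _)
          rw [back, back]
          exact hc₂⟩
    simp only [List.cons_append, List.nil_append] at i1 i2
    simp only [inv, Bool.not_true, Bool.not_false] at i3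
    rw [i1] at l1
    rw [i2] at l2
    rw [i3] at l3
    have hne : c ≠ c₂ := fun e => by
      have := (D.letter_iff P P hc hc₂).2 e
      simp at this
    have hcf : c ≠ (false, false) := fun e => by
      have := (D.letter_inv P P hw'.2.1 hc).2 e
      simp [inv] at this
    have hdc : d ≠ inv c := fun e => by
      have := (D.letter_inv P P hqq hd).2 e
      simp [inv] at this
    rcases hm1 c d hcf hdc with e | ⟨e1, e2⟩
    · have := H.cnt_le (r := r) hF (by simp) e
      omega
    rcases hm2 c₂ with e | e3
    · have := H.cnt_le (r := r) hF (by simp) e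
      omega
    obtain ⟨c1, g'⟩ := c
    obtain ⟨c2, g''⟩ := c₂
    dsimp only at e1 e2 e3
    subst e1 e2 e3
    have hg : g'' = !g' := by
      cases g' <;> cases g'' <;> simp at hne ⊢
    subst hg
    have := H.cnt_le (r := r) hF (by simp) (hm3 (!g'))
    simp only [Bool.not_true, Bool.not_false] at l3
    omega
  · exact H.not_twisted_two (by simp) P hN h h' fun f hf h0 => hD ⟨f, hf, h0⟩

theorem not_twisted_two_of_generic (P : CPMParams m 2 n r) (hN : CPMNormalized m n)
    (h : 2 * (r : ZMod n) ^ 2 ≠ 2) (h' : 2 * (r : ZMod n) ^ 2 ≠ -2) :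
    ¬ Twisted (s := 2) m r := by
  have h3 := P.three_le_ms
  rcases lt_or_ge 4 m with h4 | h4
  · have H : Profile m 2 9 2 := .of_min (by norm_num) (by rw [min_eq_right (by omega)]; rfl)
      (by norm_num)
    exact H.not_twisted_two (D := []) (by simp) P hN h h' (by simp)
  · interval_cases m
    · omega
    · omega
    · exact not_twisted_two_two P hN h h'
    · exact not_twisted_three_two P hN h h'
    · exact not_twisted_four_two P hN h h'

end

/-! ### Infinite walks -/

/-- The vertex reached after `k` steps by a walk that reads the letters `f 0, f 1, …`. -/
def path {s n : ℕ} (r : (ZMod n)ˣ) (y : Cover s n) (f : ℕ → Letter) : ℕ → Cover s n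
  | 0 => y
  | k + 1 => move r (path r y f k) (f k)

section
variable {m s n m' s' n' : ℕ} {r : (ZMod n)ˣ} {r' : (ZMod n')ˣ}
variable {R : Cover s n → Cover s' n' → Prop}

theorem Corr.exists_path (C : Corr m m' r r' R) {y : Cover s n} {y' : Cover s' n'} (h : R y y')
    (f : ℕ → Letter) : ∃ g, ∀ k, R (path r y f k) (path r' y' g k) := by
  have key : ∀ k, ∀ x : {x : Cover s' n' // R (path r y f k) x},
      ∃ a, R (path r y f (k + 1)) (move r' x.1 a) := fun k x => C.fwd x.2 (f k)
  choose F hF using key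
  let X : ∀ k, {x : Cover s' n' // R (path r y f k) x} := fun k =>
    Nat.rec ⟨y', h⟩ (fun k x => ⟨move r' x.1 (F k x), hF k x⟩) k
  refine ⟨fun k => F k (X k), fun k => ?_⟩
  have hX : ∀ k, path r' y' (fun k => F k (X k)) k = (X k).1 := by
    intro k
    induction k with
    | zero => rfl
    | succ k ih => rw [path, ih]
  rw [hX]
  exact (X k).2

theorem path_add (r : (ZMod n)ˣ) (y : Cover s n) (f : ℕ → Letter) (k j : ℕ) :
    path r y f (k + j) = path r (path r y f k) (fun i => f (k + i)) j := by
  induction j with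
  | zero => rfl
  | succ j ih => rw [← add_assoc, path, path, ih]

end

/-! ### Two coordinates with `2 r ^ 2 = ±2` -/

/-- Counts of closed extensions that determine the shape of the walks corresponding to a zigzag and
to a helix, the latter being the walk that goes down with the signs `x, y, x', y', x, …`, where
`x'` is `x` or its opposite according to `τ`. -/
structure ShapeCounts (m : ℕ) {n : ℕ} (r : (ZMod n)ˣ) (τ : Bool) : Prop where
  turn_pos : ∀ x y, 1 ≤ cnt m 2 r 3 [(false, x), (false, y), (true, y)]
  zigzag_eq_zero : ∀ d b, cnt m 2 r 3 [(d, b), (!d, b), (d, b)] ≤ 0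
  helix_pos : ∀ x y, 1 ≤ cnt m 2 r 3 [(false, x), (false, y), (false, x ^^ τ)]
  helix_eq_zero : ∀ x y, cnt m 2 r 2 [(false, x), (false, y), (false, x ^^ τ), (false, y ^^ τ)] ≤ 0
  straight : ∀ d b g h, cnt m 2 r 3 [(!d, b), (!d, g), (!d, h)] ≤ 0 ∨
    1 ≤ cnt m 2 r 2 [(d, b), (!d, b), (!d, g), (!d, h)]
  square_pos : ∀ d b g, 1 ≤ cnt m 2 r 2 [(!d, b), (!d, g), (d, g), (d, !b)]

/-- Polynomials that do not vanish if `2ρ = 2` or `2ρ = -2`, in dependence of `τ`. -/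
abbrev shapePolys (τ : Bool) : List (List ℤ) :=
  [[1], [2], [3], [4], [6], if τ then [2, 2] else [2, -2]]

/-- The values `4`, `6`, `8`, `9` of `ms`, cut off at `9`, stand for `m = 2`, `m = 3`, `m = 4` and
`m ≥ 5`; the second entry lists further polynomials that do not vanish in the respective case. -/
theorem shapeCheck : ∀ p ∈ [((4 : ℤ), [[(1 : ℤ), 1], [1, -1]]), (6, sixPolys), (8, []), (9, [])],
    ∀ τ : Bool,
    (∀ x y, 1 ≤ countExt (closeTest p.1 2 [if τ then [2, -2] else [2, 2]]) 3
      [(false, x), (false, y), (true, y)]) ∧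
    (∀ d b, countExt (maybeTest p.1 2 (shapePolys τ ++ p.2)) 3 [(d, b), (!d, b), (d, b)] ≤ 0) ∧
    (∀ x y, 1 ≤ countExt (closeTest p.1 2 [if τ then [2, -2] else [2, 2]]) 3
      [(false, x), (false, y), (false, x ^^ τ)]) ∧
    (∀ x y, countExt (maybeTest p.1 2 (shapePolys τ ++ p.2)) 2
      [(false, x), (false, y), (false, x ^^ τ), (false, y ^^ τ)] ≤ 0) ∧
    (∀ d b g h, countExt (maybeTest p.1 2 (shapePolys τ ++ p.2)) 3
        [(!d, b), (!d, g), (!d, h)] ≤ 0 ∨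
      1 ≤ countExt (closeTest p.1 2 [if τ then [2, -2] else [2, 2]]) 2
        [(d, b), (!d, b), (!d, g), (!d, h)]) ∧
    (∀ d b g, 1 ≤ countExt (closeTest p.1 2 [if τ then [2, -2] else [2, 2]]) 2
      [(!d, b), (!d, g), (d, g), (d, !b)]) := by
  decide +kernel

/-- The case `n = 3`, in which `6 = 0`. -/
theorem someDownCheck_of_three : ∀ M ∈ [(8 : ℤ), 9], ∀ τ : Bool,
    (∀ a : Letter, a ≠ (false, false) →
      1 ≤ countExt (closeTest M 2 [[6], if τ then [2, -2] else [2, 2]]) 3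
        [(false, true), (true, true), a]) ∧
    ∃ g, countExt (maybeTest M 2 [[1], [2], [4], if τ then [2, 2] else [2, -2]]) 3
      [(false, true), (false, true), (false, g)] ≤ 0 := by
  decide +kernel

/-- The case `m = 2`, `ρ = ±1`, in which two steps down lie on a `4`-cycle. -/
theorem arcCheck_two_two : ∀ z ∈ [[(1 : ℤ), -1], [1, 1]],
    1 ≤ countExt (closeTest 4 2 [z]) 2 [(false, true), (false, true)] ∧
    countExt (maybeTest 4 2 [[1], [2], [4]]) 2 [(false, true), (true, true)] ≤ 0 := by
  decide +kernel

section
variable {m n : ℕ} {r : (ZMod n)ˣ} {τ : Bool}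

theorem Profile.shapeCounts {M : ℤ} {E : List (List ℤ)} (H : Profile m 2 M 2)
    (hME : (M, E) ∈ [((4 : ℤ), [[(1 : ℤ), 1], [1, -1]]), (6, sixPolys), (8, []), (9, [])])
    (hF : ∀ f ∈ shapePolys τ ++ E, pe ((r ^ 2 : (ZMod n)ˣ) : ZMod n) f ≠ 0)
    (hZ : ∀ z ∈ [if τ then [2, -2] else [2, 2]], pe ((r ^ 2 : (ZMod n)ˣ) : ZMod n) z = 0) :
    ShapeCounts m r τ := by
  obtain ⟨h1, h2, h3, h4, h5, h6⟩ := shapeCheck (M, E) hME τ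
  exact {
    turn_pos := fun x y => H.le_cnt hZ (by simp) (h1 x y)
    zigzag_eq_zero := fun x y => H.cnt_le hF (by simp) (h2 x y)
    helix_pos := fun x y => H.le_cnt hZ (by simp) (h3 x y)
    helix_eq_zero := fun x y => H.cnt_le hF (by simp) (h4 x y)
    straight := fun d b g h => (h5 d b g h).imp (fun h => H.cnt_le hF (by simp) h)
      (fun h => H.le_cnt hZ (by simp) h)
    square_pos := fun d b g => H.le_cnt hZ (by simp) (h6 d b g) }

theorem edgeVec_sub (s : ℕ) (g : ℤ) :
    edgeVec s r (g - s) = (((r ^ s)⁻¹ : (ZMod n)ˣ) : ZMod n) • edgeVec s r g := by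
  unfold edgeVec
  rw [Int.sub_emod_right, smul_smul, ← Units.val_mul, zpow_sub, mul_comm]
  simp

theorem edgeVec_apply_self (P : CPMParams m s n r) (g : ℤ) :
    edgeVec s r g (idx P g) = ((r ^ g : (ZMod n)ˣ) : ZMod n) := by
  have h := edgeVec_apply_idx P 0 g g
  simpa using h

end

section
variable {m s n m' s' n' : ℕ} {r : (ZMod n)ˣ} {r' : (ZMod n')ˣ}
variable {R : Cover s n → Cover s' n' → Prop}

theorem Corr.path_inv (C : Corr m m' r r' R) (P : CPMParams m s n r)
    (P' : CPMParams m' s' n' r') {y : Cover s n} {y' : Cover s' n'} {f g : ℕ → Letter}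
    (h : ∀ k, R (path r y f k) (path r' y' g k)) (k : ℕ) :
    f (k + 1) = inv (f k) ↔ g (k + 1) = inv (g k) :=
  C.letter_inv P P' (h k) (h (k + 2))

theorem path_fst_of_fst_eq {y : Cover s n} {g : ℕ → Letter} {u : Bool} (hg : ∀ k, (g k).1 = u)
    (k : ℕ) : (path r y g k).1 = y.1 + sgn u * k := by
  induction k with
  | zero => simp [path]
  | succ k ih =>
    simp only [path, move, ih, hg]
    push_cast
    ring

/-- The letters that alternate in direction, beginning with the direction `u`, and have the constant
sign `b`. -/
def zigzag (u b : Bool) (k : ℕ) : Letter := (decide (k % 2 = 1) ^^ u, b)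

theorem zigzag_zero (u b : Bool) : zigzag u b 0 = (u, b) := by
  simp [zigzag]

theorem zigzag_succ (u b : Bool) (k : ℕ) : zigzag u b (k + 1) = (!(zigzag u b k).1, b) := by
  have : decide ((k + 1) % 2 = 1) = !decide (k % 2 = 1) := by
    rw [← decide_not]; exact decide_eq_decide.2 (by omega)
  rw [zigzag, zigzag, this]
  simp

theorem path_zigzag (y : Cover s n) (u b : Bool) (k : ℕ) :
    path r y (zigzag u b) (2 * k) =
      (y.1, y.2 + (2 * k) • sgn b • edgeVec s r (gap y.1 (u, b))) := by
  induction k with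
  | zero => simp [path]
  | succ k ih =>
    have h1 : zigzag u b (2 * k) = (u, b) := by simp [zigzag]
    have h2 : zigzag u b (2 * k + 1) = (!u, b) := by rw [zigzag_succ, h1]
    rw [show 2 * (k + 1) = 2 * k + 1 + 1 by ring, path, path, ih, h1, h2]
    have h3 : gap (y.1 + sgn u) (!u, b) = gap y.1 (u, b) := by
      cases u <;> simp [gap, sgn]
      ring
    refine Prod.ext ?_ ?_
    · simp [move, sgn_not]
    · simp only [move, h3]
      rw [add_smul, add_smul, one_smul]
      abel

end

theorem eq_of_ne_inv : ∀ (d b : Bool) (z : Letter), z.1 = d → z ≠ inv (!d, b) → z = (d, b) := by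
  decide

section
variable {m n : ℕ} {r : (ZMod n)ˣ} {τ : Bool}

/-- A closed zigzag corresponds to a walk that always goes down. -/
theorem ShapeCounts.dvd_addOrderOf (S : ShapeCounts m r τ) (P : CPMParams m 2 n r)
    (T : Twisted (s := 2) m r) : m ∣ addOrderOf (2 : ZMod n) := by
  obtain ⟨R, p, C, hw⟩ := T
  obtain ⟨g, hg⟩ := C.exists_path hw.1 (zigzag false true)
  have hg0 : g 0 = (false, true) := C.letter_unique P (hg 1) hw.2.1
  have hg1 : g 1 = (false, true) := by
    have h2 := hg 2
    simp only [path, hg0] at h2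
    exact C.letter_unique P h2 hw.2.2
  have hdown : ∀ k, (g k).1 = false ∧ (g (k + 1)).1 = false := by
    intro k
    induction k with
    | zero => simp [hg0, hg1]
    | succ k ih =>
      refine ⟨ih.2, ?_⟩
      by_contra hne
      have hinv : g (k + 2) ≠ inv (g (k + 1)) := fun e => by
        have := (C.path_inv P P hg (k + 1)).2 e
        rw [zigzag_succ] at this
        simp [inv, zigzag] at this
      have e0 : g k = (false, (g k).2) := Prod.ext ih.1 rfl
      have e1 : g (k + 1) = (false, (g (k + 1)).2) := Prod.ext ih.2 rfl
      have e2 : g (k + 2) = (true, (g (k + 1)).2) := by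
        rw [e1] at hinv
        exact eq_of_ne_inv _ _ _ (by simpa using hne) hinv
      have hcnt := C.cnt_eq P P 3 (y := path r p _ k) (y' := path r p g k)
        (q := [zigzag false true k, zigzag false true (k + 1), zigzag false true (k + 2)])
        (q' := [g k, g (k + 1), g (k + 2)]) ⟨hg k, hg (k + 1), hg (k + 2), hg (k + 3)⟩
      have h1 := S.turn_pos (g k).2 (g (k + 1)).2
      rw [← e0, ← e1, ← e2, ← hcnt, zigzag_succ _ _ (k + 1), zigzag_succ _ _ k,
        Bool.not_not] at h1
      have h2 := S.zigzag_eq_zero (zigzag false true k).1 true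
      exact absurd (h1.trans h2) (by norm_num)
  have h0 : proj m (path r p (zigzag false true)
      (2 * addOrderOf (2 : ZMod n))) = proj m p := by
    rw [path_zigzag, proj_eq_iff]
    refine ⟨by simp, ?_⟩
    have h2 : (2 * addOrderOf (2 : ZMod n)) • sgn true •
        edgeVec 2 r (gap p.1 (false, true)) = 0 := by
      generalize sgn true • edgeVec 2 r (gap p.1 (false, true)) = v
      funext i
      have := addOrderOf_nsmul_eq_zero (2 : ZMod n)
      rw [nsmul_eq_mul] at this
      simp only [Pi.smul_apply, Pi.zero_apply, nsmul_eq_mul]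
      push_cast
      linear_combination v i * this
    rw [h2, add_zero]
  have h1 := (C.proj_iff (hg _) hw.1).1 h0
  rw [proj_eq_iff, path_fst_of_fst_eq fun k => (hdown k).1] at h1
  have h3 : ((m * 2 : ℕ) : ℤ) ∣ ((2 * addOrderOf (2 : ZMod n) : ℕ) : ℤ) := by
    simpa [sgn] using h1.1
  rw [Int.natCast_dvd_natCast, mul_comm 2] at h3
  exact Nat.dvd_of_mul_dvd_mul_right two_pos h3

/-- If `2δ = 0`, then `δ` is `0` or `n / 2`, and `n / 2` is even. -/
theorem mul_self_eq_zero_of_normalized (hN : CPMNormalized m n) {δ : ZMod n} (h : 2 * δ = 0) :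
    δ * δ = 0 := by
  rcases hN.1 with hodd | ⟨k, hk⟩
  · have h2 : IsUnit (2 : ZMod n) := isUnit_two_of_odd hodd
    rw [(h2.mul_right_eq_zero).1 h, mul_zero]
  · obtain ⟨d, rfl⟩ := ZMod.intCast_surjective δ
    have h1 : (n : ℤ) ∣ 2 * d := (ZMod.intCast_zmod_eq_zero_iff_dvd _ n).1 (by exact_mod_cast h)
    obtain ⟨j, hj⟩ := h1
    have hd : d = 2 * (k * j) := by
      rw [hk] at hj
      push_cast at hj
      linarith
    have : ((d : ℤ) : ZMod n) = 2 * ((k * j : ℤ) : ZMod n) := by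
      rw [hd]; push_cast; ring
    calc (d : ZMod n) * d = (2 * d) * ((k * j : ℤ) : ZMod n) := by nth_rw 2 [this]; ring
      _ = 0 := by rw [h, zero_mul]

/-- The signs of the steps of the helix. -/
def helixSign (τ : Bool) (k : ℕ) : Bool := !(τ && decide (2 ≤ k % 4))

theorem helixSign_add_two (τ : Bool) (k : ℕ) : helixSign τ (k + 2) = (helixSign τ k ^^ τ) := by
  have : decide (2 ≤ (k + 2) % 4) = !decide (2 ≤ k % 4) := by
    rw [← decide_not]; exact decide_eq_decide.2 (by omega)
  rw [helixSign, helixSign, this]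
  cases τ <;> simp

/-- The vector by which two steps of the helix at distance two move the coordinate they share. -/
def helixVec (r : (ZMod n)ˣ) (τ : Bool) (g : ℤ) : Fin 2 → ZMod n :=
  edgeVec 2 r g - sgn τ • edgeVec 2 r (g - 2)

/-- The factor `1 ∓ ρ⁻¹`, where `ρ = r ^ 2`. -/
def helixFactor (r : (ZMod n)ˣ) (τ : Bool) : ZMod n :=
  1 - sgn τ * (((r ^ 2)⁻¹ : (ZMod n)ˣ) : ZMod n)

theorem helixVec_eq (r : (ZMod n)ˣ) (τ : Bool) (g : ℤ) :
    helixVec r τ g = helixFactor r τ • edgeVec 2 r g := by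
  have := edgeVec_sub (r := r) 2 g
  rw [Nat.cast_two] at this
  rw [helixVec, helixFactor, this]
  funext i
  simp only [Pi.sub_apply, zsmul_eq_mul, Pi.mul_apply, Pi.intCast_apply, Pi.smul_apply,
    smul_eq_mul]
  ring

theorem two_mul_helixFactor (hρ : 2 * (r : ZMod n) ^ 2 = 2 * sgn τ) :
    2 * helixFactor r τ = 0 := by
  have h1 : (r : ZMod n) ^ 2 * (((r ^ 2)⁻¹ : (ZMod n)ˣ) : ZMod n) = 1 := by
    rw [← Units.val_pow_eq_pow_val, Units.mul_inv]
  unfold helixFactor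
  linear_combination (((r ^ 2)⁻¹ : (ZMod n)ˣ) : ZMod n) * hρ - 2 * h1

/-- The helix moves each coordinate by the same amount in every turn, because `δ ρ⁻² = δ` for
`δ = 1 ∓ ρ⁻¹`. -/
theorem helixVec_sub_four (hN : CPMNormalized m n) (hρ : 2 * (r : ZMod n) ^ 2 = 2 * sgn τ)
    (g : ℤ) : helixVec r τ (g - 4) = helixVec r τ g := by
  have h2 := two_mul_helixFactor hρ
  have hδ := mul_self_eq_zero_of_normalized hN h2
  have e1 := edgeVec_sub (r := r) 2 g
  have e2 := edgeVec_sub (r := r) 2 (g - 2)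
  rw [Nat.cast_two] at e1 e2
  rw [helixVec_eq, helixVec_eq, show g - 4 = g - 2 - 2 by ring, e2, e1, smul_smul, smul_smul]
  congr 1
  have hs : ((sgn τ : ℤ) : ZMod n) * (sgn τ : ℤ) = 1 := by cases τ <;> simp [sgn]
  have h3 : helixFactor r τ = 1 - sgn τ * (((r ^ 2)⁻¹ : (ZMod n)ˣ) : ZMod n) := rfl
  generalize (((r ^ 2)⁻¹ : (ZMod n)ˣ) : ZMod n) = x at h3 ⊢
  generalize helixFactor r τ = δ at *
  generalize ((sgn τ : ℤ) : ZMod n) = t at *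
  have h4 : x = t * (1 - δ) := by rw [h3]; linear_combination -x * hs
  rw [h4]
  linear_combination δ * (1 - δ) ^ 2 * hs + (δ - 2) * hδ

/-- After `m` turns of the helix all coordinates return to their values: `2 (1 ∓ ρ⁻¹) = 0`, and `m`
is even unless `n` is odd. -/
theorem nsmul_helixVec (hN : CPMNormalized m n) (hρ : 2 * (r : ZMod n) ^ 2 = 2 * sgn τ) (g : ℤ) :
    m • helixVec r τ g = 0 := by
  have h2 := two_mul_helixFactor hρ
  have : m • helixFactor r τ = 0 := by
    rcases Nat.even_or_odd m with ⟨k, rfl⟩ | hm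
    · rw [nsmul_eq_mul]; push_cast; linear_combination (k : ZMod n) * h2
    · have hodd : Odd n := by
        rw [← Nat.not_even_iff_odd]
        exact fun h => (Nat.not_even_iff_odd.2 hm) (hN.2 h)
      have hu : IsUnit (2 : ZMod n) := isUnit_two_of_odd hodd
      rw [hu.mul_right_eq_zero.1 h2, smul_zero]
  rw [helixVec_eq, ← smul_assoc, this, zero_smul]

theorem path_helix (hN : CPMNormalized m n) (hρ : 2 * (r : ZMod n) ^ 2 = 2 * sgn τ)
    (y : Cover 2 n) (k : ℕ) :
    path r y (fun k => (false, helixSign τ k)) (4 * k) =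
      (y.1 - 4 * k, y.2 + k • (helixVec r τ (y.1 - 1) + helixVec r τ (y.1 - 2))) := by
  have hv : ∀ (g : ℤ) (k : ℕ), helixVec r τ (g - 4 * k) = helixVec r τ g := by
    intro g k
    induction k with
    | zero => simp
    | succ k ih =>
      rw [← ih, ← helixVec_sub_four hN hρ (g - 4 * k)]
      congr 1
      push_cast
      ring
  induction k with
  | zero => simp [path]
  | succ k ih =>
    have s0 : helixSign τ (4 * k) = true := by simp [helixSign]
    have s1 : helixSign τ (4 * k + 1) = true := by
      have : (4 * k + 1) % 4 = 1 := by omega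
      simp [helixSign, this]
    have s2 : helixSign τ (4 * k + 2) = !τ := by rw [helixSign_add_two, s0, Bool.true_xor]
    have s3 : helixSign τ (4 * k + 3) = !τ := by
      rw [show 4 * k + 3 = 4 * k + 1 + 2 by ring, helixSign_add_two, s1, Bool.true_xor]
    rw [show 4 * (k + 1) = 4 * k + 1 + 1 + 1 + 1 by ring, path, path, path, path, ih]
    rw [show 4 * k + 1 + 1 + 1 = 4 * k + 3 by ring, show 4 * k + 1 + 1 = 4 * k + 2 by ring,
      s0, s1, s2, s3]
    refine Prod.ext ?_ ?_
    · simp [move, sgn]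
      ring
    · have h1 := hv (y.1 - 1) k
      have h2 := hv (y.1 - 2) k
      rw [add_smul, one_smul, ← h1, ← h2]
      simp only [move, gap, sgn_not, helixVec, show sgn true = 1 from rfl,
        show sgn false = -1 from rfl, Bool.false_eq_true, if_false]
      rw [show y.1 - 4 * (k : ℤ) + -1 + -1 + -1 - 1 = y.1 - 2 - 4 * k - 2 by ring,
        show y.1 - 4 * (k : ℤ) + -1 + -1 - 1 = y.1 - 1 - 4 * k - 2 by ring,
        show y.1 - 4 * (k : ℤ) + -1 - 1 = y.1 - 2 - 4 * k by ring,
        show y.1 - 4 * (k : ℤ) - 1 = y.1 - 1 - 4 * k by ring, one_smul, one_smul, neg_smul,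
        neg_smul]
      abel

/-- A walk that makes two steps forth and two steps back, the first and the fourth step in one layer
and the other two in the next. -/
theorem path_meander (y : Cover 2 n) {g : ℕ → Letter} {x : Bool}
    (hg : ∀ j, g (4 * j) = (false, true) ∧ g (4 * j + 1) = (true, true) ∧
      g (4 * j + 2) = (true, x) ∧ g (4 * j + 3) = (false, x)) (k : ℕ) :
    path r y g (4 * k) =
      (y.1, y.2 + (2 * k) • (edgeVec 2 r (y.1 - 1) + sgn x • edgeVec 2 r y.1)) := by
  induction k with
  | zero => simp [path]
  | succ k ih =>
    obtain ⟨h0, h1, h2, h3⟩ := hg k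
    rw [show 4 * (k + 1) = 4 * k + 1 + 1 + 1 + 1 by ring, path, path, path, path, ih]
    rw [show 4 * k + 1 + 1 + 1 = 4 * k + 3 by ring, show 4 * k + 1 + 1 = 4 * k + 2 by ring,
      h0, h1, h2, h3]
    refine Prod.ext ?_ ?_
    · simp [move, sgn]
    · rw [mul_add, mul_one, add_smul _ 2, two_smul]
      simp only [move, gap, if_true, Bool.false_eq_true, if_false]
      simp only [sgn, if_true, Bool.false_eq_true, if_false,
        add_sub_cancel_right, ← sub_eq_add_neg, sub_add_cancel, one_smul]
      abel

/-- The helix corresponds to a walk that stays between three layers. -/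
theorem ShapeCounts.addOrderOf_dvd (S : ShapeCounts m r τ) (P : CPMParams m 2 n r)
    (hN : CPMNormalized m n) (hρ : 2 * (r : ZMod n) ^ 2 = 2 * sgn τ)
    (T : Twisted (s := 2) m r) : addOrderOf (2 : ZMod n) ∣ m := by
  obtain ⟨R, p, C', hw'⟩ := T
  have C := C'.symm
  have hw := hw'.symm
  obtain ⟨g, hg⟩ := C.exists_path hw.1 (fun k => (false, helixSign τ k))
  have hg0 : g 0 = (false, true) := by
    have h1 := hg 1
    simp only [path, show helixSign τ 0 = true by simp [helixSign]] at h1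
    exact C.letter_unique P h1 hw.2.1
  have hg1 : g 1 = (true, true) := by
    have h2 := hg 2
    simp only [path, hg0, show helixSign τ 0 = true by simp [helixSign],
      show helixSign τ 1 = true by simp [helixSign]] at h2
    exact C.letter_unique P h2 hw.2.2
  have hinv : ∀ k, g (k + 1) ≠ inv (g k) := fun k e => by
    have := (C.path_inv P P hg k).2 e
    simp [inv] at this
  have c3 : ∀ k, 1 ≤ cnt m 2 r 3 [g k, g (k + 1), g (k + 2)] := by
    intro k
    have := C.cnt_eq P P 3 (y := path r p _ k) (y' := path r p g k)
      (q := [(false, helixSign τ k), (false, helixSign τ (k + 1)), (false, helixSign τ (k + 2))])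
      (q' := [g k, g (k + 1), g (k + 2)]) ⟨hg k, hg (k + 1), hg (k + 2), hg (k + 3)⟩
    rw [← this, helixSign_add_two]
    exact S.helix_pos _ _
  have c4 : ∀ k, cnt m 2 r 2 [g k, g (k + 1), g (k + 2), g (k + 3)] ≤ 0 := by
    intro k
    have := C.cnt_eq P P 2 (y := path r p _ k) (y' := path r p g k)
      (q := [(false, helixSign τ k), (false, helixSign τ (k + 1)), (false, helixSign τ (k + 2)),
        (false, helixSign τ (k + 3))])
      (q' := [g k, g (k + 1), g (k + 2), g (k + 3)])
      ⟨hg k, hg (k + 1), hg (k + 2), hg (k + 3), hg (k + 4)⟩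
    rw [← this, show k + 3 = k + 1 + 2 by ring, helixSign_add_two, helixSign_add_two]
    exact S.helix_eq_zero _ _
  have sign_of : ∀ (k : ℕ) (d b : Bool), g k = (!d, b) → (g (k + 1)).1 = d →
      g (k + 1) = (d, b) := by
    intro k d b h1 h2
    have h3 := hinv k
    rw [h1] at h3
    exact eq_of_ne_inv _ _ _ h2 h3
  have turn : ∀ (k : ℕ) (d b : Bool), g k = (d, b) → g (k + 1) = (!d, b) → (g (k + 2)).1 = !d := by
    intro k d b h1 h2
    by_contra h3
    have h4 := sign_of (k + 1) d b h2 (by simpa using h3)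
    have h5 := c3 k
    rw [h1, h2, h4] at h5
    have := S.zigzag_eq_zero d b
    omega
  have step : ∀ (k : ℕ) (d b x : Bool), g k = (d, b) → g (k + 1) = (!d, b) → g (k + 2) = (!d, x) →
      g (k + 3) = (d, x) ∧ g (k + 4) = (d, b) := by
    intro k d b x h0 h1 h2
    have h3 : g (k + 3) = (d, x) := by
      refine sign_of (k + 2) d x h2 ?_
      by_contra hne
      replace hne : ¬ (g (k + 3)).1 = d := hne
      have h3 : g (k + 3) = (!d, (g (k + 3)).2) := Prod.ext (Bool.eq_not_iff.2 hne) rfl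
      have e3 := c3 (k + 1)
      have e4 := c4 k
      rw [show k + 1 + 1 = k + 2 by ring, show k + 1 + 2 = k + 3 by ring, h1, h2, h3] at e3
      rw [h0, h1, h2, h3] at e4
      rcases S.straight d b x (g (k + 3)).2 with h | h <;> omega
    refine ⟨h3, ?_⟩
    have h4 := turn (k + 2) (!d) x h2 (by simpa using h3)
    rw [Bool.not_not] at h4
    have e4 := c4 (k + 1)
    rw [show k + 1 + 1 = k + 2 by ring, show k + 1 + 2 = k + 3 by ring,
      show k + 1 + 3 = k + 4 by ring, h1, h2, h3] at e4
    have e5 := S.square_pos d b x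
    by_contra hne
    have : g (k + 4) = (d, !b) := by
      refine Prod.ext h4 ?_
      by_contra hne'
      exact hne (Prod.ext h4 (by simpa using hne'))
    rw [this] at e4
    omega
  obtain ⟨x, hg2⟩ : ∃ x, g 2 = (true, x) := ⟨_, Prod.ext (turn 0 false true hg0 hg1) rfl⟩
  have hall : ∀ j, g (4 * j) = (false, true) ∧ g (4 * j + 1) = (true, true) ∧
      g (4 * j + 2) = (true, x) ∧ g (4 * j + 3) = (false, x) := by
    have h3 : ∀ j, g (4 * j) = (false, true) ∧ g (4 * j + 1) = (true, true) ∧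
        g (4 * j + 2) = (true, x) := by
      intro j
      induction j with
      | zero => exact ⟨hg0, hg1, hg2⟩
      | succ j ih =>
        obtain ⟨h0, h1, h2⟩ := ih
        obtain ⟨h3, h4⟩ := step (4 * j) false true x h0 h1 h2
        obtain ⟨h5, h6⟩ := step (4 * j + 2) true x true h2 h3 h4
        exact ⟨h4, h5, h6⟩
    intro j
    obtain ⟨h0, h1, h2⟩ := h3 j
    exact ⟨h0, h1, h2, (step (4 * j) false true x h0 h1 h2).1⟩
  have h0 : proj m (path r p (fun k => (false, helixSign τ k)) (4 * m)) = proj m p := by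
    rw [path_helix hN hρ, proj_eq_iff]
    refine ⟨⟨2, by push_cast; ring⟩, ?_⟩
    rw [smul_add, nsmul_helixVec hN hρ, nsmul_helixVec hN hρ, add_zero, add_zero]
  have h1 := (C.proj_iff (hg _) hw.1).1 h0
  rw [proj_eq_iff, path_meander p hall] at h1
  have h2 := congrFun h1.2 (idx P (p.1 - 1))
  have hne : idx P (p.1 - 1) ≠ idx P p.1 := by
    rw [Ne, idx_eq_iff]
    omega
  simp only [Pi.add_apply, Pi.smul_apply] at h2
  rw [edgeVec_apply_self P, edgeVec_apply_of_ne P _ _ hne, smul_zero, add_zero, add_eq_left,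
    nsmul_eq_mul, Units.mul_left_eq_zero] at h2
  rw [addOrderOf_dvd_iff_nsmul_eq_zero, nsmul_eq_mul]
  push_cast at h2
  linear_combination h2

theorem shapePolys_ne_zero (P : CPMParams m 2 n r) (hN : CPMNormalized m n) (h3 : n ≠ 3)
    (hρ : 2 * (r : ZMod n) ^ 2 = 2 * sgn τ) :
    ∀ f ∈ shapePolys τ, pe ((r ^ 2 : (ZMod n)ˣ) : ZMod n) f ≠ 0 := by
  have h1 := one_ne_zero_of P
  have h2 := two_ne_zero_of P
  have h4 := four_ne_zero_of P
  have hn3 := P.three_le_n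
  have h6 : (6 : ZMod n) ≠ 0 := by
    intro e
    have hd : n ∣ 6 := dvd_of_natCast_eq_zero (by exact_mod_cast e)
    have := Nat.le_of_dvd (by norm_num) hd
    have h6 : n = 6 := by interval_cases n <;> omega
    rw [h6] at hN
    rcases hN.1 with h | h
    · exact absurd h (by decide)
    · omega
  have h3 : (3 : ZMod n) ≠ 0 := fun e => h6 (by linear_combination 2 * e)
  have h5 : pe ((r ^ 2 : (ZMod n)ˣ) : ZMod n) (if τ then [2, 2] else [2, -2]) ≠ 0 := by
    cases τ <;> simp [pe, sgn] at hρ ⊢ <;> intro e <;> apply h4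
    · linear_combination e + hρ
    · linear_combination e - hρ
  simp only [List.forall_mem_cons]
  refine ⟨?_, ?_, ?_, ?_, ?_, h5, by simp⟩ <;> simpa [pe]

/-- With two coordinates and `2 r ^ 2 = ±2`, a twist forces `m` to be the additive order of `2`. -/
theorem Twisted.eq_addOrderOf (P : CPMParams m 2 n r) (hN : CPMNormalized m n)
    (hρ : 2 * (r : ZMod n) ^ 2 = 2 * sgn τ) (T : Twisted (s := 2) m r) :
    m = addOrderOf (2 : ZMod n) := by
  have hZ : pe ((r ^ 2 : (ZMod n)ˣ) : ZMod n) (if τ then [2, -2] else [2, 2]) = 0 := by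
    cases τ <;> simp [pe, sgn] at hρ ⊢
    · linear_combination hρ
    · linear_combination -hρ
  have h3 := P.three_le_ms
  by_cases hdir : m = 2 ∧ (r ^ 2 = 1 ∨ r ^ 2 = -1)
  · obtain ⟨rfl, hdir⟩ := hdir
    obtain ⟨z, hz, hz0⟩ := exists_direct_poly hdir
    have hc := arcCheck_two_two z hz
    exact ((Profile.of_min (M := 4) (S := 2) (by norm_num) (by norm_num) (by norm_num)).false_of_arc
      P T 2 (by norm_num) (small_ne_zero P) hz0 hc.1 hc.2).elim
  have hm9 : 4 < m → ((min (m * 2) 9 : ℕ) : ℤ) = 9 := fun h => by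
    rw [min_eq_right (by omega)]; rfl
  have hM : ((min (m * 2) 9 : ℕ) : ℤ) = 4 ∧ m = 2 ∨ ((min (m * 2) 9 : ℕ) : ℤ) = 6 ∧ m = 3 ∨
      ((min (m * 2) 9 : ℕ) : ℤ) ∈ [(8 : ℤ), 9] := by
    rcases lt_or_ge 4 m with h4 | h4
    · simp [hm9 h4]
    · interval_cases m <;> simp at h3 ⊢
  by_cases hn : n = 3
  · subst hn
    rcases hM with ⟨-, rfl⟩ | ⟨-, rfl⟩ | hM
    · refine absurd ⟨rfl, ?_⟩ hdir
      have : ∀ r : (ZMod 3)ˣ, r ^ 2 = 1 ∨ r ^ 2 = -1 := by decide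
      exact this r
    · refine ((addOrderOf_eq_prime (p := 3) ?_ ?_)).symm <;> decide
    · have H : Profile m 2 _ 2 := .of_min (by norm_num) rfl (by norm_num)
      have hc := someDownCheck_of_three _ hM τ
      refine (H.false_of_some_down P T (F := [[1], [2], [4], if τ then [2, 2] else [2, -2]]) 3
        (by norm_num) ?_ ?_ hc.1 hc.2).elim
      · simp only [List.forall_mem_cons]
        refine ⟨by simp [pe], by simp [pe, two_ne_zero_of P], by simp [pe, four_ne_zero_of P], ?_,
          by simp⟩
        cases τ <;> simp [pe, sgn] at hρ ⊢ <;> intro e <;> apply four_ne_zero_of P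
        · linear_combination e + hρ
        · linear_combination e - hρ
      · simp only [List.forall_mem_cons]
        exact ⟨by simp [pe]; decide, hZ, by simp⟩
  · have hF := shapePolys_ne_zero P hN hn hρ
    have S : ShapeCounts m r τ := by
      rcases hM with ⟨hM, hm⟩ | ⟨hM, hm⟩ | hM
      · have H : Profile m 2 4 2 := .of_min (by norm_num) hM (by norm_num)
        refine H.shapeCounts (E := [[1, 1], [1, -1]]) (by simp) ?_ (by simpa using hZ)
        exact List.forall_mem_append.2 ⟨hF, direct_poly_ne_zero fun h => hdir ⟨hm, h⟩⟩
      · have H : Profile m 2 6 2 := .of_min (by norm_num) hM (by norm_num)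
        refine H.shapeCounts (E := sixPolys) (by simp) ?_ (by simpa using hZ)
        refine List.forall_mem_append.2 ⟨hF, ?_⟩
        have hodd : Odd n := by
          rw [← Nat.not_even_iff_odd]
          intro h
          have := hN.2 h
          rw [hm] at this
          exact absurd this (by decide)
        have hu : IsUnit (2 : ZMod n) := isUnit_two_of_odd hodd
        have hρ' : (r : ZMod n) ^ 2 = sgn τ := hu.mul_left_cancel hρ
        have k1 := one_ne_zero_of P
        have k3 : (3 : ZMod n) ≠ 0 := by simpa [pe] using hF [3] (by simp)
        simp only [List.forall_mem_cons]
        cases τ <;> simp [pe, sgn] at hρ' ⊢ <;> rw [hρ'] <;> ring_nf <;> simp [k1, k3]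
      · have H : Profile m 2 _ 2 := .of_min (by norm_num) rfl (by norm_num)
        refine H.shapeCounts (E := []) ?_ (by simpa using hF) (by simpa using hZ)
        simp only [List.mem_cons, List.not_mem_nil, or_false] at hM
        rcases hM with hM | hM <;> rw [hM] <;> simp
    exact Nat.dvd_antisymm (S.dvd_addOrderOf P T) (S.addOrderOf_dvd P hN hρ T)

end

/-! ### Twists are rare -/

section
variable {m s n : ℕ} {r : (ZMod n)ˣ}

/-- A twist exists only if there are two coordinates, `2 r ^ 2 = ±2`, and `m` is the additive order
of `2`. -/
theorem Twisted.classification (P : CPMParams m s n r) (hN : CPMNormalized m n)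
    (T : Twisted (s := s) m r) :
    s = 2 ∧ (∃ τ, 2 * (r : ZMod n) ^ 2 = 2 * sgn τ) ∧ m = addOrderOf (2 : ZMod n) := by
  have h2 := P.two_le_s
  rcases lt_or_ge 4 s with h | h
  · exact absurd T (not_twisted_of_five_le P h)
  · interval_cases s
    · have hτ : ∃ τ, 2 * (r : ZMod n) ^ 2 = 2 * sgn τ := by
        by_contra hne
        push Not at hne
        have h1 := hne true
        have h1' := hne false
        simp [sgn] at h1 h1'
        exact not_twisted_two_of_generic P hN h1 h1' T
      obtain ⟨τ, hτ⟩ := hτ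
      exact ⟨rfl, ⟨τ, hτ⟩, T.eq_addOrderOf P hN hτ⟩
    · exact absurd T (not_twisted_of_eq_three P)
    · exact absurd T (not_twisted_of_eq_four P)

end

/-! ### Directions of corresponding moves -/

section
variable {m s n m' s' n' : ℕ} {r : (ZMod n)ˣ} {r' : (ZMod n')ˣ}
variable {R : Cover s n → Cover s' n' → Prop}

/-- If the two moves up from a vertex correspond to moves in different directions, then the
reflection of the second cover that only reverses the coordinate of the move up induces a twist of
the first cover. -/
theorem Corr.twisted (C : Corr m m' r r' R) (P : CPMParams m s n r) (P' : CPMParams m' s' n' r')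
    {y : Cover s n} {y' : Cover s' n'} (h : R y y') {e o i : Bool}
    (h₁ : R (move r y (true, e)) (move r' y' (true, o)))
    (h₂ : R (move r y (true, !e)) (move r' y' (false, i))) : Twisted (s := s) m r := by
  let χ : Fin s' → Bool := fun j => decide (j = idx P' y'.1)
  have F := corr_reflect P' χ y'.2
  -- The conjugate of the reflection by the correspondence.
  have D := (C.comp F).comp C.symm
  have hfix : reflect χ y'.2 y' = y' := by
    refine Prod.ext rfl (funext fun j => ?_)
    simp only [reflect]
    split_ifs <;> ring
  have hup : move r' y' (true, !o) = reflect χ y'.2 (move r' y' (true, o)) := by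
    rw [← move_reflect P' χ y'.2 y' true o, hfix]
    simp [χ, gap]
  have hdown : move r' y' (false, i) = reflect χ y'.2 (move r' y' (false, i)) := by
    have hne : idx P' (y'.1 - 1) ≠ idx P' y'.1 := by
      rw [Ne, idx_eq_iff]
      intro hd
      have h1 : (s' : ℤ) ∣ 1 := by simpa using hd
      have := Int.le_of_dvd (by norm_num) h1
      have := P'.two_le_s
      omega
    rw [← move_reflect P' χ y'.2 y' false i, hfix]
    simp [χ, gap, hne]
  obtain ⟨⟨d, f⟩, hq⟩ := C.bwd h (true, !o)
  have hd : d = false := by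
    by_contra hd
    obtain rfl : d = true := by simpa using hd
    by_cases hf : f = e
    · subst hf
      have := C.letter_unique P' h₁ hq
      simp at this
    · obtain rfl : f = !e := Bool.eq_not_iff.2 hf
      have := C.letter_unique P' h₂ hq
      simp at this
  subst hd
  have back : move r (move r y (true, !e)) (false, e) = y := by
    have := move_inv r y (true, !e)
    simpa [inv] using this
  refine Twisted.of_signs P (p := move r y (true, !e)) (b := e) (f := f) D ⟨?_, ?_, ?_⟩
  · exact ⟨_, ⟨_, h₂, rfl⟩, by rw [← hdown]; exact h₂⟩
  · rw [back]
    exact ⟨_, ⟨_, h, rfl⟩, by rw [hfix]; exact h⟩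
  · rw [back]
    exact ⟨_, ⟨_, h₁, rfl⟩, by rw [← hup]; exact hq⟩

/-- A correspondence is directed if it preserves the directions of all moves (`d = false`) or
reverses the directions of all moves (`d = true`). -/
def Directed (r : (ZMod n)ˣ) (r' : (ZMod n')ˣ) (R : Cover s n → Cover s' n' → Prop) (d : Bool) :
    Prop :=
  ∀ {y y' a a'}, R y y' → R (move r y a) (move r' y' a') → a'.1 = (a.1 ^^ d)

theorem Directed.symm {d : Bool} (h : Directed r r' R d) :
    Directed r' r (fun y' y => R y y') d := by
  intro y' y a' a h₀ h₁
  rw [h h₀ h₁]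
  simp

/-- Without twists, the direction of the move that corresponds to a move from a given vertex only
depends on the direction of the latter. -/
theorem Corr.exists_direction (C : Corr m m' r r' R) (P : CPMParams m s n r)
    (P' : CPMParams m' s' n' r') (hT : ¬ Twisted (s := s) m r) {y : Cover s n} {y' : Cover s' n'}
    (h : R y y') :
    ∃ d : Bool, ∀ a a', R (move r y a) (move r' y' a') → a'.1 = (a.1 ^^ d) := by
  obtain ⟨σ, hσ⟩ := C.exists_perm P P' h
  have heq : ∀ a a', R (move r y a) (move r' y' a') → a' = σ a := fun a a' ha =>
    C.letter_unique P' ha (hσ a)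
  have hup : (σ (true, true)).1 = (σ (true, false)).1 := by
    by_contra hne
    have h1 := hσ (true, true)
    have h2 := hσ (true, false)
    rcases e1 : σ (true, true) with ⟨d1, x1⟩
    rcases e2 : σ (true, false) with ⟨d2, x2⟩
    rw [e1] at hne h1
    rw [e2] at hne h2
    cases d1 <;> cases d2 <;> simp at hne
    · exact hT (C.twisted P P' h (e := false) h2 h1)
    · exact hT (C.twisted P P' h (e := true) h1 h2)
  refine ⟨!(σ (true, true)).1, fun a a' ha => ?_⟩
  rw [heq a a' ha]
  have key : ∀ x y z w : Letter, x ≠ y → x ≠ z → x ≠ w → y ≠ z → y ≠ w → z ≠ w → x.1 = y.1 →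
      z.1 = (!x.1) ∧ w.1 = (!x.1) := by decide
  have hi := σ.injective
  obtain ⟨k1, k2⟩ := key (σ (true, true)) (σ (true, false)) (σ (false, true)) (σ (false, false))
    (hi.ne (by decide)) (hi.ne (by decide)) (hi.ne (by decide)) (hi.ne (by decide))
    (hi.ne (by decide)) (hi.ne (by decide)) hup
  obtain ⟨u, b⟩ := a
  cases u <;> cases b <;> simp [k1, k2, hup]

/-- Without twists, a correspondence restricts to a directed one. -/
theorem Corr.exists_directed (C : Corr m m' r r' R) (P : CPMParams m s n r)
    (P' : CPMParams m' s' n' r') (hT : ¬ Twisted (s := s) m r) {y : Cover s n} {y' : Cover s' n'}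
    (h : R y y') :
    ∃ R' : Cover s n → Cover s' n' → Prop, Corr m m' r r' R' ∧ R' y y' ∧
      ∃ d, Directed r r' R' d := by
  obtain ⟨d, hd⟩ := C.exists_direction P P' hT h
  have next : ∀ {y y'} (_ : R y y')
      (_ : ∀ a a', R (move r y a) (move r' y' a') → a'.1 = (a.1 ^^ d)) {a a'}
      (_ : R (move r y a) (move r' y' a')), ∀ b b',
      R (move r (move r y a) b) (move r' (move r' y' a') b') → b'.1 = (b.1 ^^ d) := by
    intro y y' h hd a a' ha b b' hb
    obtain ⟨d', hd'⟩ := C.exists_direction P P' hT ha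
    have h1 := hd' (inv a) (inv a') (by rw [move_inv, move_inv]; exact h)
    have h2 := hd a a' ha
    have : d' = d := by
      simp only [inv, h2] at h1
      revert h1
      cases a.1 <;> cases d <;> cases d' <;> simp
    rw [← this]
    exact hd' b b' hb
  refine ⟨fun y y' => R y y' ∧ ∀ a a', R (move r y a) (move r' y' a') → a'.1 = (a.1 ^^ d),
    ⟨?_, ?_, ?_⟩, ⟨h, hd⟩, d, ?_⟩
  · rintro y y' ⟨h, hd⟩ a
    obtain ⟨a', ha⟩ := C.fwd h a
    exact ⟨a', ha, next h hd ha⟩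
  · rintro y y' ⟨h, hd⟩ a'
    obtain ⟨a, ha⟩ := C.bwd h a'
    exact ⟨a, ha, next h hd ha⟩
  · rintro y₁ y₂ y₁' y₂' ⟨h₁, -⟩ ⟨h₂, -⟩
    exact C.proj_iff h₁ h₂
  · rintro y y' a a' ⟨-, hd⟩ ⟨ha, -⟩
    exact hd a a' ha

end

/-! ### The correspondence of an isomorphism -/

section
variable {m s n m' s' n' : ℕ} {r : (ZMod n)ˣ} {r' : (ZMod n')ˣ}

theorem mem_CPMSupp_of_adj {x z : CPMVertex m s n} (hx : x ∈ CPMSupp m s n r)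
    (h : (CPMBar m s n r).Adj x z) : z ∈ CPMSupp m s n r := by
  rw [CPMSupp, SimpleGraph.ConnectedComponent.mem_supp_iff] at hx ⊢
  rw [← hx]
  exact (SimpleGraph.ConnectedComponent.connectedComponentMk_eq_of_adj h).symm

/-- Two vertices of the covers are related if an isomorphism takes the projection of the first to
the projection of the second. -/
def isoRel (φ : CPM m s n r ≃g CPM m' s' n' r') (y : Cover s n) (y' : Cover s' n') : Prop :=
  ∃ h : proj m y ∈ CPMSupp m s n r, (φ ⟨proj m y, h⟩ : CPMVertex m' s' n') = proj m' y'

theorem corr_isoRel (P : CPMParams m s n r) (P' : CPMParams m' s' n' r')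
    (φ : CPM m s n r ≃g CPM m' s' n' r') : Corr m m' r r' (isoRel φ) := by
  refine ⟨?_, ?_, ?_⟩
  · rintro y y' ⟨h, hy⟩ a
    have hadj := (adj_proj_iff P y _).2 ⟨a, rfl⟩
    have h' := mem_CPMSupp_of_adj h hadj
    have h1 : (CPM m s n r).Adj ⟨proj m y, h⟩ ⟨proj m (move r y a), h'⟩ := hadj
    have h2 : (CPMBar m' s' n' r').Adj (φ ⟨proj m y, h⟩ : CPMVertex m' s' n')
        (φ ⟨proj m (move r y a), h'⟩ : CPMVertex m' s' n') := φ.map_rel_iff.2 h1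
    rw [hy] at h2
    obtain ⟨a', ha'⟩ := (adj_proj_iff P' y' _).1 h2
    exact ⟨a', h', ha'⟩
  · rintro y y' ⟨h, hy⟩ a'
    have hadj := (adj_proj_iff P' y' _).2 ⟨a', rfl⟩
    have hmem : proj m' y' ∈ CPMSupp m' s' n' r' := hy ▸ (φ ⟨proj m y, h⟩).2
    have h' := mem_CPMSupp_of_adj hmem hadj
    have hφ : φ ⟨proj m y, h⟩ = ⟨proj m' y', hmem⟩ := Subtype.ext hy
    obtain ⟨x, hx⟩ := φ.surjective ⟨_, h'⟩
    have h1 : (CPM m' s' n' r').Adj (φ ⟨proj m y, h⟩) (φ x) := by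
      rw [hφ, hx]
      exact hadj
    have h2 : (CPMBar m s n r).Adj (proj m y) x := φ.map_rel_iff.1 h1
    obtain ⟨a, ha⟩ := (adj_proj_iff P y _).1 h2
    refine ⟨a, ha ▸ x.2, ?_⟩
    have : (⟨proj m (move r y a), ha ▸ x.2⟩ : CPMSupp m s n r) = x := Subtype.ext ha.symm
    rw [this, hx]
  · rintro y₁ y₂ y₁' y₂' ⟨h₁, e₁⟩ ⟨h₂, e₂⟩
    rw [← e₁, ← e₂]
    constructor
    · intro h
      congr 2
      exact Subtype.ext h
    · intro h
      exact congrArg Subtype.val (φ.injective (Subtype.ext h))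

theorem exists_isoRel (P' : CPMParams m' s' n' r')
    (φ : CPM m s n r ≃g CPM m' s' n' r') : ∃ y y', isoRel φ y y' := by
  have h : proj m (0 : Cover s n) ∈ CPMSupp m s n r := by
    have : proj m (0 : Cover s n) = (0, 0) := Prod.ext (by simp [proj]) rfl
    rw [this]
    exact SimpleGraph.ConnectedComponent.connectedComponentMk_mem
  obtain ⟨y', hy'⟩ := proj_surjective P' (φ ⟨_, h⟩ : CPMVertex m' s' n')
  exact ⟨0, y', h, hy'.symm⟩

end

/-! ### Walks that go straight -/

section
variable {m s n : ℕ} {r : (ZMod n)ˣ}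

/-- The translation of the cover by a vector. -/
def translate {s n : ℕ} (w : Fin s → ZMod n) (y : Cover s n) : Cover s n := (y.1, y.2 + w)

theorem move_translate (w : Fin s → ZMod n) (y : Cover s n) (a : Letter) :
    move r (translate w y) a = translate w (move r y a) := by
  refine Prod.ext rfl ?_
  simp only [move, translate]
  abel

/-- Going back after a translation. -/
theorem path_translate_path (w : Fin s → ZMod n) (y : Cover s n) (a : Letter) (k : ℕ) :
    path r (translate w (path r y (fun _ => a) k)) (fun _ => inv a) k = translate w y := by
  induction k generalizing y with
  | zero => rfl
  | succ k ih =>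
    have h := path_add r y (fun _ => a) 1 k
    rw [add_comm] at h
    rw [h, path, show path r y (fun _ => a) 1 = move r y a from rfl, ih, move_translate, move_inv]

/-- A straight walk does not change the coordinates whose layers it does not meet. -/
theorem path_apply_of_fst_eq (P : CPMParams m s n r) {y : Cover s n} {g : ℕ → Letter} {u : Bool}
    (hg : ∀ k, (g k).1 = u) {c : ℤ} (k : ℕ)
    (hc : ∀ j : ℕ, j < k → ¬ (s : ℤ) ∣ gap (y.1 + sgn u * j) (u, true) - c) :
    (path r y g k).2 (idx P c) = y.2 (idx P c) := by
  induction k with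
  | zero => rfl
  | succ k ih =>
    have h1 := hc k (Nat.lt_succ_self k)
    have h2 : gap (path r y g k).1 (g k) = gap (y.1 + sgn u * k) (u, true) := by
      rw [path_fst_of_fst_eq hg]
      simp [gap, hg]
    simp only [path, move]
    rw [Pi.add_apply, ih fun j hj => hc j (by omega), Pi.smul_apply, h2,
      edgeVec_apply_of_ne P, smul_zero, add_zero]
    intro he
    exact h1 ((idx_eq_iff P).1 he.symm)

/-! ### The number of vertices -/

theorem two_dvd_unit_sub_one (P : CPMParams m s n r) (hN : CPMNormalized m n)
    (w : (ZMod n)ˣ) : (2 : ZMod n) ∣ w - 1 := by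
  rcases hN.1 with hodd | h4
  · have hu : IsUnit (2 : ZMod n) := isUnit_two_of_odd hodd
    exact hu.dvd
  · have : NeZero n := ⟨by have := P.three_le_n; omega⟩
    have h1 : Nat.Coprime (w : ZMod n).val n := ZMod.val_coe_unit_coprime w
    have h2 : Nat.Coprime (w : ZMod n).val 2 := h1.coprime_dvd_right (dvd_trans (by norm_num) h4)
    obtain ⟨k, hk⟩ := Nat.coprime_two_right.1 h2
    refine ⟨(k : ZMod n), ?_⟩
    have h3 : (w : ZMod n) = (((w : ZMod n).val : ℕ) : ZMod n) := by simp
    rw [h3, hk]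
    push_cast
    ring

/-- The assumption that `m` is even if `n` is even, in a form that covers both parities. -/
theorem two_dvd_m (hN : CPMNormalized m n) : (2 : ZMod n) ∣ (m : ZMod n) := by
  rcases Nat.even_or_odd n with h | h
  · obtain ⟨k, rfl⟩ := hN.2 h
    exact ⟨k, by push_cast; ring⟩
  · have hu : IsUnit (2 : ZMod n) := isUnit_two_of_odd h
    exact hu.dvd

/-- For `i ≥ 0`, the number of layers `0 ≤ k < i` with `k` congruent to `j` modulo `s`. -/
def layerCount (s : ℕ) (i : ℤ) (j : Fin s) : ℤ := (i + (s - 1 - (j : ℕ))) / s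

/-- The parity invariant that describes the component of `⟨0; 0⟩`. Divisibility by `2` is meant in
`ℤ/n`, so that the condition is void if `n` is odd. -/
def Balanced {s n : ℕ} (y : Cover s n) : Prop :=
  ∀ j, (2 : ZMod n) ∣ y.2 j - layerCount s y.1 j

theorem layerCount_zero (j : Fin s) : layerCount s 0 j = 0 := by
  have := j.2
  exact Int.ediv_eq_zero_of_lt (by omega) (by omega)

theorem layerCount_succ (P : CPMParams m s n r) (i : ℤ) (j : Fin s) :
    layerCount s (i + 1) j = layerCount s i j + if j = idx P i then 1 else 0 := by
  have hs : (0 : ℤ) < s := by have := P.two_le_s; omega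
  have hj := j.2
  obtain ⟨c, rfl⟩ : ∃ c, idx P c = j := by
    obtain ⟨c, hc⟩ := exists_idx_eq P 0 j
    exact ⟨_, hc⟩
  have hc : (((idx P c : Fin s) : ℕ) : ℤ) = c % s := by
    have := Int.emod_nonneg c hs.ne'
    simp only [idx]
    omega
  rw [layerCount, layerCount, hc]
  have e1 := Int.emod_add_mul_ediv c s
  have e2 := Int.emod_add_mul_ediv i s
  have b1 := Int.emod_nonneg c hs.ne'
  have b2 := Int.emod_lt_of_pos c hs
  have b3 := Int.emod_nonneg i hs.ne'
  have b4 := Int.emod_lt_of_pos i hs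
  have hiff : idx P c = idx P i ↔ c % s = i % s := by
    rw [idx_eq_iff, ← Int.emod_emod_of_dvd c dvd_rfl, Int.emod_emod_of_dvd c dvd_rfl,
      Int.emod_eq_emod_iff_emod_sub_eq_zero, Int.dvd_iff_emod_eq_zero]
  generalize c % (s : ℤ) = x at *
  generalize i % (s : ℤ) = z at *
  generalize i / (s : ℤ) = q at *
  subst e2
  have k1 : (z + s * q + 1 + (s - 1 - x)) / (s : ℤ) = q + (z + s - x) / s := by
    rw [show z + s * q + 1 + (s - 1 - x) = (z + s - x) + s * q by ring,
      Int.add_mul_ediv_left _ _ hs.ne']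
    ring
  have k2 : (z + s * q + (s - 1 - x)) / (s : ℤ) = q + (z + s - 1 - x) / s := by
    rw [show z + s * q + (s - 1 - x) = (z + s - 1 - x) + s * q by ring,
      Int.add_mul_ediv_left _ _ hs.ne']
    ring
  rw [k1, k2]
  rcases lt_trichotomy x z with h | h | h
  · rw [if_neg (fun e => h.ne (hiff.1 e))]
    rw [show z + s - x = (z - x) + s * 1 by ring, show z + s - 1 - x = (z - x - 1) + s * 1 by ring,
      Int.add_mul_ediv_left _ _ hs.ne', Int.add_mul_ediv_left _ _ hs.ne',
      Int.ediv_eq_zero_of_lt (by omega) (by omega), Int.ediv_eq_zero_of_lt (by omega) (by omega)]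
    ring
  · rw [if_pos (hiff.2 h), h, show z + s - z = (s : ℤ) by ring, Int.ediv_self hs.ne',
      Int.ediv_eq_zero_of_lt (by omega) (by omega)]
    ring
  · rw [if_neg (fun e => h.ne' (hiff.1 e)), Int.ediv_eq_zero_of_lt (by omega) (by omega),
      Int.ediv_eq_zero_of_lt (by omega) (by omega)]
    ring

theorem layerCount_add_mul (P : CPMParams m s n r) (i q : ℤ) (j : Fin s) :
    layerCount s (i + s * q) j = layerCount s i j + q := by
  have hs : (s : ℤ) ≠ 0 := by have := P.two_le_s; omega
  rw [layerCount, layerCount, ← Int.add_mul_ediv_left _ _ hs]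
  congr 1
  ring

theorem Balanced.move_up (P : CPMParams m s n r) (hN : CPMNormalized m n) (y : Cover s n)
    (b : Bool) : Balanced (move r y (true, b)) ↔ Balanced y := by
  refine forall_congr' fun j => ?_
  have key : (2 : ZMod n) ∣ (sgn b • edgeVec s r y.1) j - if j = idx P y.1 then 1 else 0 := by
    by_cases hj : j = idx P y.1
    · subst hj
      rw [if_pos rfl, Pi.smul_apply, edgeVec_apply_self P]
      have h := two_dvd_unit_sub_one P hN (r ^ y.1)
      cases b
      · have := dvd_sub (dvd_neg.2 h) (dvd_refl (2 : ZMod n))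
        convert this using 1
        simp [sgn]
        ring
      · simpa [sgn] using h
    · rw [if_neg hj, Pi.smul_apply, edgeVec_apply_of_ne P _ _ hj]
      simp
  rw [show (move r y (true, b)).2 j - ((layerCount s (move r y (true, b)).1 j : ℤ) : ZMod n) =
      (y.2 j - layerCount s y.1 j) +
        ((sgn b • edgeVec s r y.1) j - if j = idx P y.1 then 1 else 0) by
    simp only [move, gap, if_true, sgn, layerCount_succ P, Pi.add_apply]
    push_cast
    split_ifs <;> simp <;> ring]
  exact dvd_add_left key

theorem Balanced.move_iff (P : CPMParams m s n r) (hN : CPMNormalized m n) (y : Cover s n)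
    (a : Letter) : Balanced (move r y a) ↔ Balanced y := by
  obtain ⟨u, b⟩ := a
  cases u
  · have h := Balanced.move_up P hN (move r y (false, b)) (!b)
    rw [show ((true, !b) : Letter) = inv (false, b) from rfl, move_inv] at h
    exact h.symm
  · exact Balanced.move_up P hN y b

theorem Balanced.path_iff (P : CPMParams m s n r) (hN : CPMNormalized m n) (y : Cover s n)
    (f : ℕ → Letter) (k : ℕ) : Balanced (path r y f k) ↔ Balanced y := by
  induction k with
  | zero => rfl
  | succ k ih => rw [path, Balanced.move_iff P hN, ih]

theorem Balanced.of_proj_eq (P : CPMParams m s n r) (hN : CPMNormalized m n) {y y' : Cover s n}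
    (h : proj m y = proj m y') (hy : Balanced y) : Balanced y' := by
  rw [proj_eq_iff] at h
  obtain ⟨⟨q, hq⟩, h2⟩ := h
  intro j
  have h1 : y'.1 = y.1 + s * (m * q) := by
    push_cast at hq
    linear_combination hq
  rw [h1, layerCount_add_mul P, ← h2]
  push_cast
  have := dvd_sub (hy j) ((two_dvd_m hN).mul_right (q : ZMod n))
  convert this using 1
  ring

theorem proj_move_mem (P : CPMParams m s n r) {y : Cover s n} (h : proj m y ∈ CPMSupp m s n r)
    (a : Letter) : proj m (move r y a) ∈ CPMSupp m s n r :=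
  mem_CPMSupp_of_adj h ((adj_proj_iff P y _).2 ⟨a, rfl⟩)

theorem proj_path_mem (P : CPMParams m s n r) {y : Cover s n} (h : proj m y ∈ CPMSupp m s n r)
    (f : ℕ → Letter) (k : ℕ) : proj m (path r y f k) ∈ CPMSupp m s n r := by
  induction k with
  | zero => exact h
  | succ k ih => exact proj_move_mem P ih _

/-- Going up, alternating there, and going down again leads to a translate by an even multiple of a
vector `r ^ g e_ℓ`. -/
theorem proj_translate_edgeVec_mem (P : CPMParams m s n r) {y : Cover s n}
    (h : proj m y ∈ CPMSupp m s n r) (g k : ℕ) :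
    proj m (translate ((2 * k) • edgeVec s r (y.1 + g)) y) ∈ CPMSupp m s n r := by
  have h1 := proj_path_mem P h (fun _ => (true, true)) g
  have h2 := proj_path_mem P h1 (zigzag true true) (2 * k)
  have h3 : path r (path r y (fun _ => (true, true)) g) (zigzag true true) (2 * k) =
      translate ((2 * k) • edgeVec s r (y.1 + g)) (path r y (fun _ => (true, true)) g) := by
    rw [path_zigzag, path_fst_of_fst_eq (u := true) fun _ => rfl]
    simp only [translate, gap, if_true, show sgn true = 1 from rfl, one_smul, one_mul]
    rw [path_fst_of_fst_eq (u := true) fun _ => rfl]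
    simp [sgn]
  rw [h3] at h2
  have h4 := proj_path_mem P h2 (fun _ => inv (true, true)) g
  rwa [path_translate_path] at h4

theorem edgeVec_eq_single (P : CPMParams m s n r) (g : ℤ) :
    edgeVec s r g = Pi.single (idx P g) ((r ^ g : (ZMod n)ˣ) : ZMod n) := by
  funext i
  by_cases h : i = idx P g
  · subst h
    rw [edgeVec_apply_self P, Pi.single_eq_same]
  · rw [edgeVec_apply_of_ne P _ _ h, Pi.single_eq_of_ne h]

/-- The component is invariant under translations by vectors in `2 (ℤ/n)^s`. -/
theorem proj_translate_mem (P : CPMParams m s n r) {y : Cover s n}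
    (h : proj m y ∈ CPMSupp m s n r) (w : Fin s → ZMod n) :
    proj m (translate ((2 : ZMod n) • w) y) ∈ CPMSupp m s n r := by
  have hn : NeZero n := ⟨by have := P.three_le_n; omega⟩
  have hs : (0 : ℤ) < s := by have := P.two_le_s; omega
  have single : ∀ (y : Cover s n) (i : Fin s) (x : ZMod n), proj m y ∈ CPMSupp m s n r →
      proj m (translate (Pi.single i (2 * x)) y) ∈ CPMSupp m s n r := by
    intro y i x hy
    obtain ⟨c, rfl⟩ := exists_idx_eq P y.1 i
    have hc := Int.emod_add_mul_ediv c s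
    have h0 := Int.emod_nonneg c hs.ne'
    have hidx : idx P (y.1 + c) = idx P (y.1 + (c % s).toNat) := by
      rw [idx_eq_iff, Int.toNat_of_nonneg h0]
      exact ⟨c / s, by linear_combination -hc⟩
    have h1 := proj_translate_edgeVec_mem P hy (c % s).toNat
      (x * ((r ^ (-(y.1 + ((c % s).toNat : ℤ))) : (ZMod n)ˣ) : ZMod n)).val
    rw [edgeVec_eq_single P, ← hidx, ← Pi.single_smul, nsmul_eq_mul] at h1
    push_cast at h1
    rw [ZMod.natCast_zmod_val, mul_assoc, mul_assoc, ← Units.val_mul, ← zpow_add,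
      neg_add_cancel, zpow_zero, Units.val_one, mul_one] at h1
    exact h1
  have key : ∀ T : Finset (Fin s),
      proj m (translate (∑ i ∈ T, Pi.single i (2 * w i)) y) ∈ CPMSupp m s n r := by
    intro T
    induction T using Finset.induction_on with
    | empty => simpa [translate] using h
    | insert i T hi ih =>
      have := single _ i (w i) ih
      rw [Finset.sum_insert hi]
      convert this using 2
      refine Prod.ext rfl ?_
      simp only [translate]
      abel
  have := key Finset.univ
  rwa [show (∑ i, Pi.single i (2 * w i)) = (2 : ZMod n) • w from
    Finset.univ_sum_single ((2 : ZMod n) • w)] at this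

theorem mem_CPMSupp_iff (P : CPMParams m s n r) (hN : CPMNormalized m n) (y : Cover s n) :
    proj m y ∈ CPMSupp m s n r ↔ Balanced y := by
  have hms := P.three_le_ms
  have : NeZero (m * s) := ⟨by omega⟩
  have h0 : Balanced (0 : Cover s n) := fun j => by
    rw [show (0 : Cover s n).1 = 0 from rfl, layerCount_zero]
    simp
  have hp0 : proj m (0 : Cover s n) = (0, 0) := Prod.ext (by simp [proj]) rfl
  have hmem0 : proj m (0 : Cover s n) ∈ CPMSupp m s n r := by
    rw [hp0]
    exact SimpleGraph.ConnectedComponent.connectedComponentMk_mem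
  constructor
  · intro h
    have hreach : (CPMBar m s n r).Reachable (0, 0) (proj m y) := by
      rw [CPMSupp, SimpleGraph.ConnectedComponent.mem_supp_iff] at h
      exact (SimpleGraph.ConnectedComponent.exact h).symm
    rw [SimpleGraph.reachable_iff_reflTransGen] at hreach
    have key : ∀ x, Relation.ReflTransGen (CPMBar m s n r).Adj (0, 0) x →
        ∀ y, proj m y = x → Balanced y := by
      intro x hx
      induction hx with
      | refl =>
        intro y hy
        exact Balanced.of_proj_eq P hN (hp0.trans hy.symm) h0
      | @tail b c _ hadj ih =>
        intro y hy
        obtain ⟨z, hz⟩ := proj_surjective P b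
        rw [← hz, adj_proj_iff P] at hadj
        obtain ⟨a, ha⟩ := hadj
        exact Balanced.of_proj_eq P hN (ha.symm.trans hy.symm)
          ((Balanced.move_iff P hN z a).2 (ih z hz))
    exact key _ hreach y rfl
  · intro h
    -- It suffices to treat a vertex in a layer `k ≥ 0`, which is compared with the end of the walk
    -- that goes straight up from `0` to that layer.
    obtain ⟨y', hy', k, hk⟩ : ∃ y' : Cover s n, proj m y' = proj m y ∧ ∃ k : ℕ, y'.1 = k :=
      ⟨(((y.1 : ZMod (m * s)).val : ℤ), y.2), Prod.ext (by simp [proj]) rfl, _, rfl⟩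
    have hb := Balanced.of_proj_eq P hN hy'.symm h
    have hx := proj_path_mem P hmem0 (fun _ => (true, true)) k
    have hxb := (Balanced.path_iff P hN (r := r) 0 (fun _ => (true, true)) k).2 h0
    have hx1 : (path r (0 : Cover s n) (fun _ => (true, true)) k).1 = k := by
      rw [path_fst_of_fst_eq (u := true) fun _ => rfl]
      simp [sgn]
    generalize path r (0 : Cover s n) (fun _ => (true, true)) k = x at hx hxb hx1
    have hd : ∀ j, (2 : ZMod n) ∣ y'.2 j - x.2 j := fun j => by
      have := dvd_sub (hb j) (hxb j)
      rw [hk, hx1] at this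
      convert this using 1
      ring
    choose w hw using hd
    have := proj_translate_mem P hx w
    rw [← hy']
    convert this using 2
    refine Prod.ext (hk.trans hx1.symm) (funext fun j => ?_)
    simp only [translate, Pi.add_apply, Pi.smul_apply, smul_eq_mul]
    rw [← hw]
    ring

theorem card_CPMSupp (P : CPMParams m s n r) (hN : CPMNormalized m n) :
    Nat.card (CPMSupp m s n r) = m * s * addOrderOf (2 : ZMod n) ^ s := by
  have hms := P.three_le_ms
  have : NeZero (m * s) := ⟨by omega⟩
  have hmem : ∀ x : CPMVertex m s n, x ∈ CPMSupp m s n r ↔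
      ∀ j, x.2 j - (layerCount s (x.1.val : ℤ) j : ZMod n) ∈
        AddSubgroup.zmultiples (2 : ZMod n) := by
    intro x
    have hx : proj m (((x.1.val : ℤ), x.2) : Cover s n) = x := Prod.ext (by simp [proj]) rfl
    rw [← hx, mem_CPMSupp_iff P hN, hx]
    refine forall_congr' fun j => ?_
    rw [AddSubgroup.mem_zmultiples_iff]
    constructor
    · rintro ⟨c, hc⟩
      obtain ⟨c, rfl⟩ := ZMod.intCast_surjective c
      exact ⟨c, by rw [hc, zsmul_eq_mul, mul_comm]⟩
    · rintro ⟨c, hc⟩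
      exact ⟨c, by rw [← hc, zsmul_eq_mul, mul_comm]⟩
  let e : CPMSupp m s n r ≃ ZMod (m * s) × (Fin s → AddSubgroup.zmultiples (2 : ZMod n)) :=
    { toFun := fun x => (x.1.1, fun j => ⟨_, (hmem x.1).1 x.2 j⟩)
      invFun := fun z => ⟨(z.1, fun j => (z.2 j : ZMod n) +
          (layerCount s (z.1.val : ℤ) j : ZMod n)),
        (hmem _).2 fun j => by simp⟩
      left_inv := fun x => by simp
      right_inv := fun z => by simp }
  rw [Nat.card_congr e, Nat.card_prod, Nat.card_zmod, Nat.card_fun, Nat.card_fin,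
    Nat.card_zmultiples]

end

/-! ### Invariants of directed correspondences -/

section
variable {m s n m' s' n' : ℕ} {r : (ZMod n)ˣ} {r' : (ZMod n')ˣ}
variable {R : Cover s n → Cover s' n' → Prop} {d : Bool}

theorem Corr.exists_straight (C : Corr m m' r r' R) (hd : Directed r r' R d) {y : Cover s n}
    {y' : Cover s' n'} (h : R y y') (a : Letter) :
    ∃ g : ℕ → Letter, (∀ k, (g k).1 = (a.1 ^^ d)) ∧
      ∀ k, R (path r y (fun _ => a) k) (path r' y' g k) := by
  obtain ⟨g, hg⟩ := C.exists_path h (fun _ => a)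
  exact ⟨g, fun k => hd (hg k) (hg (k + 1)), hg⟩

theorem Corr.exists_zigzag (C : Corr m m' r r' R) (P : CPMParams m s n r)
    (P' : CPMParams m' s' n' r') (hd : Directed r r' R d) {y : Cover s n} {y' : Cover s' n'}
    (h : R y y') (u b : Bool) :
    ∃ b', ∀ k, R (path r y (zigzag u b) k) (path r' y' (zigzag (u ^^ d) b') k) := by
  obtain ⟨g, hg⟩ := C.exists_path h (zigzag u b)
  have hdir : ∀ k, (g k).1 = ((zigzag u b k).1 ^^ d) := fun k => hd (hg k) (hg (k + 1))
  have hinv : ∀ k, g (k + 1) ≠ inv (g k) := fun k e => by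
    have := (C.path_inv P P' hg k).2 e
    rw [zigzag_succ] at this
    simp [inv, zigzag] at this
  have heq : ∀ k, g k = zigzag (u ^^ d) (g 0).2 k := by
    intro k
    induction k with
    | zero =>
      rw [zigzag_zero]
      exact Prod.ext (by rw [hdir, zigzag_zero]) rfl
    | succ k ih =>
      have h1 : (g (k + 1)).1 = !(g k).1 := by
        rw [hdir, hdir, zigzag_succ]
        simp
      have h2 := hinv k
      rw [show g k = (!(!(g k).1), (g k).2) by simp] at h2
      rw [eq_of_ne_inv _ _ _ h1 h2, zigzag_succ, ← ih]
      exact Prod.ext rfl (by rw [ih, zigzag])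
  have hfun : g = zigzag (u ^^ d) (g 0).2 := funext heq
  exact ⟨(g 0).2, fun k => hfun ▸ hg k⟩

theorem path_zigzag_eq_translate (y : Cover s n) (u b : Bool) (k : ℕ) :
    path r y (zigzag u b) (2 * k) =
      translate ((2 * k) • sgn b • edgeVec s r (gap y.1 (u, b))) y :=
  path_zigzag y u b k

/-- The number of turns after which a zigzag closes is an invariant. -/
theorem Corr.addOrderOf_dvd (C : Corr m m' r r' R) (P : CPMParams m s n r)
    (P' : CPMParams m' s' n' r') (hd : Directed r r' R d) {y : Cover s n} {y' : Cover s' n'}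
    (h : R y y') : addOrderOf (2 : ZMod n') ∣ addOrderOf (2 : ZMod n) := by
  obtain ⟨b, hb⟩ := C.exists_zigzag P P' hd h true true
  have h1 := hb (2 * addOrderOf (2 : ZMod n))
  have hord := addOrderOf_nsmul_eq_zero (2 : ZMod n)
  rw [nsmul_eq_mul] at hord
  have h2 : path r y (zigzag true true) (2 * addOrderOf (2 : ZMod n)) = y := by
    rw [path_zigzag]
    refine Prod.ext rfl ?_
    generalize sgn true • edgeVec s r (gap y.1 (true, true)) = v
    funext i
    simp only [Pi.add_apply, Pi.smul_apply]
    rw [nsmul_eq_mul]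
    push_cast
    linear_combination v i * hord
  rw [h2, path_zigzag] at h1
  have h3 := congrFun (proj_eq_iff.1 ((C.proj_iff h1 h).1 rfl)).2
    (idx P' (gap y'.1 (true ^^ d, b)))
  simp only [Pi.add_apply, Pi.smul_apply] at h3
  rw [edgeVec_apply_self P', add_eq_left, nsmul_eq_mul, zsmul_eq_mul, ← mul_assoc,
    Units.mul_left_eq_zero] at h3
  rw [addOrderOf_dvd_iff_nsmul_eq_zero, nsmul_eq_mul]
  push_cast at h3
  cases b <;> simp [sgn] at h3
  · linear_combination h3
  · linear_combination h3

/-- The invariance of `s` and of `2 r ^ s` up to sign and inversion. The closed walk used goes up `s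
- 1` layers, makes a turn that changes the coordinate of the layer below the start, goes down again,
and undoes the change by a zigzag below the start. If `s < s'`, then the walk corresponding to the
turn changes a coordinate that no other part of the corresponding walk changes. -/
theorem Corr.eq_of_directed_of_le (C : Corr m m' r r' R) (P : CPMParams m s n r)
    (P' : CPMParams m' s' n' r') (hd : Directed r r' R d) {y : Cover s n} {y' : Cover s' n'}
    (h : R y y') (hs : s ≤ s') {κ : ℕ} (hκ : (κ : ZMod n) = (r : ZMod n) ^ s) :
    s = s' ∧ ∃ τ, 2 * ((r' ^ (sgn (!d) * s) : (ZMod n')ˣ) : ZMod n') = 2 * sgn τ * κ := by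
  have hs2 := P.two_le_s
  obtain ⟨g₁, hg₁, h₁⟩ := C.exists_straight hd h (true, true)
  obtain ⟨b, h₂⟩ := C.exists_zigzag P P' hd (h₁ (s - 1)) true true
  obtain ⟨g₃, hg₃, h₃⟩ := C.exists_straight hd (h₂ (2 * 1)) (inv (true, true))
  obtain ⟨b', h₄⟩ := C.exists_zigzag P P' hd (h₃ (s - 1)) false false
  have hend := h₄ (2 * κ)
  have hcast : ((s - 1 : ℕ) : ℤ) = s - 1 := by push_cast [Nat.cast_sub (by omega : 1 ≤ s)]; rfl
  -- The walk in the first cover is closed.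
  have hclosed : path r (path r (path r (path r y (fun _ => (true, true)) (s - 1))
      (zigzag true true) (2 * 1)) (fun _ => inv (true, true)) (s - 1)) (zigzag false false) (2 * κ)
      = y := by
    rw [path_zigzag_eq_translate _ true true, path_translate_path,
      path_fst_of_fst_eq (u := true) fun _ => rfl, path_zigzag_eq_translate]
    refine Prod.ext rfl ?_
    have he := edgeVec_sub (r := r) s (y.1 + (s - 1))
    rw [show y.1 + ((s : ℤ) - 1) - s = y.1 - 1 by ring] at he
    simp only [translate, gap, sgn, if_true, Bool.false_eq_true, if_false, hcast, one_mul, he]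
    generalize edgeVec s r (y.1 + (s - 1)) = v
    funext i
    simp only [Pi.add_apply, Pi.smul_apply]
    simp only [nsmul_eq_mul, zsmul_eq_mul, smul_eq_mul]
    have hu : (r : ZMod n) ^ s * (((r ^ s)⁻¹ : (ZMod n)ˣ) : ZMod n) = 1 := by
      rw [← Units.val_pow_eq_pow_val, Units.mul_inv]
    push_cast [hκ]
    push_cast at hu
    linear_combination -2 * v i * hu
  rw [hclosed] at hend
  have hfin := (proj_eq_iff.1 ((C.proj_iff hend h).1 rfl)).2
  -- Everything is compared in the coordinate changed by the image of the turn.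
  have hu3 : ((inv (true, true)).1 ^^ d) = !!d := by simp [inv]
  have hu4 : (false ^^ d) = !!d := by simp
  rw [Bool.true_xor] at hg₁ hfin
  rw [hu3] at hg₃
  rw [hu4] at hfin
  generalize (!d) = u at *
  have e1 := path_fst_of_fst_eq (r := r') (y := y') hg₁ (s - 1)
  have a1 := path_apply_of_fst_eq P' (r := r') (y := y') hg₁
    (c := gap (y'.1 + sgn u * (s - 1)) (u, true)) (s - 1) (fun j hj hdvd => by
      have := Int.eq_zero_of_abs_lt_dvd hdvd (by
        rw [abs_lt]
        cases u <;> simp only [gap, sgn, if_true, Bool.false_eq_true, if_false] <;>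
          constructor <;> omega)
      cases u <;> simp only [gap, sgn, if_true, Bool.false_eq_true, if_false] at this <;> omega)
  generalize path r' y' g₁ (s - 1) = w₁ at e1 a1 hfin
  rw [hcast] at e1
  rw [path_zigzag_eq_translate w₁] at hfin
  set w₂ := translate ((2 * 1) • sgn b • edgeVec s' r' (gap w₁.1 (u, b))) w₁ with hw₂
  have e2 : w₂.1 = y'.1 + sgn u * (s - 1) := by rw [← e1, hw₂, translate]
  have a2 : w₂.2 (idx P' (gap (y'.1 + sgn u * (s - 1)) (u, true))) =
      y'.2 (idx P' (gap (y'.1 + sgn u * (s - 1)) (u, true))) +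
      2 * (sgn b * ((r' ^ gap (y'.1 + sgn u * (s - 1)) (u, true) : (ZMod n')ˣ) : ZMod n')) := by
    rw [hw₂]
    simp only [translate]
    rw [Pi.add_apply, a1, Pi.smul_apply, Pi.smul_apply, e1,
      show gap (y'.1 + sgn u * (s - 1)) (u, b) = gap (y'.1 + sgn u * (s - 1)) (u, true) from rfl,
      edgeVec_apply_self P', nsmul_eq_mul, zsmul_eq_mul]
    push_cast
    ring
  clear_value w₂
  have e3 := path_fst_of_fst_eq (r := r') (y := w₂) hg₃ (s - 1)
  have a3 := path_apply_of_fst_eq P' (r := r') (y := w₂) hg₃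
    (c := gap (y'.1 + sgn u * (s - 1)) (u, true)) (s - 1) (fun j hj hdvd => by
      rw [e2] at hdvd
      have := Int.eq_zero_of_abs_lt_dvd hdvd (by
        rw [abs_lt]
        cases u <;> simp only [gap, sgn, if_true, Bool.false_eq_true, if_false, Bool.not_true,
          Bool.not_false] <;> constructor <;> omega)
      cases u <;> simp only [gap, sgn, if_true, Bool.false_eq_true, if_false, Bool.not_true,
        Bool.not_false] at this <;> omega)
  generalize path r' w₂ g₃ (s - 1) = w₃ at e3 a3 hfin
  rw [hcast, e2, sgn_not] at e3
  replace e3 : w₃.1 = y'.1 := by linarith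
  have a4 := congrFun hfin (idx P' (gap (y'.1 + sgn u * (s - 1)) (u, true)))
  rw [path_zigzag] at a4
  simp only at a4
  rw [Pi.add_apply, a3, a2, e3, add_assoc, add_eq_left, Pi.smul_apply,
    Pi.smul_apply, nsmul_eq_mul, zsmul_eq_mul] at a4
  push_cast at a4
  have hgap : gap (y'.1 + sgn u * (s - 1)) (u, true) = gap y'.1 (!u, b') + sgn u * s := by
    cases u <;> simp [gap, sgn] <;> ring
  rw [hgap] at a4
  have hne : s = s' := by
    by_contra hne
    have hni : idx P' (gap y'.1 (!u, b') + sgn u * s) ≠ idx P' (gap y'.1 (!u, b')) := by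
      rw [Ne, idx_eq_iff, add_sub_cancel_left]
      intro hdvd
      have := Int.eq_zero_of_abs_lt_dvd hdvd (by
        rw [abs_lt]
        cases u <;> simp only [sgn, if_true, Bool.false_eq_true, if_false] <;>
          constructor <;> omega)
      cases u <;> simp only [sgn, if_true, Bool.false_eq_true, if_false] at this <;> omega
    rw [edgeVec_apply_of_ne P' _ _ hni, mul_zero, mul_zero, add_zero, ← mul_assoc,
      Units.mul_left_eq_zero] at a4
    refine two_ne_zero_of P' ?_
    cases b <;> simp [sgn] at a4
    · exact a4
    · exact a4
  refine ⟨hne, ?_⟩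
  have hid : idx P' (gap y'.1 (!u, b') + sgn u * s) = idx P' (gap y'.1 (!u, b')) := by
    rw [idx_eq_iff, add_sub_cancel_left, hne]
    exact Dvd.intro_left _ rfl
  rw [hid, edgeVec_apply_self P', zpow_add, Units.val_mul, hne] at a4
  have a5 : ((r' ^ gap y'.1 (!u, b') : (ZMod n')ˣ) : ZMod n') *
      (2 * (sgn b * ((r' ^ (sgn u * s') : (ZMod n')ˣ) : ZMod n')) + 2 * κ * sgn b') = 0 := by
    linear_combination a4
  rw [Units.mul_right_eq_zero] at a5
  rw [hne]
  generalize ((r' ^ (sgn u * s') : (ZMod n')ˣ) : ZMod n') = x at a5 ⊢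
  cases b <;> cases b' <;> simp only [sgn, if_true, Bool.false_eq_true, if_false] at a5 <;>
    push_cast at a5
  · exact ⟨false, by simp only [sgn]; push_cast; linear_combination -a5⟩
  · exact ⟨true, by simp only [sgn]; push_cast; linear_combination -a5⟩
  · exact ⟨true, by simp only [sgn]; push_cast; linear_combination a5⟩
  · exact ⟨false, by simp only [sgn]; push_cast; linear_combination a5⟩

end

/-! ### Comparison of the parameters -/

section
variable {m s n m' s' n' : ℕ} {r : (ZMod n)ˣ} {r' : (ZMod n')ˣ}
variable {R : Cover s n → Cover s' n' → Prop}

/-- As `n` is odd or divisible by `4`, it is determined by the order of `2`. -/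
theorem eq_of_addOrderOf_eq (P : CPMParams m s n r) (P' : CPMParams m' s' n' r')
    (hN : CPMNormalized m n) (hN' : CPMNormalized m' n')
    (h : addOrderOf (2 : ZMod n) = addOrderOf (2 : ZMod n')) : n = n' := by
  have key : ∀ {k : ℕ}, 3 ≤ k → (Odd k ∨ 4 ∣ k) →
      (addOrderOf (2 : ZMod k) = k ∧ Odd k) ∨
        (2 * addOrderOf (2 : ZMod k) = k ∧ Even (addOrderOf (2 : ZMod k))) := by
    intro k h3 hk
    have h1 := ZMod.addOrderOf_coe 2 (show k ≠ 0 by omega)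
    rw [Nat.cast_two] at h1
    rcases hk with hk | ⟨j, rfl⟩
    · left
      have : Nat.gcd k 2 = 1 := Nat.coprime_two_right.2 hk
      rw [h1, this, Nat.div_one]
      exact ⟨rfl, hk⟩
    · right
      have : Nat.gcd (4 * j) 2 = 2 := Nat.gcd_eq_right ⟨2 * j, by ring⟩
      rw [this] at h1
      have h2 : 4 * j / 2 = 2 * j := by omega
      rw [h1, h2]
      exact ⟨by ring, even_two_mul j⟩
  rcases key P.three_le_n hN.1 with ⟨h1, h2⟩ | ⟨h1, h2⟩ <;>
    rcases key P'.three_le_n hN'.1 with ⟨h1', h2'⟩ | ⟨h1', h2'⟩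
  · omega
  · rw [← h, h1] at h2'
    exact absurd h2 (Nat.not_odd_iff_even.2 h2')
  · rw [h, h1'] at h2
    exact absurd h2' (Nat.not_odd_iff_even.2 h2)
  · omega

theorem unitCongr_rfl {n : ℕ} (r : (ZMod n)ˣ) : unitCongr rfl r = r := by
  ext
  simp [unitCongr]

/-- The relation between `r` and `r'` that a directed correspondence yields. -/
theorem eq_of_directed (C : Corr m m' r r' R) (P : CPMParams m s n r)
    (P' : CPMParams m' s' n' r') (hN : CPMNormalized m n) (hN' : CPMNormalized m' n') {d : Bool}
    (hd : Directed r r' R d) {y : Cover s n} {y' : Cover s' n'} (h : R y y') :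
    s = s' ∧ addOrderOf (2 : ZMod n) = addOrderOf (2 : ZMod n') ∧ ∃ hn : n' = n,
      ∃ τ, 2 * ((unitCongr hn r' ^ (sgn (!d) * s) : (ZMod n)ˣ) : ZMod n) =
        2 * sgn τ * (r : ZMod n) ^ s := by
  have ho := Nat.dvd_antisymm (C.symm.addOrderOf_dvd P' P hd.symm h) (C.addOrderOf_dvd P P' hd h)
  obtain rfl := eq_of_addOrderOf_eq P P' hN hN' ho
  have : NeZero n := ⟨by have := P.three_le_n; omega⟩
  have hκ : ∀ x : ZMod n, ((x.val : ℕ) : ZMod n) = x := fun x => ZMod.natCast_zmod_val x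
  have hle : s ≤ s' := by
    by_contra hlt
    have := (C.symm.eq_of_directed_of_le P' P hd.symm h (by omega) (hκ _)).1
    omega
  obtain ⟨hs, τ, hτ⟩ := C.eq_of_directed_of_le P P' hd h hle (hκ _)
  refine ⟨hs, ho, rfl, τ, ?_⟩
  rw [hκ] at hτ
  rw [unitCongr_rfl, hτ]

theorem eq_one_or_of_odd {n : ℕ} (hn : Odd n) {u : (ZMod n)ˣ} {τ : Bool}
    (h : 2 * (u : ZMod n) = 2 * sgn τ) : u = 1 ∨ u = -1 := by
  have h2 : IsUnit (2 : ZMod n) := isUnit_two_of_odd hn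
  have h3 := h2.mul_left_cancel h
  cases τ
  · right
    ext
    simpa [sgn] using h3
  · left
    ext
    simpa [sgn] using h3

/-- The parameters of isomorphic graphs. If one of the graphs has no twist, there is a directed
correspondence; otherwise the classification of the graphs with a twist applies. -/
theorem parameters_eq (P : CPMParams m s n r) (P' : CPMParams m' s' n' r')
    (hN : CPMNormalized m n) (hN' : CPMNormalized m' n')
    (φ : CPM m s n r ≃g CPM m' s' n' r') :
    m = m' ∧ s = s' ∧ ∃ hn : n' = n, ∃ τ, ∃ ε : Bool,
      2 * ((unitCongr hn r' ^ (sgn ε * s) : (ZMod n)ˣ) : ZMod n) =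
        2 * sgn τ * (r : ZMod n) ^ s := by
  have hcard := Nat.card_congr φ.toEquiv
  rw [card_CPMSupp P hN, card_CPMSupp P' hN'] at hcard
  have hn0 : NeZero n := ⟨by have := P.three_le_n; omega⟩
  have hn0' : NeZero n' := ⟨by have := P'.three_le_n; omega⟩
  have C := corr_isoRel P P' φ
  obtain ⟨y, y', h⟩ := exists_isoRel (r := r) P' φ
  by_cases hT : Twisted (s := s) m r ∧ Twisted (s := s') m' r'
  · obtain ⟨T, T'⟩ := hT
    obtain ⟨rfl, ⟨τ, hτ⟩, hm⟩ := T.classification P hN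
    obtain ⟨rfl, ⟨τ', hτ'⟩, hm'⟩ := T'.classification P' hN'
    have ho : addOrderOf (2 : ZMod n) = addOrderOf (2 : ZMod n') := by
      rw [← hm, ← hm'] at hcard
      have h3 : m ^ 3 = m' ^ 3 := by
        have : 2 * m ^ 3 = 2 * m' ^ 3 := by linear_combination hcard
        omega
      rw [← hm, ← hm']
      exact Nat.pow_left_injective (by norm_num) h3
    obtain rfl := eq_of_addOrderOf_eq P P' hN hN' ho
    refine ⟨by rw [hm, hm', ho], rfl, rfl, τ' ^^ !τ, true, ?_⟩
    rw [unitCongr_rfl, show sgn true * ((2 : ℕ) : ℤ) = ((2 : ℕ) : ℤ) from rfl, zpow_natCast,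
      Units.val_pow_eq_pow_val, hτ']
    cases τ <;> cases τ' <;> simp [sgn] at hτ ⊢ <;> simp [hτ]
  · have key : ∃ R : Cover s n → Cover s' n' → Prop, Corr m m' r r' R ∧ R y y' ∧
        ∃ d, Directed r r' R d := by
      rw [not_and_or] at hT
      rcases hT with hT | hT
      · exact C.exists_directed P P' hT h
      · obtain ⟨R, hC, hR, d, hd⟩ := C.symm.exists_directed P' P hT h
        exact ⟨fun y y' => R y' y, hC.symm, hR, d, hd.symm⟩
    obtain ⟨R, hC, hR, d, hd⟩ := key
    obtain ⟨rfl, ho, hn, τ, hτ⟩ := eq_of_directed hC P P' hN hN' hd hR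
    refine ⟨?_, rfl, hn, τ, !d, hτ⟩
    have hs := P.two_le_s
    rw [← ho] at hcard
    have h1 := Nat.eq_of_mul_eq_mul_right (pow_pos (addOrderOf_pos _) _) hcard
    exact Nat.eq_of_mul_eq_mul_right (by omega) h1

end

end CPMWord

theorem mainTheorem5 (m s n m' s' n' : ℕ) (r : (ZMod n)ˣ) (r' : (ZMod n')ˣ)
    (h : CPMParams m s n r) (h' : CPMParams m' s' n' r')
    (hN : CPMNormalized m n) (hN' : CPMNormalized m' n')
    (hiso : Nonempty (CPM m s n r ≃g CPM m' s' n' r')) :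
    m = m' ∧ s = s' ∧ ∃ hn : n' = n,
      let q : (ZMod n)ˣ := unitCongr hn r'
      (((r * q) ^ s = 1 ∨ (r * q) ^ s = -1) ∨ ((r⁻¹ * q) ^ s = 1 ∨ (r⁻¹ * q) ^ s = -1)) ∨
      (4 ∣ n ∧ Even m ∧
        ((2 * (((r * q) ^ s : (ZMod n)ˣ) + 1 : ZMod n) = 0 ∨
            2 * (((r * q) ^ s : (ZMod n)ˣ) - 1 : ZMod n) = 0) ∨
          (2 * (((r⁻¹ * q) ^ s : (ZMod n)ˣ) + 1 : ZMod n) = 0 ∨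
            2 * (((r⁻¹ * q) ^ s : (ZMod n)ˣ) - 1 : ZMod n) = 0))) := by
  obtain ⟨φ⟩ := hiso
  obtain ⟨hm, hs, hn, τ, ε, hτ⟩ := CPMWord.parameters_eq h h' hN hN' φ
  refine ⟨hm, hs, hn, ?_⟩
  intro q
  change 2 * ((q ^ (CPMWord.sgn ε * s) : (ZMod n)ˣ) : ZMod n) = _ at hτ
  have hr : ((r⁻¹ : (ZMod n)ˣ) : ZMod n) ^ s * (r : ZMod n) ^ s = 1 := by
    rw [← mul_pow, Units.inv_mul, one_pow]
  have hq : (q : ZMod n) ^ s * ((q⁻¹ : (ZMod n)ˣ) : ZMod n) ^ s = 1 := by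
    rw [← mul_pow, Units.mul_inv, one_pow]
  have hττ : ((CPMWord.sgn τ : ℤ) : ZMod n) * (CPMWord.sgn τ : ℤ) = 1 := by
    cases τ <;> simp [CPMWord.sgn]
  have key : 2 * (((r * q) ^ s : (ZMod n)ˣ) : ZMod n) = 2 * CPMWord.sgn τ ∨
      2 * (((r⁻¹ * q) ^ s : (ZMod n)ˣ) : ZMod n) = 2 * CPMWord.sgn τ := by
    cases ε
    · left
      rw [show CPMWord.sgn false * (s : ℤ) = -(s : ℤ) by simp [CPMWord.sgn], zpow_neg, zpow_natCast,
        ← inv_pow] at hτ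
      push_cast at hτ ⊢
      rw [mul_pow]
      linear_combination -CPMWord.sgn τ * (q : ZMod n) ^ s * hτ -
        2 * (r : ZMod n) ^ s * (q : ZMod n) ^ s * hττ + 2 * CPMWord.sgn τ * hq
    · right
      rw [show CPMWord.sgn true * (s : ℤ) = (s : ℤ) by simp [CPMWord.sgn], zpow_natCast] at hτ
      push_cast at hτ ⊢
      rw [mul_pow]
      linear_combination ((r⁻¹ : (ZMod n)ˣ) : ZMod n) ^ s * hτ + 2 * CPMWord.sgn τ * hr
  rcases hN.1 with hodd | h4
  · left
    exact key.imp (fun k => CPMWord.eq_one_or_of_odd hodd k)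
      fun k => CPMWord.eq_one_or_of_odd hodd k
  · right
    refine ⟨h4, hN.2 (even_iff_two_dvd.2 (dvd_trans (by norm_num) h4)), ?_⟩
    refine key.imp (fun k => ?_) fun k => ?_ <;> cases τ <;>
      simp only [CPMWord.sgn, if_true, Bool.false_eq_true, if_false] at k <;> push_cast at k ⊢
    · left; linear_combination k
    · right; linear_combination k
    · left; linear_combination k
    · right; linear_combination k
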